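/- **Setting.** For $k\ge 2$, $n\ge 0$ let $$J_k(n)=\sum_{r=1}^{k-1}2^k\int_{[0,1]^k}\frac{(1-u_1^4\cdots u_r^4)^n\,(1-u_{r+1}^4\cdots u_k^4)^n}{(1-u_1^2\cdots u_k^2)^{2n+1}}\,du_1\cdots du_k$$ be the Apéry-like numbers and $w_k(z)=\sum_{n\ge0}J_k(n)z^n$ their generating function. Let $\tau$ range over the upper half plane $\mathbb H$, $q=e^{2\pi i\tau}$, $q^a=e^{2\pi i a\tau}$, $$\theta_2=\sum_{n\in\mathbb Z}q^{(n+1/2)^2/2},\qquad \theta_3=\sum_{n\in\mathbb Z}q^{n^2/2},\qquad \theta_4=\sum_{n\in\mathbb Z}(-1)^nq^{n^2/2},\qquad t=t(\tau)=-\frac{\theta_2(\tau)^4}{\theta_4(\tau)^4},$$ so that $t(i\infty)=0$. By $w_k(t)$ we mean the holomorphic function of $\tau\in\mathbb H$ which near $i\infty$ (i.e. for $\operatorname{Im}\tau$ large, where $|t(\tau)|<1$) equals $\sum_n J_k(n)t(\tau)^n$, i.e. the analytic continuation of that series to $\mathbb H$. Write $$\int_0^q g\,\frac{dq}{q}=2\pi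 i\int_{i\infty}^{\tau}g(z)\,dz=2\pi\int_0^\infty g(\tau+is)\,ds,\qquad q\frac{d}{dq}=\frac1{2\pi i}\frac{d}{d\tau},$$ and put $$\boldsymbol G_1(\tau)=\int_0^q\!\int_0^q\!\int_0^q\theta_2^4\theta_4^4\,\frac{dq}q\frac{dq}q\frac{dq}q,\qquad W_1(t)=w_2(t)\int_0^q\!\int_0^q\Bigl(\frac{q\,dt/dq}{t}\Bigr)^{2}\frac{t}{(1-t)^2}\,\frac{dq}q\frac{dq}q .$$ Let $T=\begin{pmatrix}1&1\\0&1\end{pmatrix}$, $S=\begin{pmatrix}0&-1\\1&0\end{pmatrix}$, let $\mathfrak G(2)=\langle T^2,S\rangle\subset SL_2(\mathbb Z)$, let $\Gamma(2)$ be the principal congruence subgroup of level $2$, and let $(F|_m\gamma)(\tau)=(c\tau+d)^{-m}F(\gamma\tau)$ for $\gamma=\begin{pmatrix}a&b\\c&d\end{pmatrix}$. A holomorphic function $F$ on $\mathbb H$ is an automorphic integral of weight $m$ for $\mathfrak G(2)$ (with polynomial period functions) if for each $\gamma\in\mathfrak G(2)$ the difference $F|_m\gamma-F$ is a polynomial in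 $\tau$, and $F$ is meromorphic at the cusps, i.e. for each $\sigma\in SL_2(\mathbb Z)$, near $i\infty$, $F|_m\sigma$ is the sum of a polynomial in $\tau$ and a series $\sum_{n\ge n_0}a_nq^{n/N}$ with some $n_0\in\mathbb Z$, $N\ge1$. **Theorem 5.1.** All the iterated integrals above converge absolutely, and $\boldsymbol G_1$ is an automorphic integral of weight $-2$ for $\mathfrak G(2)$. The functions $w_2(t)$ and $w_4(t)$ on $\mathbb H$ exist and are unique; $$w_2(t)=J_2(0)\,\frac{\theta_4(\tau)^4}{\theta_3(\tau)^2},$$ and this is a form of weight $1$ for $\Gamma(2)$ with the character $\chi(\gamma)=(-1)^{(d-1)/2}$: it is holomorphic on $\mathbb H$, satisfies $w_2|_1\gamma=\chi(\gamma)w_2$ for $\gamma\in\Gamma(2)$, and is meromorphic at the cusps (for each $\sigma\in SL_2(\mathbb Z)$, near $i\infty$, $w_2|_1\sigma$ is a series $\sum_{n\ge n_0}a_nq^{n/N}$ with some $n_0\in\mathbb Z$, $N\ge1$). Moreover, for all $\tau\in\mathbb H$, $$w_4(t)=\pi^2w_2(t)+W_1(t),\qquad W_1(t)=\frac{2\pi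 i}{16\pi^2}\,w_2(t)\,\boldsymbol G_1'(\tau),$$ where $\boldsymbol G_1'=d\boldsymbol G_1/d\tau$. -/

import Mathlib

open scoped UpperHalfPlane ModularForm MatrixGroups Manifold

namespace NcHO

noncomputable section

/-! ## Apéry-like numbers -/

/-- The number `J_{r,k-r}(n)`, an integral over the unit cube `[0,1]^k`. The variables
`u_1, …, u_k` are indexed by `0, …, k-1`, so `u_1, …, u_r` are those with index `< r`. -/
def aperyTerm (k r n : ℕ) : ℝ :=
  2 ^ k * ∫ u in Set.Icc (0 : Fin k → ℝ) 1,
    (1 - ∏ i ∈ Finset.univ.filter (fun i : Fin k => (i : ℕ) < r), u i ^ 4) ^ n *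
      (1 - ∏ i ∈ Finset.univ.filter (fun i : Fin k => r ≤ (i : ℕ)), u i ^ 4) ^ n /
        (1 - ∏ i : Fin k, u i ^ 2) ^ (2 * n + 1)

/-- The Apéry-like numbers `J_k(n) = ∑_{r=1}^{k-1} J_{r,k-r}(n)`, for `k ≥ 2`. -/
def apery (k n : ℕ) : ℝ := ∑ r ∈ Finset.Ico 1 k, aperyTerm k r n

/-! ## Theta functions, with `q = exp (2πiτ)` and `q^a = exp (2πiaτ)` -/

/-- `θ₂(τ) = ∑_{n ∈ ℤ} q^{(n+1/2)²/2}`. -/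
def θ₂ (τ : ℂ) : ℂ := ∑' n : ℤ, Complex.exp (Real.pi * Complex.I * ((n : ℂ) + 1 / 2) ^ 2 * τ)

/-- `θ₃(τ) = ∑_{n ∈ ℤ} q^{n²/2}`. -/
def θ₃ (τ : ℂ) : ℂ := ∑' n : ℤ, Complex.exp (Real.pi * Complex.I * (n : ℂ) ^ 2 * τ)

/-- `θ₄(τ) = ∑_{n ∈ ℤ} (-1)^n q^{n²/2}`. -/
def θ₄ (τ : ℂ) : ℂ :=
  ∑' n : ℤ, (-1 : ℂ) ^ n * Complex.exp (Real.pi * Complex.I * (n : ℂ) ^ 2 * τ)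

/-- The modular function `t(τ) = -θ₂(τ)⁴ / θ₄(τ)⁴`, which vanishes at `i∞`. -/
def modT (τ : ℂ) : ℂ := -(θ₂ τ ^ 4 / θ₄ τ ^ 4)

/-- `f(τ) = θ₂(τ)⁴ θ₄(τ)⁴`. -/
def thetaForm (τ : ℂ) : ℂ := θ₂ τ ^ 4 * θ₄ τ ^ 4

/-! ## The operators `∫_0^q · dq/q` and `q d/dq` -/

/-- `∫_0^q g dq/q`, i.e. `2πi` times the integral of `g dz` from `i∞` to `τ`, taken along the
vertical ray `z = τ + is`, `0 < s < ∞`. -/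
def qInt (g : ℂ → ℂ) (τ : ℂ) : ℂ :=
  2 * Real.pi * ∫ s in Set.Ioi (0 : ℝ), g (τ + s * Complex.I)

/-- The integrals `∫_0^q g dq/q` converge absolutely at all points of the upper half plane. -/
def QIntegrable (g : ℂ → ℂ) : Prop :=
  ∀ τ : ℍ, MeasureTheory.IntegrableOn (fun s : ℝ => g ((τ : ℂ) + s * Complex.I)) (Set.Ioi 0)

/-- `q dg/dq = (2πi)⁻¹ dg/dτ`. -/
def qDeriv (g : ℂ → ℂ) (τ : ℂ) : ℂ := (2 * Real.pi * Complex.I)⁻¹ * deriv g τ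

/-- `G₁`, the triple `q`-integral of `θ₂⁴ θ₄⁴`. -/
def G₁ : ℂ → ℂ := qInt (qInt (qInt thetaForm))

/-- `((q dt/dq) / t)² · t / (1 - t)²`. -/
def kernel (τ : ℂ) : ℂ :=
  (qDeriv modT τ / modT τ) ^ 2 * (modT τ / (1 - modT τ) ^ 2)

/-- `W₁ = w₂ ∫_0^q ∫_0^q ((q dt/dq) / t)² · t / (1 - t)² dq/q dq/q`, as a function of `τ`. -/
def W₁ (w₂ : ℍ → ℂ) (τ : ℍ) : ℂ := w₂ τ * qInt (qInt kernel) τ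

/-! ## Generating functions as functions on the upper half plane -/

/-- `w` is the function `τ ↦ w_k(t(τ))` on the upper half plane, where
`w_k(z) = ∑_{n ≥ 0} J_k(n) z^n`: near `i∞` it is given by the (convergent) power series at
`z = t(τ)`, and elsewhere it is the analytic continuation of that function. -/
structure IsGenFun (k : ℕ) (w : ℍ → ℂ) : Prop where
  holo : MDiff w
  series : ∀ᶠ τ : ℍ in UpperHalfPlane.atImInfty,
    ‖modT τ‖ < 1 ∧ HasSum (fun n : ℕ => (apery k n : ℂ) * modT τ ^ n) (w τ)

/-! ## Automorphic forms and integrals -/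

/-- Near `i∞`, `g(τ) = ∑_{n ≥ n₀} a_n q^{n/N}` for some `N ≥ 1` and `n₀ ∈ ℤ`. -/
def HasFourierExpansion (g : ℍ → ℂ) : Prop :=
  ∃ (N : ℕ) (n₀ : ℤ) (a : ℕ → ℂ), 0 < N ∧ ∀ᶠ τ : ℍ in UpperHalfPlane.atImInfty,
    HasSum (fun n : ℕ =>
      a n * Complex.exp (2 * Real.pi * Complex.I * (((n : ℂ) + (n₀ : ℂ)) / (N : ℂ)) * τ)) (g τ)

/-- `f` is a form of weight `k` for `Γ` with multiplier `χ`: holomorphic on the upper half plane,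
meromorphic at the cusps, with `f(γτ) = χ(γ) (cτ+d)^k f(τ)` for `γ ∈ Γ`. For `Γ` of finite index
in `SL(2,ℤ)` the cusps are the points `σ∞` with `σ ∈ SL(2,ℤ)`. -/
structure IsFormWithMultiplier (Γ : Subgroup SL(2, ℤ)) (k : ℤ) (χ : SL(2, ℤ) → ℂ)
    (f : ℍ → ℂ) : Prop where
  holo : MDiff f
  slash : ∀ γ ∈ Γ, ∀ τ : ℍ, (f ∣[k] γ) τ = χ γ * f τ
  cusps : ∀ σ : SL(2, ℤ), HasFourierExpansion (f ∣[k] σ)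

/-- `F` is a (holomorphic) automorphic integral of weight `k` for `Γ` with polynomial period
functions. Meromorphy at the cusp `σ∞` means that `F|σ` is, near `i∞`, the sum of a polynomial
in `τ` and a Fourier series with finitely many negative exponents. -/
structure IsAutomorphicIntegral (Γ : Subgroup SL(2, ℤ)) (k : ℤ) (F : ℍ → ℂ) : Prop where
  holo : MDiff F
  period : ∀ γ ∈ Γ, ∃ R : Polynomial ℂ, ∀ τ : ℍ, (F ∣[k] γ) τ = F τ + R.eval (τ : ℂ)
  cusps : ∀ σ : SL(2, ℤ), ∃ P : Polynomial ℂ,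
    HasFourierExpansion (fun τ : ℍ => (F ∣[k] σ) τ - P.eval (τ : ℂ))

/-- The group `𝔊(2) = ⟨T², S⟩`. -/
def thetaGroup : Subgroup SL(2, ℤ) := Subgroup.closure {ModularGroup.T ^ 2, ModularGroup.S}

/-- The character `(a b; c d) ↦ (-1)^{(d-1)/2}` of `Γ(2)`. -/
def χ (γ : SL(2, ℤ)) : ℂ := ((ZMod.χ₄ ((γ 1 1 : ℤ) : ZMod 4) : ℤ) : ℂ)

end

end NcHO

/-!
# Generating functions of the Apéry-like numbers `J₂` and `J₄`

Everything is written in the nome `x = exp (πiτ)`, in which `θ₃ = squareSum x`,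
`θ₄ = squareSum (-x)` and `θ₂⁴ = x * pronicSum x ^ 4` are holomorphic in the unit disc, and in terms
of `λ = θ₂⁴/θ₃⁴ = nomeLambda x`, for which `t = λ/(λ-1)`.

*The Apéry-like numbers.* With `X = u₁⋯u_r` and `Y = u_{r+1}⋯u_k`, the identity
`(1 - X⁴)(1 - Y⁴) = (1 - X²Y²)² - (X² - Y²)²` shows that `J_k(n) = ∑_j (-1)^j C(n,j) A_k(j)`, where
`A_k(j)` is an integral of `(X² - Y²)^{2j} / (1 - X²Y²)^{2j+1}`. In the variables `-log X`, `-log Y`,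
summation over `r` turns `A_k(j)` into a multiple of the moment `∫₀^∞ L^{k-2} ψ_j(L) dL`, where
`ψ_j(L) = ∫₀^L sinh^{2j} / sinh^{2j+1} L` (`apery_eq`). The differential equation of `ψ_j`
(`hasDerivAt_sinhRatioDeriv`) gives `4(j+1)² A_2(j+1) = (2j+1)² A_2(j)` and
`4(j+1)² A_4(j+1) = (2j+1)² A_4(j) - 4 A_2(j)`, and the values of `ζ(2)` and `ζ(4)` give
`A_4(0) = π² A_2(0)`.

*The generating functions.* A binomial transform of coefficients is Euler's transformation of power
series (`hasSum_binomialTransform`), so that `w_k(t) = (1 - λ) ∑_j A_k(j) λ^j`. By the recurrences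
the series for `k = 2` satisfies the hypergeometric equation of the periods of the Legendre family,
and the one for `k = 4` the same equation with the former series as inhomogeneity. The equation
pulls back to `(x d/dx)²` after division by `θ₃²` (`hypergeometric_pair`), which rests on
`x dλ/dx = λ θ₄⁴` and on a Halphen type equation for the logarithmic derivative of `θ₃`
(`mul_deriv_logDerivThree`). Hence the two series are `J₂(0) θ₃²` and `J₂(0) θ₃² (π² - W)`, where
`(x d/dx)² W = θ₂⁴θ₄⁴`, and `1 - λ = θ₄⁴/θ₃⁴` yields `w₂` and `w₄`. The kernel of `W₁` is
`-θ₂⁴θ₄⁴/4` (`kernel_eq`), which identifies `W` with the double integral in `W₁` and with the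
derivative of `G₁`.

The identities between theta functions are proved from the duplication formulas
(`squareSum_sq`, `pronicSum_sq`): a suitable quotient `R` or difference `E` of the two sides
satisfies `R(x) = R(x²)` or `E(x) = 4 E(x²)`, hence is determined by its behaviour at `0`.

*Modularity.* `SL(2, ℤ)` permutes `θ₂²`, `θ₃²`, `θ₄²` up to constants and the factor of automorphy
(`exists_thetaSq_smul`), so `θ₂⁴θ₄⁴` is a form of weight `4` for `𝔊(2)`. Bol's identity
(`hasDerivAt_bol`) says that the third derivative intertwines the weights `-2` and `4`, so the
period functions of the triple integral `G₁` have vanishing third derivative. For the form `w₂` of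
weight `1` the multiplier is computed on the generators `-1`, `T²` and the transpose of `T²` of
`Γ(2)` (`thetaQuot_slash`).
-/

open Filter Topology

namespace NcHO

/-! ### Theta series in the nome -/

/-- The series `∑ x^{n²}` over `n ∈ ℤ`, which is `θ₃` in the nome `x = exp (πiτ)`. -/
noncomputable def squareSum (x : ℂ) : ℂ := ∑' n : ℤ, x ^ (n ^ 2).toNat

/-- The series `∑ x^{n² + n}` over `n ∈ ℤ`, which is `x^{-1/4} θ₂` in the nome `x = exp (πiτ)`. -/
noncomputable def pronicSum (x : ℂ) : ℂ := ∑' n : ℤ, x ^ (n ^ 2 + n).toNat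

lemma pronic_nonneg (n : ℤ) : 0 ≤ n ^ 2 + n := by
  rcases le_or_gt 0 n with h | h
  · positivity
  · nlinarith

lemma pow_toNat_mul_pow_toNat {k l : ℤ} (hk : 0 ≤ k) (hl : 0 ≤ l) (x : ℂ) :
    x ^ k.toNat * x ^ l.toNat = x ^ (k + l).toNat := by
  rw [Int.toNat_add hk hl, pow_add]

lemma sq_pow_toNat (k : ℤ) (x : ℂ) : (x ^ 2) ^ k.toNat = x ^ (2 * k).toNat := by
  rw [← pow_mul]; congr 1; omega

lemma summable_pow_natAbs_sub_one {r : ℝ} (h0 : 0 ≤ r) (h1 : r < 1) :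
    Summable fun n : ℤ => r ^ (n.natAbs - 1) := by
  have h : Summable fun n : ℕ => r ^ (n - 1) :=
    (summable_nat_add_iff 1).1 (by simpa using summable_geometric_of_lt_one h0 h1)
  rw [summable_int_iff_summable_nat_and_neg]
  simpa using h

lemma natAbs_sub_one_le_sq (n : ℤ) : n.natAbs - 1 ≤ (n ^ 2).toNat := by
  have := Int.natAbs_le_self_sq n
  omega

lemma natAbs_sub_one_le_pronic (n : ℤ) : n.natAbs - 1 ≤ (n ^ 2 + n).toNat := by
  have : (n.natAbs : ℤ) - 1 ≤ n ^ 2 + n := by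
    rcases le_or_gt 0 n with h | h
    · have : (n.natAbs : ℤ) = n := by omega
      nlinarith
    · have : (n.natAbs : ℤ) = -n := by omega
      nlinarith
  omega

lemma norm_pow_le_of_natAbs {e : ℕ} {n : ℤ} (he : n.natAbs - 1 ≤ e) {r : ℝ} (hr : r ≤ 1) {x : ℂ}
    (hx : ‖x‖ ≤ r) : ‖x ^ e‖ ≤ r ^ (n.natAbs - 1) := by
  rw [norm_pow]
  calc ‖x‖ ^ e ≤ r ^ e := by gcongr
    _ ≤ _ := pow_le_pow_of_le_one ((norm_nonneg x).trans hx) hr he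

lemma summable_norm_pow_exponent {e : ℤ → ℕ} (he : ∀ n, n.natAbs - 1 ≤ e n) {x : ℂ}
    (hx : ‖x‖ < 1) : Summable fun n : ℤ => ‖x ^ e n‖ :=
  Summable.of_nonneg_of_le (fun _ => norm_nonneg _)
    (fun n => norm_pow_le_of_natAbs (he n) hx.le le_rfl)
    (summable_pow_natAbs_sub_one (norm_nonneg x) hx)

lemma differentiableAt_tsum_pow_exponent {e : ℤ → ℕ} (he : ∀ n, n.natAbs - 1 ≤ e n) {x : ℂ}
    (hx : ‖x‖ < 1) : DifferentiableAt ℂ (fun x : ℂ => ∑' n : ℤ, x ^ e n) x := by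
  obtain ⟨r, hxr, hr⟩ := exists_between hx
  have h := Complex.differentiableOn_tsum_of_summable_norm (F := fun (n : ℤ) (x : ℂ) => x ^ e n)
    (U := Metric.ball 0 r)
    (summable_pow_natAbs_sub_one ((norm_nonneg x).trans hxr.le) hr)
    (fun n => (differentiable_id.pow _).differentiableOn) Metric.isOpen_ball
    (fun n w hw => norm_pow_le_of_natAbs (he n) hr.le (by simpa using (mem_ball_zero_iff.1 hw).le))
  exact h.differentiableAt (Metric.isOpen_ball.mem_nhds (by simpa using hxr))

lemma differentiableAt_squareSum {x : ℂ} (hx : ‖x‖ < 1) : DifferentiableAt ℂ squareSum x :=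
  differentiableAt_tsum_pow_exponent natAbs_sub_one_le_sq hx

lemma differentiableAt_pronicSum {x : ℂ} (hx : ‖x‖ < 1) : DifferentiableAt ℂ pronicSum x :=
  differentiableAt_tsum_pow_exponent natAbs_sub_one_le_pronic hx

lemma squareSum_zero : squareSum 0 = 1 := by
  rw [squareSum, tsum_eq_single 0]
  · simp
  · intro n hn
    have : 0 < n ^ 2 := by positivity
    exact zero_pow (by omega)

lemma pronicSum_zero : pronicSum 0 = 2 := by
  rw [pronicSum, tsum_eq_sum (s := {0, -1})]
  · norm_num
  · intro n hn
    simp only [Finset.mem_insert, Finset.mem_singleton, not_or] at hn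
    have : 0 < n ^ 2 + n := by
      rcases lt_or_gt_of_ne hn.1 with h | h
      · have : n ≤ -2 := by omega
        nlinarith
      · positivity
    exact zero_pow (by omega)

/-- Pairs of integers according to the parity of their sum: those with even sum are
`(s + t, s - t)`, those with odd sum `(s + t + 1, s - t)`. -/
noncomputable def paritySplit : (ℤ × ℤ) ⊕ (ℤ × ℤ) ≃ ℤ × ℤ :=
  Equiv.ofBijective
    (Sum.elim (fun p => (p.1 + p.2, p.1 - p.2)) fun p => (p.1 + p.2 + 1, p.1 - p.2)) <| by
    constructor
    · rintro (⟨s, t⟩ | ⟨s, t⟩) (⟨s', t'⟩ | ⟨s', t'⟩) h <;>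
        simp only [Sum.elim_inl, Sum.elim_inr, Prod.mk.injEq] at h
      · simp only [Sum.inl.injEq, Prod.mk.injEq]; omega
      · omega
      · omega
      · simp only [Sum.inr.injEq, Prod.mk.injEq]; omega
    · rintro ⟨m, n⟩
      rcases Int.even_or_odd (m + n) with ⟨k, hk⟩ | ⟨k, hk⟩
      · exact ⟨Sum.inl (k, m - k), by simp only [Sum.elim_inl, Prod.mk.injEq]; omega⟩
      · exact ⟨Sum.inr (k, m - k - 1), by simp only [Sum.elim_inr, Prod.mk.injEq]; omega⟩

lemma tsum_eq_tsum_even_add_tsum_odd {f : ℤ × ℤ → ℂ} (hf : Summable f) :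
    ∑' p, f p = ∑' p : ℤ × ℤ, f (p.1 + p.2, p.1 - p.2)
      + ∑' p : ℤ × ℤ, f (p.1 + p.2 + 1, p.1 - p.2) := by
  have hs : Summable (f ∘ paritySplit) := (Equiv.summable_iff paritySplit).2 hf
  rw [← paritySplit.tsum_eq f]
  exact Summable.tsum_sum (f := f ∘ paritySplit)
    (hs.comp_injective Sum.inl_injective) (hs.comp_injective Sum.inr_injective)

lemma sq_tsum_pow_exponent {e : ℤ → ℕ} (he : ∀ n, n.natAbs - 1 ≤ e n) {x : ℂ}
    (hx : ‖x‖ < 1) : (∑' n : ℤ, x ^ e n) ^ 2 =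
      ∑' p : ℤ × ℤ, x ^ e (p.1 + p.2) * x ^ e (p.1 - p.2)
      + ∑' p : ℤ × ℤ, x ^ e (p.1 + p.2 + 1) * x ^ e (p.1 - p.2) := by
  have h := summable_norm_pow_exponent he hx
  have hs : Summable fun p : ℤ × ℤ => x ^ e p.1 * x ^ e p.2 :=
    summable_mul_of_summable_norm (f := fun n => x ^ e n) (g := fun n => x ^ e n) h h
  rw [sq, tsum_mul_tsum_of_summable_norm h h, tsum_eq_tsum_even_add_tsum_odd hs]

lemma norm_sq_lt_one {x : ℂ} (hx : ‖x‖ < 1) : ‖x ^ 2‖ < 1 := by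
  rw [norm_pow]; exact pow_lt_one₀ (norm_nonneg x) hx two_ne_zero

/-- The duplication formula `θ₃(τ)² = θ₃(2τ)² + θ₂(2τ)²`. -/
lemma squareSum_sq {x : ℂ} (hx : ‖x‖ < 1) :
    squareSum x ^ 2 = squareSum (x ^ 2) ^ 2 + x * pronicSum (x ^ 2) ^ 2 := by
  have hA := summable_norm_pow_exponent natAbs_sub_one_le_sq (norm_sq_lt_one hx)
  have hB := summable_norm_pow_exponent natAbs_sub_one_le_pronic (norm_sq_lt_one hx)
  rw [squareSum, sq_tsum_pow_exponent natAbs_sub_one_le_sq hx]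
  congr 1
  · rw [squareSum, sq, tsum_mul_tsum_of_summable_norm hA hA]
    refine tsum_congr fun p => ?_
    rw [pow_toNat_mul_pow_toNat (sq_nonneg _) (sq_nonneg _),
      pow_toNat_mul_pow_toNat (sq_nonneg _) (sq_nonneg _), sq_pow_toNat]
    congr 2; ring
  · rw [pronicSum, sq (tsum _), tsum_mul_tsum_of_summable_norm hB hB, ← tsum_mul_left]
    refine tsum_congr fun p => ?_
    rw [pow_toNat_mul_pow_toNat (sq_nonneg _) (sq_nonneg _),
      pow_toNat_mul_pow_toNat (pronic_nonneg _) (pronic_nonneg _), sq_pow_toNat]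
    have h1 := pronic_nonneg p.1
    have h2 := pronic_nonneg p.2
    rw [← pow_succ']
    congr 1
    have : (p.1 + p.2 + 1) ^ 2 + (p.1 - p.2) ^ 2 = 2 * (p.1 ^ 2 + p.1 + (p.2 ^ 2 + p.2)) + 1 := by
      ring
    omega

/-- The duplication formula `θ₂(τ)² = 2 θ₂(2τ) θ₃(2τ)`. -/
lemma pronicSum_sq {x : ℂ} (hx : ‖x‖ < 1) :
    pronicSum x ^ 2 = 2 * squareSum (x ^ 2) * pronicSum (x ^ 2) := by
  have hA := summable_norm_pow_exponent natAbs_sub_one_le_sq (norm_sq_lt_one hx)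
  have hB := summable_norm_pow_exponent natAbs_sub_one_le_pronic (norm_sq_lt_one hx)
  rw [pronicSum, sq_tsum_pow_exponent natAbs_sub_one_le_pronic hx, mul_assoc, two_mul]
  congr 1
  · rw [pronicSum, squareSum, mul_comm (tsum _), tsum_mul_tsum_of_summable_norm hB hA]
    refine tsum_congr fun p => ?_
    rw [pow_toNat_mul_pow_toNat (pronic_nonneg _) (pronic_nonneg _), sq_pow_toNat, sq_pow_toNat,
      pow_toNat_mul_pow_toNat (by linarith [pronic_nonneg p.1]) (by positivity)]
    congr 2; ring
  · rw [pronicSum, squareSum, ← (Equiv.addRight (1 : ℤ)).tsum_eq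
      (fun n : ℤ => (x ^ 2) ^ (n ^ 2).toNat), tsum_mul_tsum_of_summable_norm
      (hA.comp_injective (Equiv.addRight (1 : ℤ)).injective) hB]
    refine tsum_congr fun p => ?_
    rw [pow_toNat_mul_pow_toNat (pronic_nonneg _) (pronic_nonneg _), sq_pow_toNat, sq_pow_toNat,
      pow_toNat_mul_pow_toNat (by positivity) (by linarith [pronic_nonneg p.2]),
      Equiv.coe_addRight]
    congr 2; ring

lemma squareSum_neg_sq {x : ℂ} (hx : ‖x‖ < 1) :
    squareSum (-x) ^ 2 = squareSum (x ^ 2) ^ 2 - x * pronicSum (x ^ 2) ^ 2 := by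
  rw [squareSum_sq (by simpa using hx), neg_sq]; ring

/-- Jacobi's identity `θ₃⁴ = θ₄⁴ + θ₂⁴`. -/
lemma squareSum_pow_four {x : ℂ} (hx : ‖x‖ < 1) :
    squareSum x ^ 4 = squareSum (-x) ^ 4 + x * pronicSum x ^ 4 := by
  linear_combination (squareSum x ^ 2 + squareSum (x ^ 2) ^ 2 + x * pronicSum (x ^ 2) ^ 2) *
    squareSum_sq hx - (squareSum (-x) ^ 2 + squareSum (x ^ 2) ^ 2 - x * pronicSum (x ^ 2) ^ 2) *
    squareSum_neg_sq hx - x * (pronicSum x ^ 2 + 2 * squareSum (x ^ 2) * pronicSum (x ^ 2)) *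
    pronicSum_sq hx

lemma squareSum_mul_squareSum_neg_sq {x : ℂ} (hx : ‖x‖ < 1) :
    squareSum x ^ 2 * squareSum (-x) ^ 2 = squareSum (-x ^ 2) ^ 4 := by
  rw [squareSum_sq hx, squareSum_neg_sq hx]
  linear_combination squareSum_pow_four (norm_sq_lt_one hx)

lemma tendsto_pow_two_pow {x : ℂ} (hx : ‖x‖ < 1) :
    Tendsto (fun n : ℕ => x ^ 2 ^ n) atTop (𝓝 0) :=
  (tendsto_pow_atTop_nhds_zero_of_norm_lt_one hx).comp
    (tendsto_pow_atTop_atTop_of_one_lt one_lt_two)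

lemma norm_pow_two_pow_lt_one {x : ℂ} (hx : ‖x‖ < 1) (n : ℕ) : ‖x ^ 2 ^ n‖ < 1 := by
  rw [norm_pow]; exact pow_lt_one₀ (norm_nonneg x) hx (by positivity)

/-- A zero of `θ₃` would produce zeros of `θ₄` at all the points `2ⁿτ`, which tend to `i∞`. -/
lemma squareSum_ne_zero {x : ℂ} (hx : ‖x‖ < 1) : squareSum x ≠ 0 := by
  intro h0
  have hz : ∀ n : ℕ, squareSum (-x ^ 2 ^ (n + 1)) = 0 := by
    intro n
    induction n with
    | zero =>
      have h := squareSum_mul_squareSum_neg_sq hx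
      rw [h0] at h
      simpa using h.symm
    | succ n ih =>
      have h := squareSum_mul_squareSum_neg_sq (norm_pow_two_pow_lt_one hx (n + 1))
      rw [ih, ← pow_mul, ← pow_succ] at h
      simpa using h.symm
  have hlim : Tendsto (fun n : ℕ => squareSum (-x ^ 2 ^ (n + 1))) atTop (𝓝 (squareSum 0)) := by
    have hc : ContinuousAt squareSum 0 := (differentiableAt_squareSum (by simp)).continuousAt
    refine hc.tendsto.comp ?_
    simpa using ((tendsto_pow_two_pow hx).comp (tendsto_add_atTop_nat 1)).neg
  simp only [hz, squareSum_zero] at hlim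
  exact zero_ne_one (tendsto_nhds_unique tendsto_const_nhds hlim)

lemma pronicSum_ne_zero {x : ℂ} (hx : ‖x‖ < 1) : pronicSum x ≠ 0 := by
  intro h0
  have hz : ∀ n : ℕ, pronicSum (x ^ 2 ^ n) = 0 := by
    intro n
    induction n with
    | zero => simpa using h0
    | succ n ih =>
      have hn := norm_pow_two_pow_lt_one hx n
      have h := pronicSum_sq hn
      rw [ih, ← pow_mul, ← pow_succ] at h
      have hA := squareSum_ne_zero (norm_pow_two_pow_lt_one hx (n + 1))
      simpa [hA] using h.symm
  have hlim : Tendsto (fun n : ℕ => pronicSum (x ^ 2 ^ n)) atTop (𝓝 (pronicSum 0)) :=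
    (differentiableAt_pronicSum (by simp)).continuousAt.tendsto.comp (tendsto_pow_two_pow hx)
  simp only [hz, pronicSum_zero] at hlim
  exact two_ne_zero (tendsto_nhds_unique hlim tendsto_const_nhds)

/-! ### Differential equations of the theta series -/

lemma differentiableAt_deriv_of_ball {f : ℂ → ℂ} (hf : ∀ x : ℂ, ‖x‖ < 1 → DifferentiableAt ℂ f x)
    {x : ℂ} (hx : ‖x‖ < 1) : DifferentiableAt ℂ (deriv f) x := by
  have h : DifferentiableOn ℂ f (Metric.ball 0 1) := fun y hy =>
    (hf y (mem_ball_zero_iff.1 hy)).differentiableWithinAt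
  exact (h.deriv Metric.isOpen_ball).differentiableAt
    (Metric.isOpen_ball.mem_nhds (mem_ball_zero_iff.2 hx))

lemma eventually_norm_lt_one {x : ℂ} (hx : ‖x‖ < 1) : ∀ᶠ y in 𝓝 x, ‖y‖ < 1 :=
  continuous_norm.continuousAt.eventually_lt continuousAt_const hx

/-- `x θ₃'/θ₃`, the logarithmic derivative of `θ₃` with respect to `log x`, where `x` is the
nome. -/
noncomputable def logDerivThree (x : ℂ) : ℂ := x * deriv squareSum x / squareSum x

/-- The logarithmic derivative of `θ₂ = x^{1/4} ∑ x^{n² + n}` with respect to `log x`, where `x`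
is the nome. -/
noncomputable def logDerivTwo (x : ℂ) : ℂ := 1 / 4 + x * deriv pronicSum x / pronicSum x

lemma differentiableAt_logDerivThree {x : ℂ} (hx : ‖x‖ < 1) :
    DifferentiableAt ℂ logDerivThree x :=
  (differentiableAt_id.mul (differentiableAt_deriv_of_ball
    (fun _ => differentiableAt_squareSum) hx)).div (differentiableAt_squareSum hx)
    (squareSum_ne_zero hx)

lemma differentiableAt_logDerivTwo {x : ℂ} (hx : ‖x‖ < 1) : DifferentiableAt ℂ logDerivTwo x :=
  ((differentiableAt_id.mul (differentiableAt_deriv_of_ball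
    (fun _ => differentiableAt_pronicSum) hx)).div (differentiableAt_pronicSum hx)
    (pronicSum_ne_zero hx)).const_add _

lemma mul_deriv_squareSum {x : ℂ} (hx : ‖x‖ < 1) :
    x * deriv squareSum x = logDerivThree x * squareSum x := by
  rw [logDerivThree, div_mul_cancel₀ _ (squareSum_ne_zero hx)]

lemma mul_deriv_pronicSum {x : ℂ} (hx : ‖x‖ < 1) :
    x * deriv pronicSum x = (logDerivTwo x - 1 / 4) * pronicSum x := by
  rw [logDerivTwo, add_sub_cancel_left, div_mul_cancel₀ _ (pronicSum_ne_zero hx)]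

lemma hasDerivAt_comp_sq {f : ℂ → ℂ} (hf : ∀ x : ℂ, ‖x‖ < 1 → DifferentiableAt ℂ f x)
    {x : ℂ} (hx : ‖x‖ < 1) : HasDerivAt (fun x => f (x ^ 2)) (deriv f (x ^ 2) * (2 * x)) x := by
  have h := (hf _ (norm_sq_lt_one hx)).hasDerivAt.comp x (hasDerivAt_pow 2 x)
  simpa [Function.comp_def] using h

lemma logDerivThree_duplication {x : ℂ} (hx : ‖x‖ < 1) :
    logDerivThree x * squareSum x ^ 2 = 2 * logDerivThree (x ^ 2) * squareSum (x ^ 2) ^ 2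
      + 2 * logDerivTwo (x ^ 2) * (x * pronicSum (x ^ 2) ^ 2) := by
  have hL : HasDerivAt (fun x => squareSum x ^ 2) _ x :=
    (differentiableAt_squareSum hx).hasDerivAt.pow 2
  have hR : HasDerivAt (fun x => squareSum (x ^ 2) ^ 2 + x * pronicSum (x ^ 2) ^ 2) _ x :=
    ((hasDerivAt_comp_sq (fun _ => differentiableAt_squareSum) hx).pow 2).add
      ((hasDerivAt_id x).mul ((hasDerivAt_comp_sq (fun _ => differentiableAt_pronicSum) hx).pow 2))
  have h := hL.unique (hR.congr_of_eventuallyEq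
    ((eventually_norm_lt_one hx).mono fun y hy => squareSum_sq hy))
  simp only [id] at h
  have h3 := mul_deriv_squareSum hx
  have h3' := mul_deriv_squareSum (norm_sq_lt_one hx)
  have h2' := mul_deriv_pronicSum (norm_sq_lt_one hx)
  push_cast at h
  norm_num at h
  linear_combination x / 2 * h - squareSum x * h3 + 2 * squareSum (x ^ 2) * h3'
    + 2 * x * pronicSum (x ^ 2) * h2'

lemma logDerivTwo_duplication {x : ℂ} (hx : ‖x‖ < 1) :
    logDerivTwo x = logDerivTwo (x ^ 2) + logDerivThree (x ^ 2) := by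
  have hL : HasDerivAt (fun x => pronicSum x ^ 2) _ x :=
    (differentiableAt_pronicSum hx).hasDerivAt.pow 2
  have hR : HasDerivAt (fun x => 2 * squareSum (x ^ 2) * pronicSum (x ^ 2)) _ x :=
    ((hasDerivAt_comp_sq (fun _ => differentiableAt_squareSum) hx).const_mul 2).mul
      (hasDerivAt_comp_sq (fun _ => differentiableAt_pronicSum) hx)
  have h := hL.unique (hR.congr_of_eventuallyEq
    ((eventually_norm_lt_one hx).mono fun y hy => pronicSum_sq hy))
  have h2 := mul_deriv_pronicSum hx
  have h3' := mul_deriv_squareSum (norm_sq_lt_one hx)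
  have h2' := mul_deriv_pronicSum (norm_sq_lt_one hx)
  have hb := pronicSum_ne_zero hx
  push_cast at h
  norm_num at h
  refine mul_right_cancel₀ (pow_ne_zero 2 hb) ?_
  linear_combination x / 2 * h - pronicSum x * h2 + 2 * pronicSum (x ^ 2) * h3'
    + 2 * squareSum (x ^ 2) * h2'
    - (logDerivTwo (x ^ 2) + logDerivThree (x ^ 2) - 1 / 4) * pronicSum_sq hx

/-- `q d/dq log (θ₂/θ₃) = θ₄⁴/8`. By the duplication formulas the quotient of the two sides is
invariant under `τ ↦ 2τ`, hence equal to its limit at `i∞`. -/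
lemma logDerivTwo_sub_logDerivThree {x : ℂ} (hx : ‖x‖ < 1) :
    logDerivTwo x - logDerivThree x = squareSum (-x) ^ 4 / 4 := by
  let R : ℂ → ℂ := fun x => (logDerivTwo x - logDerivThree x) / squareSum (-x) ^ 4
  have hR : ∀ x : ℂ, ‖x‖ < 1 → R x = R (x ^ 2) := by
    intro x hx
    have hx' := norm_sq_lt_one hx
    have h1 := squareSum_ne_zero (x := -x) (by simpa using hx)
    have h2 := squareSum_ne_zero (x := -x ^ 2) (by simpa using hx')
    have h3 := squareSum_ne_zero hx
    have e3 := logDerivThree_duplication hx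
    have e2 := logDerivTwo_duplication hx
    have e4 : squareSum (-x ^ 2) ^ 4 = squareSum x ^ 2 * squareSum (-x) ^ 2 :=
      (squareSum_mul_squareSum_neg_sq hx).symm
    simp only [R]
    rw [div_eq_div_iff (pow_ne_zero 4 h1) (pow_ne_zero 4 h2), e4]
    have ea := squareSum_sq hx
    have ed := squareSum_neg_sq hx
    have key : (logDerivTwo x - logDerivThree x) * squareSum x ^ 2 =
        (logDerivTwo (x ^ 2) - logDerivThree (x ^ 2)) * squareSum (-x) ^ 2 := by
      rw [ed]
      linear_combination squareSum x ^ 2 * e2 - e3 +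
        (logDerivTwo (x ^ 2) + logDerivThree (x ^ 2)) * ea
    linear_combination squareSum (-x) ^ 2 * key
  have hc : ContinuousAt R 0 := by
    refine ContinuousAt.div ((differentiableAt_logDerivTwo (by simp)).continuousAt.sub
      (differentiableAt_logDerivThree (by simp)).continuousAt) ?_ ?_
    · have : ContinuousAt squareSum (-0) := by
        simpa using (differentiableAt_squareSum (x := 0) (by simp)).continuousAt
      exact (this.comp (f := fun x : ℂ => -x) continuousAt_neg).pow 4
    · simp [squareSum_zero]
  have hit : ∀ n : ℕ, R (x ^ 2 ^ n) = R x := by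
    intro n
    induction n with
    | zero => simp
    | succ n ih => rw [← ih, hR _ (norm_pow_two_pow_lt_one hx n), ← pow_mul, ← pow_succ]
  have hlim := hc.tendsto.comp (tendsto_pow_two_pow hx)
  have hval : R x = R 0 :=
    tendsto_nhds_unique (tendsto_const_nhds.congr fun n => (hit n).symm) hlim
  have h0 : R 0 = 1 / 4 := by simp [R, logDerivTwo, logDerivThree, squareSum_zero]
  have h1 := squareSum_ne_zero (x := -x) (by simpa using hx)
  rw [h0] at hval
  simp only [R] at hval
  rw [div_eq_iff (pow_ne_zero 4 h1)] at hval
  rw [hval]; ring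

lemma differentiableAt_squareSum_neg {x : ℂ} (hx : ‖x‖ < 1) :
    DifferentiableAt ℂ (fun x => squareSum (-x)) x :=
  (differentiableAt_squareSum (x := -x) (by simpa using hx)).comp x differentiableAt_id.neg

/-- The derivative of `θ₄⁴` obtained from Jacobi's identity. -/
lemma mul_deriv_squareSum_neg_pow_four {x : ℂ} (hx : ‖x‖ < 1) :
    x * deriv (fun x => squareSum (-x) ^ 4) x =
      squareSum (-x) ^ 4 * (4 * logDerivThree x - x * pronicSum x ^ 4) := by
  have hR : HasDerivAt (fun x => squareSum x ^ 4 - x * pronicSum x ^ 4) _ x :=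
    ((differentiableAt_squareSum hx).hasDerivAt.pow 4).sub
      ((hasDerivAt_id x).mul ((differentiableAt_pronicSum hx).hasDerivAt.pow 4))
  have h := (hR.congr_of_eventuallyEq (f₁ := fun x => squareSum (-x) ^ 4)
    ((eventually_norm_lt_one hx).mono fun y hy => by
      simp only; linear_combination -squareSum_pow_four hy)).deriv
  rw [h]
  have h3 := mul_deriv_squareSum hx
  have h2 := mul_deriv_pronicSum hx
  have h23 := logDerivTwo_sub_logDerivThree hx
  have hJ := squareSum_pow_four hx
  simp only [id]
  push_cast
  norm_num
  linear_combination 4 * squareSum x ^ 3 * h3 - 4 * x * pronicSum x ^ 3 * h2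
    - 4 * x * pronicSum x ^ 4 * h23 + 4 * logDerivThree x * hJ

lemma mul_deriv_logDerivTwo_sub {x : ℂ} (hx : ‖x‖ < 1) :
    x * deriv logDerivTwo x - x * deriv logDerivThree x =
      squareSum (-x) ^ 4 * (logDerivThree x - x * pronicSum x ^ 4 / 4) := by
  have hL : HasDerivAt (fun x => logDerivTwo x - logDerivThree x) _ x :=
    (differentiableAt_logDerivTwo hx).hasDerivAt.sub (differentiableAt_logDerivThree hx).hasDerivAt
  have hR : HasDerivAt (fun x => squareSum (-x) ^ 4 / 4) _ x :=
    (((differentiableAt_squareSum_neg hx).fun_pow 4).hasDerivAt).div_const 4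
  have h := hL.unique (hR.congr_of_eventuallyEq
    ((eventually_norm_lt_one hx).mono fun y hy => logDerivTwo_sub_logDerivThree hy))
  linear_combination x * h + mul_deriv_squareSum_neg_pow_four hx / 4

lemma eq_zero_of_eq_four_mul_comp_sq {f : ℂ → ℂ} (hd : DifferentiableAt ℂ f 0) (h0 : f 0 = 0)
    (hf : ∀ x : ℂ, ‖x‖ < 1 → f x = 4 * f (x ^ 2)) {x : ℂ} (hx : ‖x‖ < 1) : f x = 0 := by
  have hit : ∀ n : ℕ, f x = (2 ^ n) ^ 2 * f (x ^ 2 ^ n) := by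
    intro n
    induction n with
    | zero => simp
    | succ n ih =>
      rw [ih, hf _ (norm_pow_two_pow_lt_one hx n), ← pow_mul x, ← pow_succ, pow_succ (2 : ℂ) n]
      ring
  obtain ⟨C, hC⟩ := hd.isBigO_sub.bound
  have hev := (tendsto_pow_two_pow hx).eventually hC
  have hlim : Tendsto (fun n : ℕ => C * (((2 ^ n : ℕ) : ℝ) ^ 2 * ‖x‖ ^ 2 ^ n)) atTop (𝓝 0) := by
    have := ((tendsto_pow_const_mul_const_pow_of_abs_lt_one 2 (r := ‖x‖) (by simpa using hx)).comp
      (tendsto_pow_atTop_atTop_of_one_lt (one_lt_two (α := ℕ)))).const_mul C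
    simpa using this
  have hle : ∀ᶠ n : ℕ in atTop, ‖f x‖ ≤ C * (((2 ^ n : ℕ) : ℝ) ^ 2 * ‖x‖ ^ 2 ^ n) := by
    filter_upwards [hev] with n hn
    rw [hit n, norm_mul]
    simp only [h0, sub_zero, norm_pow] at hn
    have : ‖((2 : ℂ) ^ n) ^ 2‖ = ((2 ^ n : ℕ) : ℝ) ^ 2 := by simp
    rw [this]
    calc ((2 ^ n : ℕ) : ℝ) ^ 2 * ‖f (x ^ 2 ^ n)‖
        ≤ ((2 ^ n : ℕ) : ℝ) ^ 2 * (C * ‖x‖ ^ 2 ^ n) := by gcongr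
      _ = _ := by ring
  have := le_of_tendsto_of_tendsto tendsto_const_nhds hlim hle
  simpa using this

/-- The Halphen-type equation for `θ₃`, with `∂ = x d/dx`: equivalently
`∂² (θ₃⁻²) = - θ₂⁴ θ₄⁴ θ₃⁻² / 4`. By the duplication formulas the difference of the two sides is a
function `E` with `E(τ) = 4 E(2τ)` that vanishes at `i∞`, so it is zero. -/
lemma mul_deriv_logDerivThree {x : ℂ} (hx : ‖x‖ < 1) :
    x * deriv logDerivThree x =
      2 * logDerivThree x ^ 2 + x * pronicSum x ^ 4 * squareSum (-x) ^ 4 / 8 := by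
  let E : ℂ → ℂ := fun x => x * deriv logDerivTwo x - 2 * logDerivTwo x ^ 2
    + squareSum x ^ 4 * squareSum (-x) ^ 4 / 8
  have hE : ∀ x : ℂ, ‖x‖ < 1 → E x = 4 * E (x ^ 2) := by
    intro x hx
    have hx' := norm_sq_lt_one hx
    have hd : deriv logDerivTwo x =
        deriv logDerivTwo (x ^ 2) * (2 * x) + deriv logDerivThree (x ^ 2) * (2 * x) := by
      have hR : HasDerivAt (fun x => logDerivTwo (x ^ 2) + logDerivThree (x ^ 2)) _ x :=
        (hasDerivAt_comp_sq (fun _ => differentiableAt_logDerivTwo) hx).add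
          (hasDerivAt_comp_sq (fun _ => differentiableAt_logDerivThree) hx)
      exact (hR.congr_of_eventuallyEq
        ((eventually_norm_lt_one hx).mono fun y hy => logDerivTwo_duplication hy)).deriv
    have e1 := mul_deriv_logDerivTwo_sub hx'
    have e2 := logDerivTwo_sub_logDerivThree hx'
    have e3 := squareSum_pow_four hx'
    have e4 := squareSum_mul_squareSum_neg_sq hx
    have e5 := logDerivTwo_duplication hx
    have e6 : logDerivTwo (x ^ 2) = logDerivThree (x ^ 2) + squareSum (-x ^ 2) ^ 4 / 4 := by
      linear_combination e2
    simp only [E]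
    rw [hd, e5, e3, show squareSum x ^ 4 * squareSum (-x) ^ 4 =
      (squareSum x ^ 2 * squareSum (-x) ^ 2) ^ 2 by ring, e4, e6]
    linear_combination -2 * e1
  have hdE : DifferentiableAt ℂ E 0 := by
    have h0 : ‖(0 : ℂ)‖ < 1 := by simp
    exact ((differentiableAt_id.mul (differentiableAt_deriv_of_ball
      (fun _ => differentiableAt_logDerivTwo) h0)).sub
      (((differentiableAt_logDerivTwo h0).pow 2).const_mul 2)).add
      ((((differentiableAt_squareSum h0).pow 4).mul
        ((differentiableAt_squareSum_neg h0).pow 4)).div_const 8)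
  have hE0 : E 0 = 0 := by simp [E, logDerivTwo, squareSum_zero]; norm_num
  have h := eq_zero_of_eq_four_mul_comp_sq hdE hE0 hE hx
  have e1 := mul_deriv_logDerivTwo_sub hx
  have e2 : logDerivTwo x = logDerivThree x + squareSum (-x) ^ 4 / 4 := by
    linear_combination logDerivTwo_sub_logDerivThree hx
  have e3 := squareSum_pow_four hx
  simp only [E] at h
  rw [e2] at h
  linear_combination h - e1 - squareSum (-x) ^ 4 / 8 * e3

/-! ### The modular function `λ` and its hypergeometric equation -/

/-- `λ = θ₂⁴/θ₃⁴` as a function of the nome. -/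
noncomputable def nomeLambda (x : ℂ) : ℂ := x * pronicSum x ^ 4 / squareSum x ^ 4

lemma nomeLambda_zero : nomeLambda 0 = 0 := by simp [nomeLambda]

lemma one_sub_nomeLambda {x : ℂ} (hx : ‖x‖ < 1) :
    1 - nomeLambda x = squareSum (-x) ^ 4 / squareSum x ^ 4 := by
  have := squareSum_ne_zero hx
  rw [nomeLambda]
  field_simp
  linear_combination squareSum_pow_four hx

lemma differentiableAt_nomeLambda {x : ℂ} (hx : ‖x‖ < 1) : DifferentiableAt ℂ nomeLambda x :=
  (differentiableAt_id.mul ((differentiableAt_pronicSum hx).pow 4)).div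
    ((differentiableAt_squareSum hx).pow 4) (pow_ne_zero 4 (squareSum_ne_zero hx))

/-- `q dλ/dq = λ θ₄⁴/2`. -/
lemma mul_deriv_nomeLambda {x : ℂ} (hx : ‖x‖ < 1) :
    x * deriv nomeLambda x = nomeLambda x * squareSum (-x) ^ 4 := by
  have ha := squareSum_ne_zero hx
  have hR : HasDerivAt nomeLambda _ x :=
    ((hasDerivAt_id x).mul ((differentiableAt_pronicSum hx).hasDerivAt.pow 4)).div
      ((differentiableAt_squareSum hx).hasDerivAt.pow 4) (pow_ne_zero 4 ha)
  rw [hR.deriv]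
  have h3 := mul_deriv_squareSum hx
  have h2 := mul_deriv_pronicSum hx
  have h23 := logDerivTwo_sub_logDerivThree hx
  simp only [id, Pi.pow_apply, Pi.mul_apply]
  rw [nomeLambda]
  push_cast
  norm_num
  field_simp
  linear_combination 4 * x * squareSum x * pronicSum x ^ 3 * h2
    - 4 * x * pronicSum x ^ 4 * h3 + 4 * x * pronicSum x ^ 4 * squareSum x * h23

lemma norm_mul_succ_le {α : ℕ → ℂ} {C : ℝ} {k : ℕ} (hα : ∀ j, ‖α j‖ ≤ C * ((j : ℝ) + 1) ^ k)
    (j : ℕ) : ‖((j : ℂ) + 1) * α (j + 1)‖ ≤ C * 2 ^ k * ((j : ℝ) + 1) ^ (k + 1) := by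
  have hC : 0 ≤ C := by
    have := (norm_nonneg _).trans (hα 0)
    simpa using this
  have hj : ‖(j : ℂ) + 1‖ = (j : ℝ) + 1 := by
    rw [← Nat.cast_succ, Complex.norm_natCast]; push_cast; ring
  rw [norm_mul, hj]
  calc ((j : ℝ) + 1) * ‖α (j + 1)‖ ≤ ((j : ℝ) + 1) * (C * (2 * ((j : ℝ) + 1)) ^ k) := by
        gcongr
        refine (hα (j + 1)).trans ?_
        push_cast
        gcongr
        linarith [j.cast_nonneg (α := ℝ)]
    _ = _ := by rw [mul_pow]; ring

lemma summable_poly_mul_geometric (C : ℝ) (k : ℕ) {r : ℝ} (h0 : 0 ≤ r) (h1 : r < 1) :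
    Summable fun j : ℕ => C * ((j : ℝ) + 1) ^ k * r ^ j := by
  rcases h0.eq_or_lt with rfl | h0
  · refine summable_of_ne_finset_zero (s := {0}) fun j hj => ?_
    simp only [Finset.mem_singleton] at hj
    simp [hj]
  have h := (summable_nat_add_iff 1).2
    (summable_pow_mul_geometric_of_norm_lt_one k (r := r) (by simpa [abs_of_pos h0] using h1))
  refine (h.mul_left (C / r)).congr fun j => ?_
  push_cast
  field_simp
  ring

lemma hasSum_powerSeries {α : ℕ → ℂ} {C : ℝ} {k : ℕ} (hα : ∀ j, ‖α j‖ ≤ C * ((j : ℝ) + 1) ^ k)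
    {z : ℂ} (hz : ‖z‖ < 1) : HasSum (fun j => α j * z ^ j) (∑' j, α j * z ^ j) := by
  refine Summable.hasSum (Summable.of_norm_bounded
    (summable_poly_mul_geometric C k (norm_nonneg z) hz) fun j => ?_)
  rw [norm_mul, norm_pow]
  gcongr
  exact hα j

lemma hasDerivAt_powerSeries {α : ℕ → ℂ} {C : ℝ} {k : ℕ}
    (hα : ∀ j, ‖α j‖ ≤ C * ((j : ℝ) + 1) ^ k) {z : ℂ} (hz : ‖z‖ < 1) :
    HasDerivAt (fun z => ∑' j, α j * z ^ j) (∑' j : ℕ, ((j : ℂ) + 1) * α (j + 1) * z ^ j) z := by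
  obtain ⟨r, hzr, hr⟩ := exists_between hz
  have hr0 : 0 ≤ r := (norm_nonneg z).trans hzr.le
  have hpos : (0 : ℝ) < r := (norm_nonneg z).trans_lt hzr
  have hsum : Summable fun j : ℕ => C * 2 ^ k * ((j : ℝ) + 1) ^ (k + 1) * r ^ j :=
    summable_poly_mul_geometric _ _ hr0 hr
  have hs' : HasDerivAt (fun z => ∑' j : ℕ, α (j + 1) * z ^ (j + 1))
      (∑' j : ℕ, ((j : ℂ) + 1) * α (j + 1) * z ^ j) z := by
    refine hasDerivAt_tsum_of_isPreconnected (g := fun (j : ℕ) (z : ℂ) => α (j + 1) * z ^ (j + 1))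
      (g' := fun (j : ℕ) (z : ℂ) => ((j : ℂ) + 1) * α (j + 1) * z ^ j)
      (t := Metric.ball (0 : ℂ) r) (y₀ := 0) hsum
      Metric.isOpen_ball (convex_ball 0 r).isPreconnected ?_ ?_ (by simpa using hpos) ?_
      (by simpa using hzr)
    · intro j y _
      have := (hasDerivAt_pow (j + 1) y).const_mul (α (j + 1))
      refine this.congr_deriv ?_
      push_cast
      ring
    · intro j y hy
      have hy' : ‖y‖ ≤ r := (mem_ball_zero_iff.1 hy).le
      rw [norm_mul, norm_pow]
      have h := norm_mul_succ_le hα j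
      have h' := (norm_nonneg _).trans h
      gcongr
    · simp
  refine (hs'.const_add (α 0)).congr_of_eventuallyEq ?_
  filter_upwards [eventually_norm_lt_one hz] with y hy
  rw [(hasSum_powerSeries hα hy).summable.tsum_eq_zero_add]
  simp

/-- If `4 (j+1)² α_{j+1} = (2j+1)² α_j + γ_j`, then `f = ∑ α_j z^j` and `g = ∑ γ_j z^j` satisfy
`4 ((1 - z) z f')' = f + g`. -/
lemma hasDerivAt_hypergeometric {α γ : ℕ → ℂ} {C : ℝ} (hα : ∀ j, ‖α j‖ ≤ C) (hγ : ∀ j, ‖γ j‖ ≤ C)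
    (hrec : ∀ j : ℕ, 4 * ((j : ℂ) + 1) ^ 2 * α (j + 1) = (2 * j + 1) ^ 2 * α j + γ j) {z : ℂ}
    (hz : ‖z‖ < 1) :
    HasDerivAt (fun z => (1 - z) * z * ∑' j : ℕ, ((j : ℂ) + 1) * α (j + 1) * z ^ j)
      ((∑' j, α j * z ^ j + ∑' j, γ j * z ^ j) / 4) z := by
  have h0 : ∀ j, ‖α j‖ ≤ C * ((j : ℝ) + 1) ^ 0 := by simpa using hα
  have h0γ : ∀ j, ‖γ j‖ ≤ C * ((j : ℝ) + 1) ^ 0 := by simpa using hγ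
  have h1 := norm_mul_succ_le h0
  have h2 := norm_mul_succ_le h1
  have hd := (((hasDerivAt_id z).const_sub 1).mul (hasDerivAt_id z)).mul
    (hasDerivAt_powerSeries h1 hz)
  refine hd.congr_deriv ?_
  have s0 := hasSum_powerSeries h0 hz
  have sγ := hasSum_powerSeries h0γ hz
  have s1 := hasSum_powerSeries h1 hz
  have s2 := hasSum_powerSeries h2 hz
  set f1 := ∑' j : ℕ, ((j : ℂ) + 1) * α (j + 1) * z ^ j
  set f2 := ∑' j : ℕ, ((j : ℂ) + 1) * (((j + 1 : ℕ) : ℂ) + 1) * α (j + 1 + 1) * z ^ j with hf2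
  have e2 : (∑' j : ℕ, ((j : ℂ) + 1) * ((((j + 1 : ℕ) : ℂ) + 1) * α (j + 1 + 1)) * z ^ j) = f2 := by
    simp only [hf2, mul_assoc]
  rw [e2] at s2 ⊢
  have t1 : HasSum (fun j : ℕ => (j : ℂ) * α j * z ^ j) (z * f1) := by
    rw [← hasSum_nat_add_iff' 1]
    simp only [Finset.range_one, Finset.sum_singleton, Nat.cast_zero, zero_mul, sub_zero]
    refine (s1.mul_left z).congr_fun fun j => ?_
    push_cast; ring
  have t2 : HasSum (fun j : ℕ => (j : ℂ) * ((j + 1) * α (j + 1)) * z ^ j) (z * f2) := by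
    rw [← hasSum_nat_add_iff' 1]
    simp only [Finset.range_one, Finset.sum_singleton, Nat.cast_zero, zero_mul, sub_zero]
    refine (s2.mul_left z).congr_fun fun j => ?_
    push_cast; ring
  have t3 : HasSum (fun j : ℕ => (j : ℂ) * (j - 1) * α j * z ^ j) (z * (z * f2)) := by
    rw [← hasSum_nat_add_iff' 1]
    simp only [Finset.range_one, Finset.sum_singleton, Nat.cast_zero, zero_mul, sub_zero]
    refine (t2.mul_left z).congr_fun fun j => ?_
    push_cast; ring
  have hl := ((s1.add t2).sub ((t1.mul_left 2).add t3))
  have hr := (s0.add sγ).div_const 4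
  have := hl.unique (hr.congr_fun fun j => by linear_combination z ^ j * hrec j / 4)
  rw [← this]
  simp only [id, Pi.mul_apply]
  ring

lemma eq_of_mul_deriv_eq_zero {f : ℂ → ℂ} {ρ : ℝ}
    (hf : ∀ x ∈ Metric.ball (0 : ℂ) ρ, DifferentiableAt ℂ f x)
    (h0 : ∀ x ∈ Metric.ball (0 : ℂ) ρ, x * deriv f x = 0) {x : ℂ} (hx : x ∈ Metric.ball (0 : ℂ) ρ) :
    f x = f 0 := by
  have hρ : 0 < ρ := Metric.pos_of_mem_ball hx
  have hmem : (0 : ℂ) ∈ Metric.ball (0 : ℂ) ρ := Metric.mem_ball_self hρ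
  have hdf : DifferentiableOn ℂ f (Metric.ball 0 ρ) := fun y hy => (hf y hy).differentiableWithinAt
  have hoff : ∀ y ∈ Metric.ball (0 : ℂ) ρ, y ≠ 0 → deriv f y = 0 := fun y hy hy0 =>
    (mul_eq_zero.1 (h0 y hy)).resolve_left hy0
  have hz : deriv f 0 = 0 := by
    have hc : ContinuousAt (deriv f) 0 :=
      ((hdf.deriv Metric.isOpen_ball).differentiableAt
        (Metric.isOpen_ball.mem_nhds hmem)).continuousAt
    refine tendsto_nhds_unique
      (hc.tendsto.mono_left nhdsWithin_le_nhds : Tendsto _ (𝓝[≠] (0 : ℂ)) _) ?_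
    refine tendsto_const_nhds.congr' ?_
    filter_upwards [self_mem_nhdsWithin,
      nhdsWithin_le_nhds (Metric.isOpen_ball.mem_nhds hmem)] with y hy hy'
    exact (hoff y hy' hy).symm
  refine Metric.isOpen_ball.is_const_of_deriv_eq_zero (convex_ball 0 ρ).isPreconnected hdf ?_
    hx hmem
  intro y hy
  by_cases hy0 : y = 0
  · rw [hy0, hz]; rfl
  · exact hoff y hy hy0

/-- Solving the inhomogeneous hypergeometric equation in terms of the nome: `f(λ)/θ₃²` is an
iterated primitive of `θ₂⁴ θ₄⁴ g(λ) / (4 θ₃²)` with respect to `dx/x`. -/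
lemma hypergeometric_eq_squareSum_sq_mul {α γ : ℕ → ℂ} {C : ℝ} (hα : ∀ j, ‖α j‖ ≤ C)
    (hγ : ∀ j, ‖γ j‖ ≤ C)
    (hrec : ∀ j : ℕ, 4 * ((j : ℂ) + 1) ^ 2 * α (j + 1) = (2 * j + 1) ^ 2 * α j + γ j)
    {W W₁ : ℂ → ℂ} (hW : ∀ x : ℂ, ‖x‖ < 1 → DifferentiableAt ℂ W x)
    (hW₁ : ∀ x : ℂ, ‖x‖ < 1 → DifferentiableAt ℂ W₁ x)
    (hWW₁ : ∀ x : ℂ, ‖x‖ < 1 → x * deriv W x = W₁ x)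
    (hW₁' : ∀ᶠ x in 𝓝 (0 : ℂ), x * deriv W₁ x = x * pronicSum x ^ 4 * squareSum (-x) ^ 4 *
      (∑' j, γ j * nomeLambda x ^ j) / (4 * squareSum x ^ 2)) :
    ∀ᶠ x in 𝓝 (0 : ℂ), ∑' j, α j * nomeLambda x ^ j =
      squareSum x ^ 2 * (α 0 + W x - W 0) := by
  have h0n : ‖(0 : ℂ)‖ < 1 := by simp
  have hlam : ∀ᶠ x in 𝓝 (0 : ℂ), ‖nomeLambda x‖ < 1 :=
    (differentiableAt_nomeLambda h0n).continuousAt.eventually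
      (by rw [nomeLambda_zero]; exact eventually_norm_lt_one h0n)
  obtain ⟨ρ, hρ, hball⟩ := Metric.eventually_nhds_iff_ball.1
    ((hW₁'.and hlam).and (eventually_norm_lt_one h0n))
  let f : ℂ → ℂ := fun z => ∑' j, α j * z ^ j
  let m : ℂ → ℂ := fun z => (1 - z) * z * ∑' j : ℕ, ((j : ℂ) + 1) * α (j + 1) * z ^ j
  let v : ℂ → ℂ := fun x => f (nomeLambda x) / squareSum x ^ 2
  let u : ℂ → ℂ := fun x => squareSum x ^ 2 * m (nomeLambda x)
    - 2 * logDerivThree x * v x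
  have h0 : ∀ j, ‖α j‖ ≤ C * ((j : ℝ) + 1) ^ 0 := by simpa using hα
  have hv : ∀ x ∈ Metric.ball (0 : ℂ) ρ, DifferentiableAt ℂ v x ∧ x * deriv v x = u x := by
    intro x hxρ
    obtain ⟨⟨-, hl⟩, hx⟩ := hball x hxρ
    have ha := squareSum_ne_zero hx
    have hd : HasDerivAt v _ x :=
      ((hasDerivAt_powerSeries h0 hl).comp x (differentiableAt_nomeLambda hx).hasDerivAt).div
        ((differentiableAt_squareSum hx).hasDerivAt.pow 2) (pow_ne_zero 2 ha)
    refine ⟨hd.differentiableAt, ?_⟩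
    rw [hd.deriv]
    have e1 := mul_deriv_nomeLambda hx
    have e2 := one_sub_nomeLambda hx
    have e3 := mul_deriv_squareSum hx
    rw [eq_div_iff (pow_ne_zero 4 ha)] at e2
    simp only [u, m, v, f, Function.comp_apply]
    push_cast
    norm_num
    field_simp
    set f1 := ∑' j : ℕ, ((j : ℂ) + 1) * α (j + 1) * nomeLambda x ^ j
    linear_combination squareSum x * f1 * e1 - squareSum x * f1 * nomeLambda x * e2
      - 2 * (∑' j, α j * nomeLambda x ^ j) * e3
  have hu : ∀ x ∈ Metric.ball (0 : ℂ) ρ, DifferentiableAt ℂ u x ∧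
      x * deriv u x = x * deriv W₁ x := by
    intro x hxρ
    obtain ⟨⟨hWx, hl⟩, hx⟩ := hball x hxρ
    have ha := squareSum_ne_zero hx
    have hd : HasDerivAt u _ x :=
      (((differentiableAt_squareSum hx).hasDerivAt.pow 2).mul
        ((hasDerivAt_hypergeometric hα hγ hrec hl).comp x
          (differentiableAt_nomeLambda hx).hasDerivAt)).sub
        (((differentiableAt_logDerivThree hx).hasDerivAt.const_mul 2).mul
          (hv x hxρ).1.hasDerivAt)
    refine ⟨hd.differentiableAt, ?_⟩
    rw [hd.deriv, hWx]
    have e0 := (hv x hxρ).2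
    have e1 := mul_deriv_nomeLambda hx
    have e3 := mul_deriv_squareSum hx
    have e4 := mul_deriv_logDerivThree hx
    have e5 : v x * squareSum x ^ 2 = ∑' j, α j * nomeLambda x ^ j :=
      div_mul_cancel₀ _ (pow_ne_zero 2 ha)
    have e6 : nomeLambda x * squareSum x ^ 4 = x * pronicSum x ^ 4 :=
      div_mul_cancel₀ _ (pow_ne_zero 4 ha)
    have hudef : u x = squareSum x ^ 2 * m (nomeLambda x) - 2 * logDerivThree x * v x := rfl
    rw [hudef] at e0
    rw [eq_div_iff (mul_ne_zero (by norm_num : (4 : ℂ) ≠ 0) (pow_ne_zero 2 ha)), ← e5]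
    simp only [Function.comp_apply, Pi.pow_apply]
    change x * (_ * m (nomeLambda x) + _ - _) * _ = _
    set G := ∑' j, γ j * nomeLambda x ^ j
    push_cast
    norm_num
    linear_combination 8 * squareSum x ^ 3 * m (nomeLambda x) * e3
      - 8 * squareSum x ^ 2 * logDerivThree x * e0 - 8 * squareSum x ^ 2 * v x * e4
      + squareSum x ^ 4 * (v x * squareSum x ^ 2 + G) * e1
      + squareSum (-x) ^ 4 * (v x * squareSum x ^ 2 + G) * e6
  have h0ρ : (0 : ℂ) ∈ Metric.ball (0 : ℂ) ρ := Metric.mem_ball_self hρ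
  have hδ₁ : ∀ x ∈ Metric.ball (0 : ℂ) ρ, u x - W₁ x = 0 := by
    intro x hx
    have h := eq_of_mul_deriv_eq_zero (f := fun x => u x - W₁ x) (ρ := ρ)
      (fun y hy => (hu y hy).1.sub (hW₁ y (hball y hy).2))
      (fun y hy => by
        rw [deriv_fun_sub (hu y hy).1 (hW₁ y (hball y hy).2), mul_sub, (hu y hy).2, sub_self]) hx
    rw [h, ← hWW₁ 0 h0n, ← (hv 0 h0ρ).2]
    ring
  filter_upwards [Metric.ball_mem_nhds _ hρ] with x hx
  have h := eq_of_mul_deriv_eq_zero (f := fun x => v x - W x) (ρ := ρ)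
    (fun y hy => (hv y hy).1.sub (hW y (hball y hy).2))
    (fun y hy => by
      rw [deriv_fun_sub (hv y hy).1 (hW y (hball y hy).2), mul_sub, (hv y hy).2,
        hWW₁ y (hball y hy).2, hδ₁ y hy]) hx
  have hv0 : v 0 = α 0 := by
    simp only [v, f, nomeLambda_zero, squareSum_zero]
    rw [tsum_eq_single 0 (fun j hj => by simp [hj])]
    simp
  have hvx : v x * squareSum x ^ 2 = ∑' j, α j * nomeLambda x ^ j :=
    div_mul_cancel₀ _ (pow_ne_zero 2 (squareSum_ne_zero (hball x hx).2))
  rw [← hvx]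
  simp only [hv0] at h
  linear_combination squareSum x ^ 2 * h

/-- Jacobi's formula `₂F₁(1/2, 1/2; 1; λ) = θ₃²` near the cusp, for a multiple `∑ α_j z^j` of the
hypergeometric series, together with the analogous formula for an inhomogeneous equation. -/
lemma hypergeometric_pair {α β : ℕ → ℂ} {C : ℝ} (hα : ∀ j, ‖α j‖ ≤ C) (hβ : ∀ j, ‖β j‖ ≤ C)
    (hrecα : ∀ j : ℕ, 4 * ((j : ℂ) + 1) ^ 2 * α (j + 1) = (2 * j + 1) ^ 2 * α j)
    (hrecβ : ∀ j : ℕ, 4 * ((j : ℂ) + 1) ^ 2 * β (j + 1) = (2 * j + 1) ^ 2 * β j - 4 * α j)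
    {W W₁ : ℂ → ℂ} (hW : ∀ x : ℂ, ‖x‖ < 1 → DifferentiableAt ℂ W x)
    (hW₁ : ∀ x : ℂ, ‖x‖ < 1 → DifferentiableAt ℂ W₁ x)
    (hWW₁ : ∀ x : ℂ, ‖x‖ < 1 → x * deriv W x = W₁ x)
    (hW₁' : ∀ x : ℂ, ‖x‖ < 1 → x * deriv W₁ x = x * pronicSum x ^ 4 * squareSum (-x) ^ 4)
    (hW0 : W 0 = 0) :
    ∀ᶠ x in 𝓝 (0 : ℂ), ∑' j, α j * nomeLambda x ^ j = squareSum x ^ 2 * α 0 ∧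
      ∑' j, β j * nomeLambda x ^ j = squareSum x ^ 2 * (β 0 - α 0 * W x) := by
  have hC : 0 ≤ C := (norm_nonneg _).trans (hα 0)
  have h0n : ‖(0 : ℂ)‖ < 1 := by simp
  have h1 := hypergeometric_eq_squareSum_sq_mul (γ := 0) (W := 0) (W₁ := 0) hα (by simpa using hC)
    (by simpa using hrecα) (fun _ _ => differentiableAt_const 0)
    (fun _ _ => differentiableAt_const 0) (by simp) (by simp)
  have h2 := hypergeometric_eq_squareSum_sq_mul (γ := fun j => -4 * α j) (C := 4 * C)
    (W := fun x => -α 0 * W x)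
    (W₁ := fun x => -α 0 * W₁ x) (fun j => (hβ j).trans (by linarith))
    (fun j => by rw [norm_mul]; norm_num; linarith [hα j])
    (fun j => by rw [hrecβ]; ring) (fun x hx => (hW x hx).const_mul _)
    (fun x hx => (hW₁ x hx).const_mul _)
    (fun x hx => by
      rw [deriv_const_mul _ (hW x hx)]; linear_combination -α 0 * hWW₁ x hx)
    (by
      filter_upwards [h1, eventually_norm_lt_one h0n] with x h1 hx
      have ha := squareSum_ne_zero hx
      rw [deriv_const_mul _ (hW₁ x hx),
        eq_div_iff (mul_ne_zero (by norm_num : (4 : ℂ) ≠ 0) (pow_ne_zero 2 ha))]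
      simp only [mul_assoc (-4 : ℂ), tsum_mul_left, h1]
      simp only [Pi.zero_apply, add_zero, sub_zero]
      linear_combination -4 * squareSum x ^ 2 * α 0 * hW₁' x hx)
  filter_upwards [h1, h2] with x h1 h2
  refine ⟨by simpa using h1, ?_⟩
  rw [h2, hW0]
  ring

open Function.Periodic (qParam)

/-! ### The integral `∫₀^q · dq/q` on functions of the nome -/

lemma hasDerivAt_qParam (h : ℝ) (τ : ℂ) :
    HasDerivAt (qParam h) (2 * Real.pi * Complex.I / h * qParam h τ) τ := by
  have h1 : HasDerivAt (fun z : ℂ => 2 * Real.pi * Complex.I * z / h)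
      (2 * Real.pi * Complex.I / h) τ := by
    have := ((hasDerivAt_id τ).const_mul (2 * Real.pi * Complex.I)).div_const (h : ℂ)
    simpa using this
  exact h1.cexp.congr_deriv (mul_comm _ _)

lemma hasDerivAt_comp_qParam {h : ℝ} (hh : 0 < h) {Φ : ℂ → ℂ}
    (hΦ : ∀ x : ℂ, ‖x‖ < 1 → DifferentiableAt ℂ Φ x) {τ : ℂ} (hτ : 0 < τ.im) :
    HasDerivAt (fun τ => Φ (qParam h τ))
      (2 * Real.pi * Complex.I / h * (qParam h τ * deriv Φ (qParam h τ))) τ := by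
  have h1 := (hΦ _ (Function.Periodic.norm_qParam_lt_one hh hτ)).hasDerivAt.comp τ
    (hasDerivAt_qParam h τ)
  exact h1.congr_deriv (by ring)

/-- A holomorphic function on the unit disc that vanishes at the origin has a primitive with
respect to `dx/x`. -/
lemma exists_primitive {φ : ℂ → ℂ} (hφ : ∀ x : ℂ, ‖x‖ < 1 → DifferentiableAt ℂ φ x)
    (h0 : φ 0 = 0) : ∃ Φ : ℂ → ℂ, Φ 0 = 0 ∧ (∀ x : ℂ, ‖x‖ < 1 → DifferentiableAt ℂ Φ x) ∧
      ∀ x : ℂ, ‖x‖ < 1 → x * deriv Φ x = φ x := by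
  have hd : DifferentiableOn ℂ φ (Metric.ball 0 1) := fun x hx =>
    (hφ x (mem_ball_zero_iff.1 hx)).differentiableWithinAt
  have hs : DifferentiableOn ℂ (dslope φ 0) (Metric.ball 0 1) :=
    (Complex.differentiableOn_dslope (Metric.ball_mem_nhds _ one_pos)).2 hd
  obtain ⟨Φ, hΦ0, hΦ⟩ := hs.isExactOn_ball.with_val_at 0 0
  refine ⟨Φ, hΦ0, fun x hx => (hΦ x (mem_ball_zero_iff.2 hx)).differentiableAt, fun x hx => ?_⟩
  rw [(hΦ x (mem_ball_zero_iff.2 hx)).deriv]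
  have := sub_smul_dslope φ 0 x
  simpa [h0] using this

lemma norm_qParam_add_mul_I {h : ℝ} (τ : ℂ) (s : ℝ) :
    ‖qParam h (τ + s * Complex.I)‖ = ‖qParam h τ‖ * Real.exp (-(2 * Real.pi / h) * s) := by
  rw [Function.Periodic.norm_qParam, Function.Periodic.norm_qParam, ← Real.exp_add]
  congr 1
  simp
  ring

lemma im_add_mul_I_pos {τ : ℂ} (hτ : 0 < τ.im) {s : ℝ} (hs : 0 ≤ s) :
    0 < (τ + s * Complex.I).im := by
  simp; linarith

lemma integrableOn_comp_qParam {h : ℝ} (hh : 0 < h) {φ : ℂ → ℂ}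
    (hφ : ∀ x : ℂ, ‖x‖ < 1 → DifferentiableAt ℂ φ x) (h0 : φ 0 = 0) {τ : ℂ} (hτ : 0 < τ.im) :
    MeasureTheory.IntegrableOn (fun s : ℝ => φ (qParam h (τ + s * Complex.I))) (Set.Ioi 0) := by
  have hd : DifferentiableOn ℂ φ (Metric.ball 0 1) := fun x hx =>
    (hφ x (mem_ball_zero_iff.1 hx)).differentiableWithinAt
  have hs : DifferentiableOn ℂ (dslope φ 0) (Metric.ball 0 1) :=
    (Complex.differentiableOn_dslope (Metric.ball_mem_nhds _ one_pos)).2 hd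
  have hr1 := Function.Periodic.norm_qParam_lt_one hh hτ
  obtain ⟨C, hC⟩ := (isCompact_closedBall (0 : ℂ) ‖qParam h τ‖).exists_bound_of_continuousOn
    (hs.continuousOn.mono (Metric.closedBall_subset_ball hr1))
  have hb : (0 : ℝ) < 2 * Real.pi / h := by positivity
  have hint := ((exp_neg_integrableOn_Ioi 0 hb).const_mul (C * ‖qParam h τ‖))
  refine MeasureTheory.Integrable.mono' hint ?_ ?_
  · refine ContinuousOn.aestronglyMeasurable ?_ measurableSet_Ioi
    intro s hs
    have hx := Function.Periodic.norm_qParam_lt_one hh (im_add_mul_I_pos hτ (le_of_lt hs))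
    have hc : ContinuousAt (fun s : ℝ => qParam h (τ + s * Complex.I)) s :=
      ((Function.Periodic.continuous_qParam (h := h)).comp (by fun_prop)).continuousAt
    exact (ContinuousAt.comp (f := fun s : ℝ => qParam h (τ + s * Complex.I)) (g := φ)
      (hφ _ hx).continuousAt hc).continuousWithinAt
  · refine MeasureTheory.ae_restrict_of_forall_mem measurableSet_Ioi fun s hs => ?_
    have hn := norm_qParam_add_mul_I (h := h) τ s
    have hle : Real.exp (-(2 * Real.pi / h) * s) ≤ 1 := by
      rw [Real.exp_le_one_iff]
      have : 0 < s := hs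
      nlinarith
    have hmem : qParam h (τ + s * Complex.I) ∈ Metric.closedBall (0 : ℂ) ‖qParam h τ‖ := by
      rw [mem_closedBall_zero_iff, hn]
      exact mul_le_of_le_one_right (norm_nonneg _) hle
    have h1 := sub_smul_dslope φ 0 (qParam h (τ + s * Complex.I))
    rw [sub_zero, h0, sub_zero] at h1
    rw [← h1, norm_smul, hn]
    have := hC _ hmem
    calc _ ≤ ‖qParam h τ‖ * Real.exp (-(2 * Real.pi / h) * s) * C := by gcongr
      _ = _ := by ring

lemma qInt_congr {f g : ℂ → ℂ} (hfg : ∀ τ : ℂ, 0 < τ.im → f τ = g τ) {τ : ℂ} (hτ : 0 < τ.im) :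
    qInt f τ = qInt g τ := by
  rw [qInt, qInt]
  congr 1
  exact MeasureTheory.setIntegral_congr_fun measurableSet_Ioi fun s hs =>
    hfg _ (im_add_mul_I_pos hτ (le_of_lt hs))

lemma qIntegrable_congr {f g : ℂ → ℂ} (hfg : ∀ τ : ℂ, 0 < τ.im → f τ = g τ)
    (hg : QIntegrable g) : QIntegrable f := fun τ =>
  (hg τ).congr_fun (fun _ hs => (hfg _ (im_add_mul_I_pos τ.im_pos (le_of_lt hs))).symm)
    measurableSet_Ioi

lemma qInt_const_mul (c : ℂ) (g : ℂ → ℂ) (τ : ℂ) : qInt (fun τ => c * g τ) τ = c * qInt g τ := by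
  simp only [qInt, MeasureTheory.integral_const_mul]
  ring

/-- `∫₀^q · dq/q` of a function of `x = q^{1/h}` vanishing at `x = 0` is again such a function,
namely `h` times its primitive with respect to `dx/x`. -/
lemma qInt_comp_qParam {h : ℝ} (hh : 0 < h) {φ Φ : ℂ → ℂ}
    (hφ : ∀ x : ℂ, ‖x‖ < 1 → DifferentiableAt ℂ φ x) (h0 : φ 0 = 0)
    (hΦ : ∀ x : ℂ, ‖x‖ < 1 → DifferentiableAt ℂ Φ x) (hΦ0 : Φ 0 = 0)
    (hd : ∀ x : ℂ, ‖x‖ < 1 → x * deriv Φ x = h * φ x) {τ : ℂ} (hτ : 0 < τ.im) :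
    qInt (fun τ => φ (qParam h τ)) τ = Φ (qParam h τ) := by
  have hderiv : ∀ s ∈ Set.Ici (0 : ℝ), HasDerivAt
      (fun s : ℝ => Φ (qParam h (τ + s * Complex.I)))
      (-(2 * Real.pi) * φ (qParam h (τ + s * Complex.I))) s := by
    intro s hs
    have hp := im_add_mul_I_pos hτ hs
    have h1 := hasDerivAt_comp_qParam hh hΦ hp
    have h2 : HasDerivAt (fun s : ℂ => τ + s * Complex.I) Complex.I (s : ℂ) := by
      simpa using ((hasDerivAt_id (s : ℂ)).mul_const Complex.I).const_add τ
    have h3 := (HasDerivAt.comp (s : ℂ) h1 h2).comp_ofReal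
    refine h3.congr_deriv ?_
    rw [hd _ (Function.Periodic.norm_qParam_lt_one hh hp)]
    have : (h : ℂ) ≠ 0 := by exact_mod_cast hh.ne'
    generalize φ (qParam h (τ + s * Complex.I)) = c
    field_simp
    linear_combination c * Complex.I_sq
  have hlim : Tendsto (fun s : ℝ => Φ (qParam h (τ + s * Complex.I))) atTop (𝓝 0) := by
    have hc : Tendsto Φ (𝓝 0) (𝓝 0) := by
      have := (hΦ 0 (by simp)).continuousAt.tendsto
      rwa [hΦ0] at this
    refine hc.comp (tendsto_zero_iff_norm_tendsto_zero.2 ?_)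
    simp only [norm_qParam_add_mul_I]
    have hb : (0 : ℝ) < 2 * Real.pi / h := by positivity
    have := (Real.tendsto_exp_atBot.comp
      ((tendsto_id (α := ℝ)).const_mul_atTop_of_neg (neg_lt_zero.2 hb))).const_mul ‖qParam h τ‖
    simpa using this
  have hint := (integrableOn_comp_qParam hh hφ h0 hτ).const_mul (-(2 * (Real.pi : ℂ)))
  have key := MeasureTheory.integral_Ioi_of_hasDerivAt_of_tendsto' hderiv hint hlim
  rw [MeasureTheory.integral_const_mul] at key
  rw [qInt]
  simp only [Complex.ofReal_zero, zero_mul, add_zero, zero_sub] at key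
  linear_combination -key

/-- `g` is a holomorphic function of `x = q^{1/h}` on the unit disc that vanishes at `x = 0`. -/
def IsNomeFun (h : ℝ) (g : ℂ → ℂ) : Prop :=
  ∃ φ : ℂ → ℂ, (∀ x : ℂ, ‖x‖ < 1 → DifferentiableAt ℂ φ x) ∧ φ 0 = 0 ∧
    ∀ τ : ℂ, 0 < τ.im → g τ = φ (qParam h τ)

lemma IsNomeFun.qIntegrable {h : ℝ} (hh : 0 < h) {g : ℂ → ℂ} (hg : IsNomeFun h g) :
    QIntegrable g := by
  obtain ⟨φ, hφ, h0, hgφ⟩ := hg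
  exact qIntegrable_congr hgφ fun τ => integrableOn_comp_qParam hh hφ h0 τ.im_pos

lemma IsNomeFun.qInt {h : ℝ} (hh : 0 < h) {g : ℂ → ℂ} (hg : IsNomeFun h g) :
    IsNomeFun h (qInt g) := by
  obtain ⟨φ, hφ, h0, hgφ⟩ := hg
  obtain ⟨Φ, hΦ0, hΦ, hd⟩ := exists_primitive (φ := fun x => h * φ x)
    (fun x hx => (hφ x hx).const_mul _) (by simp [h0])
  exact ⟨Φ, hΦ, hΦ0, fun τ hτ => (qInt_congr hgφ hτ).trans
    (qInt_comp_qParam hh hφ h0 hΦ hΦ0 hd hτ)⟩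

lemma eventually_im_pos {τ : ℂ} (hτ : 0 < τ.im) : ∀ᶠ z : ℂ in 𝓝 τ, 0 < z.im :=
  (isOpen_lt continuous_const Complex.continuous_im).mem_nhds hτ

lemma IsNomeFun.hasDerivAt_qInt {h : ℝ} (hh : 0 < h) {g : ℂ → ℂ} (hg : IsNomeFun h g) {τ : ℂ}
    (hτ : 0 < τ.im) : HasDerivAt (NcHO.qInt g) (2 * Real.pi * Complex.I * g τ) τ := by
  obtain ⟨φ, hφ, h0, hgφ⟩ := hg
  obtain ⟨Φ, hΦ0, hΦ, hd⟩ := exists_primitive (φ := fun x => h * φ x)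
    (fun x hx => (hφ x hx).const_mul _) (by simp [h0])
  have h1 := hasDerivAt_comp_qParam hh hΦ hτ
  rw [hd _ (Function.Periodic.norm_qParam_lt_one hh hτ), ← hgφ τ hτ] at h1
  have hne : (h : ℂ) ≠ 0 := by exact_mod_cast hh.ne'
  refine (h1.congr_of_eventuallyEq ?_).congr_deriv (by field_simp)
  filter_upwards [eventually_im_pos hτ] with z hz
  exact (qInt_congr hgφ hz).trans (qInt_comp_qParam hh hφ h0 hΦ hΦ0 hd hz)

lemma mdiff_of_differentiableAt {g : ℂ → ℂ} (hg : ∀ τ : ℂ, 0 < τ.im → DifferentiableAt ℂ g τ) :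
    MDiff (fun τ : ℍ => g τ) := by
  rw [UpperHalfPlane.mdifferentiable_iff]
  intro z hz
  refine ((hg z hz).congr_of_eventuallyEq ?_).differentiableWithinAt
  filter_upwards [eventually_im_pos hz] with w hw
  simp [UpperHalfPlane.ofComplex_apply_of_im_pos hw]

/-! ### Fourier expansions -/

/-- A function of the form `x^{n₀} φ(x)`, with `x = q^{1/N}` and `φ` holomorphic on the unit disc,
has a Fourier expansion. -/
lemma hasFourierExpansion_of_qParam {g : ℍ → ℂ} {N : ℕ} (hN : 0 < N) (n₀ : ℤ) {φ : ℂ → ℂ}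
    (hφ : ∀ x : ℂ, ‖x‖ < 1 → DifferentiableAt ℂ φ x)
    (hg : ∀ τ : ℍ, g τ = qParam N τ ^ n₀ * φ (qParam N τ)) : HasFourierExpansion g := by
  refine ⟨N, n₀, fun n => (n.factorial : ℂ)⁻¹ * iteratedDeriv n φ 0, hN,
    Eventually.of_forall fun τ => ?_⟩
  have hd : DifferentiableOn ℂ φ (Metric.ball 0 1) := fun x hx =>
    (hφ x (mem_ball_zero_iff.1 hx)).differentiableWithinAt
  have hx := Function.Periodic.norm_qParam_lt_one (h := N) (by exact_mod_cast hN) τ.im_pos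
  have hs := (Complex.hasSum_taylorSeries_on_ball hd (mem_ball_zero_iff.2 hx)).mul_left
    (qParam N τ ^ n₀)
  rw [hg]
  convert! hs using 2 with n
  have hexp : Complex.exp (2 * Real.pi * Complex.I * (((n : ℂ) + (n₀ : ℂ)) / (N : ℂ)) * τ) =
      qParam N τ ^ n₀ * qParam N τ ^ n := by
    rw [← zpow_natCast, ← zpow_add₀ (Function.Periodic.qParam_ne_zero _), qParam,
      ← Complex.exp_int_mul]
    congr 1
    push_cast
    ring
  simp only [sub_zero, smul_eq_mul]
  rw [hexp]
  ring

lemma IsNomeFun.hasFourierExpansion {N : ℕ} (hN : 0 < N) {g : ℂ → ℂ} (hg : IsNomeFun N g) :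
    HasFourierExpansion fun τ : ℍ => g τ := by
  obtain ⟨φ, hφ, -, hgφ⟩ := hg
  exact hasFourierExpansion_of_qParam hN 0 hφ fun τ => by simpa using hgφ τ τ.im_pos

lemma tendsto_qParam_atImInfty {h : ℝ} (hh : 0 < h) :
    Tendsto (fun τ : ℍ => qParam h τ) UpperHalfPlane.atImInfty (𝓝 0) :=
  ((Function.Periodic.qParam_tendsto hh).mono_right nhdsWithin_le_nhds).comp
    UpperHalfPlane.tendsto_coe_atImInfty

/-! ### Modular transformations of the theta functions -/

lemma qParam_two (τ : ℂ) : qParam 2 τ = Complex.exp (Real.pi * Complex.I * τ) := by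
  rw [qParam]
  congr 1
  push_cast
  ring

lemma qParam_two_pow_toNat {k : ℤ} (hk : 0 ≤ k) (τ : ℂ) :
    qParam 2 τ ^ k.toNat = Complex.exp (Real.pi * Complex.I * k * τ) := by
  have h : ((k.toNat : ℕ) : ℂ) = (k : ℂ) := by exact_mod_cast Int.toNat_of_nonneg hk
  rw [qParam_two, ← Complex.exp_nat_mul, h]
  congr 1
  ring

lemma θ₃_eq (τ : ℂ) : θ₃ τ = squareSum (qParam 2 τ) := by
  refine tsum_congr fun n => ?_
  rw [qParam_two_pow_toNat (sq_nonneg n)]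
  push_cast
  rfl

lemma θ₄_eq (τ : ℂ) : θ₄ τ = squareSum (-qParam 2 τ) := by
  refine tsum_congr fun n => ?_
  rw [neg_pow, qParam_two_pow_toNat (sq_nonneg n)]
  have h : (-1 : ℂ) ^ (n ^ 2).toNat = (-1) ^ n := by
    rw [← zpow_natCast, Int.toNat_of_nonneg (sq_nonneg n)]
    rcases Int.even_or_odd n with hn | hn
    · rw [hn.neg_one_zpow, (hn.pow_of_ne_zero two_ne_zero).neg_one_zpow]
    · rw [hn.neg_one_zpow, hn.pow.neg_one_zpow]
  rw [h]
  push_cast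
  rfl

lemma θ₂_eq (τ : ℂ) :
    θ₂ τ = Complex.exp (Real.pi * Complex.I * τ / 4) * pronicSum (qParam 2 τ) := by
  rw [pronicSum, ← tsum_mul_left]
  refine tsum_congr fun n => ?_
  rw [qParam_two_pow_toNat (pronic_nonneg n), ← Complex.exp_add]
  congr 1
  push_cast
  ring

/-- The squares of `θ₂`, `θ₃`, `θ₄`, which `SL(2, ℤ)` permutes up to factors of automorphy. -/
noncomputable def thetaSq (i : Fin 3) (τ : ℍ) : ℂ := ![θ₂ τ ^ 2, θ₃ τ ^ 2, θ₄ τ ^ 2] i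

lemma cpow_one_half_sq (x : ℂ) : (x ^ (1 / 2 : ℂ)) ^ 2 = x := by
  simp

lemma θ₃_eq_jacobiTheta₂ (τ : ℂ) : θ₃ τ = jacobiTheta₂ 0 τ :=
  tsum_congr fun n => by simp [jacobiTheta₂_term]

lemma θ₄_eq_jacobiTheta₂ (τ : ℂ) : θ₄ τ = jacobiTheta₂ (1 / 2) τ := by
  refine tsum_congr fun n => ?_
  rw [jacobiTheta₂_term, Complex.exp_add]
  congr 1
  rw [← Complex.exp_pi_mul_I, ← Complex.exp_int_mul]
  congr 1
  ring

lemma θ₂_eq_jacobiTheta₂ (τ : ℂ) :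
    θ₂ τ = Complex.exp (Real.pi * Complex.I * τ / 4) * jacobiTheta₂ (τ / 2) τ := by
  rw [jacobiTheta₂, ← tsum_mul_left]
  refine tsum_congr fun n => ?_
  rw [jacobiTheta₂_term, ← Complex.exp_add]
  congr 1
  ring

lemma θ₃_sq_neg_inv {τ : ℂ} (hτ : τ ≠ 0) : θ₃ (-τ⁻¹) ^ 2 = -Complex.I * τ * θ₃ τ ^ 2 := by
  have h := jacobiTheta₂_functional_equation 0 τ
  have hI := Complex.I_ne_zero
  rw [θ₃_eq_jacobiTheta₂, θ₃_eq_jacobiTheta₂, h]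
  simp only [mul_pow, div_pow, cpow_one_half_sq, zero_div, ne_eq, OfNat.ofNat_ne_zero,
    not_false_eq_true, zero_pow, mul_zero, Complex.exp_zero, one_pow, mul_one]
  rw [show (-1 / τ : ℂ) = -τ⁻¹ by ring]
  field_simp

lemma θ₂_sq_neg_inv {τ : ℂ} (hτ : τ ≠ 0) : θ₂ (-τ⁻¹) ^ 2 = -Complex.I * τ * θ₄ τ ^ 2 := by
  have h := jacobiTheta₂_functional_equation (1 / 2) τ
  have hI := Complex.I_ne_zero
  rw [θ₂_eq_jacobiTheta₂, θ₄_eq_jacobiTheta₂, h,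
    show (-τ⁻¹ / 2 : ℂ) = -(1 / 2 / τ) by ring, jacobiTheta₂_neg_left,
    show (-1 / τ : ℂ) = -τ⁻¹ by ring,
    show (Real.pi * Complex.I * -τ⁻¹ / 4 : ℂ) = -Real.pi * Complex.I * (1 / 2) ^ 2 / τ by ring]
  simp only [mul_pow, div_pow, cpow_one_half_sq, one_pow]
  field_simp

lemma θ₄_sq_neg_inv {τ : ℂ} (hτ : τ ≠ 0) : θ₄ (-τ⁻¹) ^ 2 = -Complex.I * τ * θ₂ τ ^ 2 := by
  have h := θ₂_sq_neg_inv (neg_ne_zero.2 (inv_ne_zero hτ))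
  rw [show -(-τ⁻¹)⁻¹ = τ by simp] at h
  rw [h]
  field_simp
  linear_combination θ₄ (-(1 / τ)) ^ 2 * Complex.I_sq

lemma qParam_two_add_one (τ : ℂ) : qParam 2 (τ + 1) = -qParam 2 τ := by
  rw [qParam_two, qParam_two, mul_add, mul_one, Complex.exp_add, Complex.exp_pi_mul_I]
  ring

lemma θ₂_sq_add_one (τ : ℂ) : θ₂ (τ + 1) ^ 2 = Complex.I * θ₂ τ ^ 2 := by
  have h : θ₂ (τ + 1) = Complex.exp (Real.pi * Complex.I / 4) * θ₂ τ := by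
    rw [θ₂, θ₂, ← tsum_mul_left]
    refine tsum_congr fun n => ?_
    obtain ⟨k, hk⟩ := Int.even_mul_succ_self n
    have hk' : (n : ℂ) * (n + 1) = k + k := by exact_mod_cast hk
    have : (Real.pi * Complex.I * ((n : ℂ) + 1 / 2) ^ 2 * (τ + 1) : ℂ) =
        Real.pi * Complex.I / 4 + Real.pi * Complex.I * ((n : ℂ) + 1 / 2) ^ 2 * τ
          + k * (2 * Real.pi * Complex.I) := by
      linear_combination Real.pi * Complex.I * hk'
    rw [this, Complex.exp_add, Complex.exp_int_mul_two_pi_mul_I, Complex.exp_add]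
    ring
  rw [h, mul_pow, ← Complex.exp_nat_mul]
  congr 1
  rw [show ((2 : ℕ) : ℂ) * (Real.pi * Complex.I / 4) = Real.pi / 2 * Complex.I by push_cast; ring]
  exact Complex.exp_pi_div_two_mul_I

lemma θ₃_add_one (τ : ℂ) : θ₃ (τ + 1) = θ₄ τ := by
  rw [θ₃_eq, θ₄_eq, qParam_two_add_one]

lemma θ₄_add_one (τ : ℂ) : θ₄ (τ + 1) = θ₃ τ := by
  rw [θ₃_eq, θ₄_eq, qParam_two_add_one, neg_neg]

lemma coe_S_smul (τ : ℍ) : ((ModularGroup.S • τ : ℍ) : ℂ) = -(τ : ℂ)⁻¹ := by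
  rw [UpperHalfPlane.modular_S_smul, UpperHalfPlane.coe_mk, inv_neg]

lemma coe_T_smul (τ : ℍ) : ((ModularGroup.T • τ : ℍ) : ℂ) = τ + 1 := by
  rw [UpperHalfPlane.modular_T_smul, UpperHalfPlane.coe_vadd, add_comm]; simp

lemma denom_T (τ : ℍ) : UpperHalfPlane.denom ModularGroup.T τ = 1 := by
  rw [ModularGroup.denom_apply]
  simp [ModularGroup.T]

lemma thetaSq_slash_S (i : Fin 3) :
    thetaSq i ∣[(1 : ℤ)] ModularGroup.S = (-Complex.I) • thetaSq (Equiv.swap 0 2 i) := by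
  ext τ
  have hτ := τ.ne_zero
  rw [ModularForm.SL_slash_apply, ModularGroup.denom_S, zpow_neg_one, Pi.smul_apply, smul_eq_mul]
  simp only [thetaSq, coe_S_smul]
  fin_cases i
  · have := θ₂_sq_neg_inv hτ
    simp [this]
    field_simp
  · have := θ₃_sq_neg_inv hτ
    have e : Equiv.swap (0 : Fin 3) 2 1 = 1 := by decide
    simp [this, e]
    field_simp
  · have := θ₄_sq_neg_inv hτ
    simp [this]
    field_simp

lemma thetaSq_slash_T (i : Fin 3) :
    thetaSq i ∣[(1 : ℤ)] ModularGroup.T =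
      (![Complex.I, 1, 1] i) • thetaSq (Equiv.swap 1 2 i) := by
  ext τ
  rw [ModularForm.SL_slash_apply, denom_T, one_zpow, Pi.smul_apply, smul_eq_mul]
  simp only [thetaSq, coe_T_smul]
  fin_cases i
  · have e : Equiv.swap (1 : Fin 3) 2 0 = 0 := by decide
    simp [θ₂_sq_add_one, e]
  · simp [θ₃_add_one]
  · simp [θ₄_add_one]

lemma exists_thetaSq_slash (σ : SL(2, ℤ)) : ∃ (π : Equiv.Perm (Fin 3)) (c : Fin 3 → ℂ),
    (∀ i, c i ≠ 0) ∧ ∀ i, thetaSq i ∣[(1 : ℤ)] σ = c i • thetaSq (π i) := by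
  have hσ : σ ∈ Subgroup.closure {ModularGroup.S, ModularGroup.T} := by
    simp [SpecialLinearGroup.SL2Z_generators]
  induction hσ using Subgroup.closure_induction with
  | mem x hx =>
    rcases hx with rfl | rfl
    · exact ⟨_, fun _ => -Complex.I, fun _ => by simp, thetaSq_slash_S⟩
    · refine ⟨_, ![Complex.I, 1, 1], fun i => ?_, thetaSq_slash_T⟩
      fin_cases i <;> simp
  | one => exact ⟨1, 1, fun _ => one_ne_zero, fun i => by simp [SlashAction.slash_one]⟩
  | mul x y _ _ hx hy =>
    obtain ⟨π, c, hc, h⟩ := hx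
    obtain ⟨π', c', hc', h'⟩ := hy
    refine ⟨π.trans π', fun i => c i * c' (π i), fun i => mul_ne_zero (hc i) (hc' _), fun i => ?_⟩
    rw [SlashAction.slash_mul, h, ModularForm.SL_smul_slash, h', smul_smul]
    rfl
  | inv x _ hx =>
    obtain ⟨π, c, hc, h⟩ := hx
    refine ⟨π.symm, fun i => (c (π.symm i))⁻¹, fun i => inv_ne_zero (hc _), fun i => ?_⟩
    have h1 := congrArg (fun F : ℍ → ℂ => F ∣[(1 : ℤ)] x⁻¹) (h (π.symm i))
    simp only [← SlashAction.slash_mul, mul_inv_cancel, SlashAction.slash_one,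
      ModularForm.SL_smul_slash, Equiv.apply_symm_apply] at h1
    rw [h1, smul_smul, inv_mul_cancel₀ (hc _), one_smul]

/-- `SL(2, ℤ)` permutes `θ₂²`, `θ₃²`, `θ₄²` up to constants and the factor of automorphy. -/
lemma exists_thetaSq_smul (σ : SL(2, ℤ)) : ∃ (π : Equiv.Perm (Fin 3)) (c : Fin 3 → ℂ),
    ∀ (i : Fin 3) (τ : ℍ),
      thetaSq i (σ • τ) = c i * UpperHalfPlane.denom σ τ * thetaSq (π i) τ := by
  obtain ⟨π, c, -, h⟩ := exists_thetaSq_slash σ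
  refine ⟨π, c, fun i τ => ?_⟩
  have h1 := congrFun (h i) τ
  have hd := UpperHalfPlane.denom_ne_zero σ τ
  rw [ModularForm.SL_slash_apply, zpow_neg_one, Pi.smul_apply, smul_eq_mul,
    mul_inv_eq_iff_eq_mul₀ hd] at h1
  rw [h1]
  ring

/-! ### The iterated integral of `θ₂⁴ θ₄⁴` -/

/-- `θ₂⁴`, `θ₃⁴`, `θ₄⁴` as functions of the nome. -/
noncomputable def thetaPowFour (i : Fin 3) (x : ℂ) : ℂ :=
  ![x * pronicSum x ^ 4, squareSum x ^ 4, squareSum (-x) ^ 4] i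

lemma differentiableAt_thetaPowFour (i : Fin 3) {x : ℂ} (hx : ‖x‖ < 1) :
    DifferentiableAt ℂ (thetaPowFour i) x := by
  have h1 : DifferentiableAt ℂ (fun x => x * pronicSum x ^ 4) x :=
    differentiableAt_id.mul ((differentiableAt_pronicSum hx).pow 4)
  have h2 : DifferentiableAt ℂ (fun x => squareSum x ^ 4) x := (differentiableAt_squareSum hx).pow 4
  have h3 : DifferentiableAt ℂ (fun x => squareSum (-x) ^ 4) x :=
    (differentiableAt_squareSum_neg hx).pow 4
  fin_cases i
  · exact h1
  · exact h2
  · exact h3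

lemma exp_pow_four (τ : ℂ) : Complex.exp (Real.pi * Complex.I * τ / 4) ^ 4 = qParam 2 τ := by
  rw [qParam_two, ← Complex.exp_nat_mul]
  congr 1
  push_cast
  ring

lemma thetaSq_sq (i : Fin 3) (τ : ℍ) : thetaSq i τ ^ 2 = thetaPowFour i (qParam 2 τ) := by
  fin_cases i
  · simp only [thetaSq, thetaPowFour, Fin.zero_eta, Matrix.cons_val_zero]
    rw [← exp_pow_four, exp_pow_four τ, θ₂_eq, ← exp_pow_four]
    ring
  · simp [thetaSq, thetaPowFour, θ₃_eq, ← pow_mul]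
  · simp [thetaSq, thetaPowFour, θ₄_eq, ← pow_mul]

lemma thetaForm_eq_thetaSq (τ : ℍ) : thetaForm τ = thetaSq 0 τ ^ 2 * thetaSq 2 τ ^ 2 := by
  simp [thetaForm, thetaSq, ← pow_mul]

lemma thetaForm_eq {τ : ℂ} (hτ : 0 < τ.im) : thetaForm τ =
    qParam 2 τ * pronicSum (qParam 2 τ) ^ 4 * squareSum (-qParam 2 τ) ^ 4 := by
  have h := thetaForm_eq_thetaSq ⟨τ, hτ⟩
  rw [thetaSq_sq, thetaSq_sq] at h
  simpa [thetaPowFour] using h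

lemma isNomeFun_thetaForm : IsNomeFun 2 thetaForm :=
  ⟨fun x => thetaPowFour 0 x * thetaPowFour 2 x, fun _ hx =>
    (differentiableAt_thetaPowFour 0 hx).mul (differentiableAt_thetaPowFour 2 hx),
    by simp [thetaPowFour], fun τ hτ => by rw [thetaForm_eq hτ]; rfl⟩

lemma thetaForm_slash {γ : SL(2, ℤ)} (hγ : γ ∈ thetaGroup) :
    (fun τ : ℍ => thetaForm τ) ∣[(4 : ℤ)] γ = fun τ : ℍ => thetaForm τ := by
  have hT : ∀ τ : ℂ, thetaForm (τ + 1 + 1) = thetaForm τ := by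
    intro τ
    rw [thetaForm, show θ₂ (τ + 1 + 1) ^ 4 = (θ₂ (τ + 1 + 1) ^ 2) ^ 2 by ring, θ₂_sq_add_one,
      θ₂_sq_add_one, θ₄_add_one, θ₃_add_one, thetaForm]
    linear_combination θ₂ τ ^ 4 * θ₄ τ ^ 4 * (Complex.I ^ 2 - 1) * Complex.I_sq
  refine Subgroup.closure_induction (p := fun γ _ =>
    (fun τ : ℍ => thetaForm τ) ∣[(4 : ℤ)] γ = fun τ : ℍ => thetaForm τ) ?_ ?_ ?_ ?_ hγ
  · rintro x (rfl | rfl)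
    · ext τ
      rw [sq, SlashAction.slash_mul, ModularForm.SL_slash_apply, ModularForm.SL_slash_apply,
        denom_T, denom_T, coe_T_smul, coe_T_smul, hT]
      simp
    · ext τ
      have hτ := τ.ne_zero
      rw [ModularForm.SL_slash_apply, ModularGroup.denom_S, coe_S_smul, thetaForm,
        show θ₂ (-(τ : ℂ)⁻¹) ^ 4 = (θ₂ (-(τ : ℂ)⁻¹) ^ 2) ^ 2 by ring,
        show θ₄ (-(τ : ℂ)⁻¹) ^ 4 = (θ₄ (-(τ : ℂ)⁻¹) ^ 2) ^ 2 by ring, θ₂_sq_neg_inv hτ,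
        θ₄_sq_neg_inv hτ, thetaForm, zpow_neg, ← div_eq_mul_inv,
        div_eq_iff (zpow_ne_zero _ hτ)]
      have h4 : (τ : ℂ) ^ (4 : ℤ) = (τ : ℂ) ^ 4 := by norm_cast
      rw [h4]
      linear_combination θ₂ τ ^ 4 * θ₄ τ ^ 4 * (τ : ℂ) ^ 4 * (Complex.I ^ 2 - 1) * Complex.I_sq
  · exact SlashAction.slash_one _ _
  · intro x y _ _ hx hy
    rw [SlashAction.slash_mul, hx, hy]
  · intro x _ hx
    nth_rw 1 [← hx]
    rw [← SlashAction.slash_mul, mul_inv_cancel, SlashAction.slash_one]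

lemma exists_derivative_eq (p : Polynomial ℂ) : ∃ r : Polynomial ℂ, r.derivative = p := by
  induction p using Polynomial.induction_on' with
  | add p q hp hq =>
    obtain ⟨r, hr⟩ := hp
    obtain ⟨s, hs⟩ := hq
    exact ⟨r + s, by simp [hr, hs]⟩
  | monomial n a =>
    refine ⟨Polynomial.monomial (n + 1) (a / (n + 1)), ?_⟩
    rw [Polynomial.derivative_monomial]
    have : (n : ℂ) + 1 ≠ 0 := Nat.cast_add_one_ne_zero n
    congr 1
    push_cast
    field_simp

lemma exists_polynomial_of_hasDerivAt {f : ℂ → ℂ} (p : Polynomial ℂ)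
    (hf : ∀ τ : ℂ, 0 < τ.im → HasDerivAt f (p.eval τ) τ) :
    ∃ r : Polynomial ℂ, ∀ τ : ℂ, 0 < τ.im → f τ = r.eval τ := by
  obtain ⟨r, hr⟩ := exists_derivative_eq p
  have hd : ∀ τ : ℂ, 0 < τ.im → HasDerivAt (fun τ => f τ - r.eval τ) 0 τ := fun τ hτ => by
    have := (hf τ hτ).sub (r.hasDerivAt τ)
    rwa [hr, sub_self] at this
  have hconv : Convex ℝ {τ : ℂ | 0 < τ.im} := convex_halfSpace_im_gt 0
  have hopen : IsOpen {τ : ℂ | 0 < τ.im} := isOpen_lt continuous_const Complex.continuous_im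
  refine ⟨r + Polynomial.C (f Complex.I - r.eval Complex.I), fun τ hτ => ?_⟩
  have := hopen.is_const_of_deriv_eq_zero hconv.isPreconnected
    (fun z hz => (hd z hz).differentiableAt.differentiableWithinAt) (fun z hz => (hd z hz).deriv)
    hτ (show 0 < Complex.I.im by simp)
  simp only [Polynomial.eval_add, Polynomial.eval_C]
  linear_combination this

/-- Bol's identity in weight `-2`: the third derivative of `(cτ+d)² G(γτ)` is
`(cτ+d)⁻⁴ G‴(γτ)`. The three derivatives are normalized by a factor `k`. -/
lemma hasDerivAt_bol {a b c d k : ℂ} (had : a * d - b * c = 1) {G G₁ G₂ f : ℂ → ℂ} {τ : ℂ}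
    (hτ : c * τ + d ≠ 0)
    (hG : HasDerivAt G (k * G₁ ((a * τ + b) / (c * τ + d))) ((a * τ + b) / (c * τ + d)))
    (hG₁ : HasDerivAt G₁ (k * G₂ ((a * τ + b) / (c * τ + d))) ((a * τ + b) / (c * τ + d)))
    (hG₂ : HasDerivAt G₂ (k * f ((a * τ + b) / (c * τ + d))) ((a * τ + b) / (c * τ + d))) :
    HasDerivAt (fun τ => (c * τ + d) ^ 2 * G ((a * τ + b) / (c * τ + d)))
      (2 * c * (c * τ + d) * G ((a * τ + b) / (c * τ + d))
        + k * G₁ ((a * τ + b) / (c * τ + d))) τ ∧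
    HasDerivAt (fun τ => 2 * c * (c * τ + d) * G ((a * τ + b) / (c * τ + d))
        + k * G₁ ((a * τ + b) / (c * τ + d)))
      (2 * c ^ 2 * G ((a * τ + b) / (c * τ + d))
        + 2 * c * k * G₁ ((a * τ + b) / (c * τ + d)) / (c * τ + d)
        + k ^ 2 * G₂ ((a * τ + b) / (c * τ + d)) / (c * τ + d) ^ 2) τ ∧
    HasDerivAt (fun τ => 2 * c ^ 2 * G ((a * τ + b) / (c * τ + d))
        + 2 * c * k * G₁ ((a * τ + b) / (c * τ + d)) / (c * τ + d)
        + k ^ 2 * G₂ ((a * τ + b) / (c * τ + d)) / (c * τ + d) ^ 2)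
      (k ^ 3 * f ((a * τ + b) / (c * τ + d)) / (c * τ + d) ^ 4) τ := by
  have hl : HasDerivAt (fun τ => c * τ + d) c τ := by
    simpa using ((hasDerivAt_id τ).const_mul c).add_const d
  have hn : HasDerivAt (fun τ => a * τ + b) a τ := by
    simpa using ((hasDerivAt_id τ).const_mul a).add_const b
  have hM : HasDerivAt (fun τ => (a * τ + b) / (c * τ + d)) (1 / (c * τ + d) ^ 2) τ := by
    refine (hn.div hl hτ).congr_deriv ?_
    congr 1
    linear_combination had
  have h0 := hG.comp τ hM
  have h1 := hG₁.comp τ hM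
  have h2 := hG₂.comp τ hM
  simp only [Function.comp_def] at h0 h1 h2
  refine ⟨((hl.pow 2).mul h0).congr_deriv ?_, (((hl.const_mul (2 * c)).mul h0).add
    (h1.const_mul k)).congr_deriv ?_, (((h0.const_mul (2 * c ^ 2)).add
    ((h1.const_mul (2 * c * k)).div hl hτ)).add
    ((h2.const_mul (k ^ 2)).div (hl.pow 2) (pow_ne_zero 2 hτ))).congr_deriv ?_⟩
  · simp only [Pi.pow_apply]
    push_cast
    field_simp
  · field_simp
  · simp only [Pi.pow_apply]
    push_cast
    field_simp
    ring

lemma coe_smul_eq (σ : SL(2, ℤ)) (τ : ℍ) : ((σ • τ : ℍ) : ℂ) =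
    ((σ 0 0 : ℂ) * τ + (σ 0 1 : ℂ)) / ((σ 1 0 : ℂ) * τ + (σ 1 1 : ℂ)) := by
  rw [UpperHalfPlane.coe_specialLinearGroup_apply]
  simp

lemma denom_eq (σ : SL(2, ℤ)) (τ : ℍ) :
    UpperHalfPlane.denom σ τ = (σ 1 0 : ℂ) * τ + (σ 1 1 : ℂ) := by
  rw [ModularGroup.denom_apply]

/-- If `θ₂⁴θ₄⁴ | σ = κ + g` with the constant term `κ`, then `G₁ | σ` differs by a polynomial from
the triple integral of `g`. -/
lemma G₁_slash {σ : SL(2, ℤ)} {κ : ℂ} {g : ℂ → ℂ} (hg : IsNomeFun 2 g)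
    (hσ : ∀ τ : ℍ, thetaForm (σ • τ : ℍ) = UpperHalfPlane.denom σ τ ^ 4 * (κ + g τ)) :
    ∃ R : Polynomial ℂ, ∀ τ : ℍ,
      ((fun τ : ℍ => G₁ τ) ∣[(-2 : ℤ)] σ) τ = qInt (qInt (qInt g)) τ + R.eval (τ : ℂ) := by
  set k : ℂ := 2 * Real.pi * Complex.I with hk
  set a : ℂ := ((σ 0 0 : ℤ) : ℂ)
  set b : ℂ := ((σ 0 1 : ℤ) : ℂ)
  set c : ℂ := ((σ 1 0 : ℤ) : ℂ)
  set d : ℂ := ((σ 1 1 : ℤ) : ℂ)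
  have had : a * d - b * c = 1 := by
    have := Matrix.det_fin_two σ.1
    rw [σ.2] at this
    simp only [a, b, c, d]
    exact_mod_cast this.symm
  have hf := isNomeFun_thetaForm
  have h2 : (0 : ℝ) < 2 := two_pos
  have hden : ∀ τ : ℂ, 0 < τ.im → c * τ + d ≠ 0 := fun τ hτ => by
    have := UpperHalfPlane.denom_ne_zero σ ⟨τ, hτ⟩
    rwa [denom_eq] at this
  have hM : ∀ τ : ℂ, ∀ hτ : 0 < τ.im, ((σ • (⟨τ, hτ⟩ : ℍ) : ℍ) : ℂ) = (a * τ + b) / (c * τ + d) :=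
    fun τ hτ => coe_smul_eq σ ⟨τ, hτ⟩
  have hpos : ∀ τ : ℂ, 0 < τ.im → 0 < ((a * τ + b) / (c * τ + d)).im := fun τ hτ => by
    rw [← hM τ hτ]; exact UpperHalfPlane.im_pos _
  have hbol := fun (τ : ℂ) (hτ : 0 < τ.im) => hasDerivAt_bol had (k := k) (f := thetaForm)
    (G := qInt (qInt (qInt thetaForm))) (G₁ := qInt (qInt thetaForm)) (G₂ := qInt thetaForm)
    (hden τ hτ)
    (((hf.qInt h2).qInt h2).hasDerivAt_qInt h2 (hpos τ hτ)) ((hf.qInt h2).hasDerivAt_qInt h2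
      (hpos τ hτ)) (hf.hasDerivAt_qInt h2 (hpos τ hτ))
  obtain ⟨r₁, hr₁⟩ := exists_polynomial_of_hasDerivAt (f := fun τ => _ - k ^ 2 * qInt g τ)
    (Polynomial.C (k ^ 3 * κ)) fun τ hτ => by
      refine ((hbol τ hτ).2.2.sub ((hg.hasDerivAt_qInt h2 hτ).const_mul (k ^ 2))).congr_deriv ?_
      have h := hσ ⟨τ, hτ⟩
      rw [hM τ hτ, denom_eq] at h
      have hd := hden τ hτ
      rw [h, Polynomial.eval_C, ← hk]
      change k ^ 3 * ((c * τ + d) ^ 4 * (κ + g τ)) / (c * τ + d) ^ 4 - _ = _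
      field_simp
      ring
  obtain ⟨r₂, hr₂⟩ := exists_polynomial_of_hasDerivAt (f := fun τ => _ - k * qInt (qInt g) τ)
    r₁ fun τ hτ => by
      refine ((hbol τ hτ).2.1.sub (((hg.qInt h2).hasDerivAt_qInt h2 hτ).const_mul k)).congr_deriv ?_
      rw [← hr₁ τ hτ, ← hk]
      ring
  obtain ⟨r₃, hr₃⟩ := exists_polynomial_of_hasDerivAt (f := fun τ => _ - qInt (qInt (qInt g)) τ)
    r₂ fun τ hτ => by
      refine ((hbol τ hτ).1.sub (((hg.qInt h2).qInt h2).hasDerivAt_qInt h2 hτ)).congr_deriv ?_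
      rw [← hr₂ τ hτ]
  refine ⟨r₃, fun τ => ?_⟩
  rw [← hr₃ τ τ.im_pos, ModularForm.SL_slash_apply, denom_eq, G₁, coe_smul_eq, neg_neg]
  have : ((σ 1 0 : ℂ) * τ + (σ 1 1 : ℂ)) ^ (2 : ℤ) = (c * τ + d) ^ 2 := by norm_cast
  rw [this]
  ring

lemma isAutomorphicIntegral_G₁ : IsAutomorphicIntegral thetaGroup (-2) fun τ : ℍ => G₁ τ where
  holo := mdiff_of_differentiableAt fun τ hτ =>
    (((isNomeFun_thetaForm.qInt two_pos).qInt two_pos).hasDerivAt_qInt two_pos hτ).differentiableAt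
  period γ hγ := by
    refine G₁_slash (κ := 0) isNomeFun_thetaForm fun τ => ?_
    have h := congrFun (thetaForm_slash hγ) τ
    have hd := UpperHalfPlane.denom_ne_zero γ τ
    rw [ModularForm.SL_slash_apply, zpow_neg, ← div_eq_mul_inv,
      div_eq_iff (zpow_ne_zero _ hd)] at h
    rw [h, zero_add, mul_comm]
    norm_cast
  cusps σ := by
    obtain ⟨π, c, h⟩ := exists_thetaSq_smul σ
    let φ : ℂ → ℂ := fun x => (c 0 * c 2) ^ 2 * (thetaPowFour (π 0) x * thetaPowFour (π 2) x)
    have hφ : ∀ x : ℂ, ‖x‖ < 1 → DifferentiableAt ℂ φ x := fun x hx =>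
      ((differentiableAt_thetaPowFour _ hx).mul (differentiableAt_thetaPowFour _ hx)).const_mul _
    have hg : IsNomeFun 2 fun τ => φ (qParam 2 τ) - φ 0 :=
      ⟨fun x => φ x - φ 0, fun x hx => (hφ x hx).sub_const _, sub_self _, fun _ _ => rfl⟩
    obtain ⟨R, hR⟩ := G₁_slash (σ := σ) (κ := φ 0) hg fun τ => by
      rw [thetaForm_eq_thetaSq, h, h, add_sub_cancel]
      simp only [φ, ← thetaSq_sq]
      ring
    refine ⟨R, ?_⟩
    have hF := IsNomeFun.hasFourierExpansion (N := 2) two_pos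
      (by exact_mod_cast ((hg.qInt two_pos).qInt two_pos).qInt two_pos)
    convert! hF using 2 with τ
    rw [hR, add_sub_cancel_right]

/-! ### The form `θ₄⁴/θ₃²` of weight one -/

lemma norm_qParam_two_lt_one {τ : ℂ} (hτ : 0 < τ.im) : ‖qParam 2 τ‖ < 1 :=
  Function.Periodic.norm_qParam_lt_one two_pos hτ

lemma θ₃_ne_zero {τ : ℂ} (hτ : 0 < τ.im) : θ₃ τ ≠ 0 := by
  rw [θ₃_eq]; exact squareSum_ne_zero (norm_qParam_two_lt_one hτ)

/-- The function `θ₄⁴/θ₃²` on the upper half plane. -/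
noncomputable def thetaQuot (τ : ℍ) : ℂ := θ₄ τ ^ 4 / θ₃ τ ^ 2

lemma thetaQuot_eq (τ : ℍ) : thetaQuot τ = thetaSq 2 τ ^ 2 / thetaSq 1 τ := by
  simp [thetaQuot, thetaSq, ← pow_mul]

/-- The factor of `θ₂²`, `θ₃²`, `θ₄²` that does not vanish in the unit disc, as a function of
`x = q^{1/4}`. -/
noncomputable def thetaUnit (i : Fin 3) (x : ℂ) : ℂ :=
  ![pronicSum (x ^ 2) ^ 2, squareSum (x ^ 2) ^ 2, squareSum (-x ^ 2) ^ 2] i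

lemma thetaUnit_ne_zero (i : Fin 3) {x : ℂ} (hx : ‖x‖ < 1) : thetaUnit i x ≠ 0 := by
  have hx' := norm_sq_lt_one hx
  have h1 := pow_ne_zero 2 (pronicSum_ne_zero hx')
  have h2 := pow_ne_zero 2 (squareSum_ne_zero hx')
  have h3 := pow_ne_zero 2 (squareSum_ne_zero (x := -x ^ 2) (by simpa using hx'))
  fin_cases i
  · exact h1
  · exact h2
  · exact h3

lemma differentiableAt_thetaUnit (i : Fin 3) {x : ℂ} (hx : ‖x‖ < 1) :
    DifferentiableAt ℂ (thetaUnit i) x := by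
  have h1 := (hasDerivAt_comp_sq (fun _ => differentiableAt_pronicSum) hx).differentiableAt.fun_pow 2
  have h2 := (hasDerivAt_comp_sq (fun _ => differentiableAt_squareSum) hx).differentiableAt.fun_pow 2
  have h3 := (hasDerivAt_comp_sq (f := fun x => squareSum (-x))
    (fun _ => differentiableAt_squareSum_neg) hx).differentiableAt.fun_pow 2
  fin_cases i
  · exact h1
  · exact h2
  · exact h3

lemma qParam_four_sq (τ : ℂ) : qParam 4 τ ^ 2 = qParam 2 τ := by
  rw [qParam, qParam, ← Complex.exp_nat_mul]
  congr 1
  push_cast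
  ring

lemma thetaSq_eq_qParam_four (i : Fin 3) (τ : ℍ) :
    thetaSq i τ = qParam 4 τ ^ ((![1, 0, 0] : Fin 3 → ℤ) i) * thetaUnit i (qParam 4 τ) := by
  have h : Complex.exp (Real.pi * Complex.I * τ / 4) ^ 2 = qParam 4 τ := by
    rw [qParam, ← Complex.exp_nat_mul]
    congr 1
    push_cast
    ring
  fin_cases i
  · simp [thetaSq, thetaUnit, θ₂_eq, mul_pow, h, qParam_four_sq]
  · simp [thetaSq, thetaUnit, θ₃_eq, qParam_four_sq]
  · simp [thetaSq, thetaUnit, θ₄_eq, qParam_four_sq]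

lemma hasFourierExpansion_thetaSq_quotient (C : ℂ) (i j : Fin 3) :
    HasFourierExpansion fun τ : ℍ => C * (thetaSq i τ ^ 2 / thetaSq j τ) := by
  refine hasFourierExpansion_of_qParam (N := 4) (by norm_num)
    (2 * (![1, 0, 0] : Fin 3 → ℤ) i - (![1, 0, 0] : Fin 3 → ℤ) j)
    (φ := fun x => C * (thetaUnit i x ^ 2 / thetaUnit j x)) (fun x hx => ?_) fun τ => ?_
  · exact (((differentiableAt_thetaUnit i hx).pow 2).div (differentiableAt_thetaUnit j hx)
      (thetaUnit_ne_zero j hx)).const_mul C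
  · have hq : qParam 4 τ ≠ 0 := Function.Periodic.qParam_ne_zero _
    rw [thetaSq_eq_qParam_four, thetaSq_eq_qParam_four, Nat.cast_ofNat, zpow_sub₀ hq, two_mul,
      zpow_add₀ hq]
    ring

lemma mdiff_thetaQuot : MDiff thetaQuot := by
  have h : ∀ τ : ℂ, 0 < τ.im → DifferentiableAt ℂ
      (fun τ => squareSum (-qParam 2 τ) ^ 4 / squareSum (qParam 2 τ) ^ 2) τ := by
    intro τ hτ
    have hx := norm_qParam_two_lt_one hτ
    have h1 := (hasDerivAt_comp_qParam two_pos (fun _ => differentiableAt_squareSum)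
      hτ).differentiableAt
    have h2 := (hasDerivAt_comp_qParam two_pos (fun _ => differentiableAt_squareSum_neg)
      hτ).differentiableAt
    exact (h2.fun_pow 4).fun_div (h1.fun_pow 2) (pow_ne_zero 2 (squareSum_ne_zero hx))
  convert! mdiff_of_differentiableAt h using 2 with τ
  rw [thetaQuot, θ₃_eq, θ₄_eq]

lemma qParam_two_add_two_mul (τ : ℂ) (m : ℤ) : qParam 2 (τ + 2 * m) = qParam 2 τ := by
  rw [qParam_two, qParam_two, show Real.pi * Complex.I * (τ + 2 * m) =
    Real.pi * Complex.I * τ + m * (2 * Real.pi * Complex.I) by ring, Complex.exp_add,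
    Complex.exp_int_mul_two_pi_mul_I, mul_one]

/-- The lower triangular unipotent matrix with lower left entry `k`. -/
def lowerUnipotent (k : ℤ) : SL(2, ℤ) := ⟨!![1, 0; k, 1], by simp [Matrix.det_fin_two]⟩

lemma coe_lowerUnipotent (k : ℤ) :
    (lowerUnipotent k : Matrix (Fin 2) (Fin 2) ℤ) = !![1, 0; k, 1] := rfl

lemma lowerUnipotent_eq (k : ℤ) :
    lowerUnipotent k = ModularGroup.S * ModularGroup.T ^ (-k) * ModularGroup.S⁻¹ := by
  rw [eq_mul_inv_iff_mul_eq]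
  ext i j
  rw [Matrix.SpecialLinearGroup.coe_mul, Matrix.SpecialLinearGroup.coe_mul,
    ModularGroup.coe_T_zpow, ModularGroup.coe_S, coe_lowerUnipotent]
  fin_cases i <;> fin_cases j <;> simp

lemma denom_T_zpow (m : ℤ) (τ : ℍ) :
    UpperHalfPlane.denom ((ModularGroup.T ^ m : SL(2, ℤ)) : GL (Fin 2) ℝ) τ = 1 := by
  rw [ModularGroup.denom_apply, ModularGroup.coe_T_zpow]
  simp

lemma slash_T_zpow_of_periodic {F : ℍ → ℂ} {f : ℂ → ℂ} (hF : ∀ τ : ℍ, F τ = f τ)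
    (hf : ∀ (τ : ℂ) (m : ℤ), f (τ + 2 * m) = f τ) (m : ℤ) :
    F ∣[(1 : ℤ)] (ModularGroup.T ^ (2 * m)) = F := by
  ext τ
  rw [ModularForm.SL_slash_apply, denom_T_zpow, hF, hF, ModularGroup.coe_T_zpow_smul_eq]
  push_cast
  rw [hf]
  simp

lemma thetaQuot_slash_T_zpow (m : ℤ) :
    thetaQuot ∣[(1 : ℤ)] (ModularGroup.T ^ (2 * m)) = thetaQuot :=
  slash_T_zpow_of_periodic (f := fun τ => θ₄ τ ^ 4 / θ₃ τ ^ 2) (fun _ => rfl)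
    (fun τ m => by simp only [θ₃_eq, θ₄_eq, qParam_two_add_two_mul]) m

lemma thetaQuot_slash_S : thetaQuot ∣[(1 : ℤ)] ModularGroup.S =
    fun τ : ℍ => -Complex.I * (θ₂ τ ^ 4 / θ₃ τ ^ 2) := by
  ext τ
  have hτ := τ.ne_zero
  have h3 := θ₃_ne_zero τ.im_pos
  rw [ModularForm.SL_slash_apply, ModularGroup.denom_S, thetaQuot, coe_S_smul, zpow_neg_one,
    θ₃_sq_neg_inv hτ, show θ₄ (-(τ : ℂ)⁻¹) ^ 4 = (θ₄ (-(τ : ℂ)⁻¹) ^ 2) ^ 2 by ring,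
    θ₄_sq_neg_inv hτ]
  have hI := Complex.I_ne_zero
  field_simp

lemma θ₂_pow_four_eq {τ : ℂ} : θ₂ τ ^ 4 = qParam 2 τ * pronicSum (qParam 2 τ) ^ 4 := by
  rw [θ₂_eq, mul_pow, exp_pow_four]

lemma thetaQuot_slash_lowerUnipotent (k : ℤ) :
    thetaQuot ∣[(1 : ℤ)] lowerUnipotent (2 * k) = thetaQuot := by
  have h := slash_T_zpow_of_periodic (F := fun τ : ℍ => -Complex.I * (θ₂ τ ^ 4 / θ₃ τ ^ 2))
    (f := fun τ => -Complex.I * (θ₂ τ ^ 4 / θ₃ τ ^ 2)) (fun _ => rfl)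
    (fun τ m => by simp only [θ₃_eq, θ₂_pow_four_eq, qParam_two_add_two_mul]) (-k)
  rw [lowerUnipotent_eq, SlashAction.slash_mul, SlashAction.slash_mul, thetaQuot_slash_S,
    show -(2 * k) = 2 * -k by ring, h, ← thetaQuot_slash_S, ← SlashAction.slash_mul,
    mul_inv_cancel, SlashAction.slash_one]

lemma exists_abs_sub_two_mul_le (a : ℤ) {c : ℤ} (hc : c ≠ 0) : ∃ k : ℤ, |a - 2 * k * c| ≤ |c| := by
  refine ⟨(a + |c|) / (2 * c), ?_⟩
  have hc2 : 2 * c ≠ 0 := by omega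
  have h1 := Int.emod_nonneg (a + |c|) hc2
  have h2 := Int.emod_lt_abs (a + |c|) hc2
  have h3 := Int.emod_add_mul_ediv (a + |c|) (2 * c)
  rw [abs_mul, abs_two] at h2
  rw [abs_le]
  constructor <;> nlinarith

/-- The subgroup of `Γ(2)` generated by `-1`, `T²` and the transpose of `T²` is all of `Γ(2)`, by the
Euclidean algorithm with even quotients; the induction runs over the size of the lower left
entry. -/
lemma thetaQuot_slash (n : ℕ) : ∀ γ : SL(2, ℤ), (γ 1 0).natAbs = n → 2 ∣ γ 1 0 → 2 ∣ γ 0 1 →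
    thetaQuot ∣[(1 : ℤ)] γ = χ γ • thetaQuot := by
  induction n using Nat.strong_induction_on with
  | _ n ih =>
  intro γ hn hc hb
  have hdet : γ 0 0 * γ 1 1 - γ 0 1 * γ 1 0 = 1 := by
    rw [← Matrix.det_fin_two, γ.det_coe]
  by_cases hc0 : γ 1 0 = 0
  · rw [hc0, mul_zero, sub_zero] at hdet
    obtain ⟨m, hm⟩ := hb
    ext τ
    have hper : ∀ m : ℤ, θ₄ ((τ : ℂ) + 2 * m) ^ 4 / θ₃ ((τ : ℂ) + 2 * m) ^ 2 = thetaQuot τ :=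
      fun m => by simp only [thetaQuot, θ₃_eq, θ₄_eq, qParam_two_add_two_mul]
    rw [ModularForm.SL_slash_apply, denom_eq, thetaQuot, coe_smul_eq, hc0, hm, Pi.smul_apply,
      smul_eq_mul, χ]
    rcases Int.eq_one_or_neg_one_of_mul_eq_one' hdet with ⟨h1, h2⟩ | ⟨h1, h2⟩
    · rw [h1, h2]
      have := hper m
      simpa using this
    · rw [h1, h2]
      have := hper (-m)
      have e : ((ZMod.χ₄ ((-1 : ℤ) : ZMod 4) : ℤ) : ℂ) = -1 := by
        have : ZMod.χ₄ ((-1 : ℤ) : ZMod 4) = -1 := by decide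
        rw [this]; simp
      rw [e, ← this]
      have e2 : (((-1 : ℤ) : ℂ) * τ + ((2 * m : ℤ) : ℂ)) / (((0 : ℤ) : ℂ) * τ + ((-1 : ℤ) : ℂ)) =
          τ + 2 * ((-m : ℤ) : ℂ) := by
        push_cast
        ring
      rw [e2]
      simp
  · obtain ⟨k, hk⟩ := exists_abs_sub_two_mul_le (γ 0 0) hc0
    set a' := γ 0 0 - 2 * k * γ 1 0 with ha'
    set b' := γ 0 1 - 2 * k * γ 1 1 with hb'
    have hdet' : a' * γ 1 1 - b' * γ 1 0 = 1 := by rw [ha', hb']; linear_combination hdet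
    obtain ⟨c₁, hc₁⟩ := hc
    have ha'odd : a' % 2 = 1 := by
      by_contra h
      obtain ⟨a₁, ha₁⟩ : 2 ∣ a' := by omega
      rw [ha₁, hc₁] at hdet'
      have : 2 * (a₁ * γ 1 1 - b' * c₁) = 1 := by linear_combination hdet'
      omega
    have ha'0 : a' ≠ 0 := by omega
    have hlt : |a'| < |γ 1 0| := by
      refine lt_of_le_of_ne hk fun h => ?_
      rcases abs_eq_abs.1 h with h | h <;> omega
    obtain ⟨l, hl⟩ := exists_abs_sub_two_mul_le (γ 1 0) ha'0
    let δ : SL(2, ℤ) := lowerUnipotent (2 * -l) * (ModularGroup.T ^ (2 * -k) * γ)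
    have hδ : (δ : Matrix (Fin 2) (Fin 2) ℤ) = !![1, 0; 2 * -l, 1] * (!![1, 2 * -k; 0, 1] * γ.1) := by
      rw [← coe_lowerUnipotent, ← ModularGroup.coe_T_zpow, ← Matrix.SpecialLinearGroup.coe_mul,
        ← Matrix.SpecialLinearGroup.coe_mul]
    have h10 : δ 1 0 = γ 1 0 - 2 * l * a' := by
      simp [hδ, Matrix.vecMul, dotProduct, Fin.sum_univ_two, ha']
      ring
    have h01 : δ 0 1 = b' := by
      simp [hδ, Matrix.vecMul, dotProduct, Fin.sum_univ_two, hb']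
      ring
    have h11 : δ 1 1 = γ 1 1 - 2 * l * b' := by
      simp [hδ, Matrix.vecMul, dotProduct, Fin.sum_univ_two, hb']
      ring
    have hb'2 : 2 ∣ b' := by
      obtain ⟨b₁, hb₁⟩ := hb
      exact ⟨b₁ - k * γ 1 1, by rw [hb', hb₁]; ring⟩
    have hih := ih (δ 1 0).natAbs (by rw [h10, ← hn]; zify; exact hl.trans_lt hlt) δ rfl
      (by rw [h10]; exact ⟨c₁ - l * a', by rw [hc₁]; ring⟩) (by rw [h01]; exact hb'2)
    have hχ : χ δ = χ γ := by
      obtain ⟨b₁, hb₁⟩ := hb'2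
      have : ((δ 1 1 : ℤ) : ZMod 4) = ((γ 1 1 : ℤ) : ZMod 4) := by
        rw [h11, ZMod.intCast_eq_intCast_iff_dvd_sub]
        exact ⟨l * b₁, by rw [hb₁]; push_cast; ring⟩
      rw [χ, χ, this]
    rw [hχ] at hih
    simp only [δ] at hih
    rwa [SlashAction.slash_mul, SlashAction.slash_mul, thetaQuot_slash_lowerUnipotent,
      thetaQuot_slash_T_zpow] at hih

lemma isFormWithMultiplier_thetaQuot (C : ℂ) :
    IsFormWithMultiplier (CongruenceSubgroup.Gamma 2) 1 χ fun τ : ℍ => C * thetaQuot τ where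
  holo := by
    have h := mdiff_thetaQuot
    rw [UpperHalfPlane.mdifferentiable_iff] at h ⊢
    exact h.const_mul C
  slash γ hγ τ := by
    obtain ⟨-, hb, hc, -⟩ := CongruenceSubgroup.Gamma_mem.1 hγ
    have h := congrFun (thetaQuot_slash _ γ rfl ((ZMod.intCast_zmod_eq_zero_iff_dvd _ 2).1 hc)
      ((ZMod.intCast_zmod_eq_zero_iff_dvd _ 2).1 hb)) τ
    rw [ModularForm.SL_slash_apply] at h ⊢
    rw [mul_assoc, h, Pi.smul_apply, smul_eq_mul]
    ring
  cusps σ := by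
    obtain ⟨π, c, h⟩ := exists_thetaSq_smul σ
    have hF := hasFourierExpansion_thetaSq_quotient (C * (c 2 ^ 2 / c 1)) (π 2) (π 1)
    convert! hF using 2 with τ
    have hd := UpperHalfPlane.denom_ne_zero σ τ
    rw [ModularForm.SL_slash_apply, thetaQuot_eq, h, h, zpow_neg_one]
    field_simp

/-! ### Integrals of ratios of hyperbolic sines -/

/-- `∫₀^L sinh^{2j}`. -/
noncomputable def sinhPowInt (j : ℕ) (L : ℝ) : ℝ := ∫ b in (0 : ℝ)..L, Real.sinh b ^ (2 * j)

/-- `∫₀^L sinh^{2j} / sinh^{2j+1} L`. At `L = 0` this is the junk value `0`, while the limit there is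
`1 / (2j+1)`. -/
noncomputable def sinhRatio (j : ℕ) (L : ℝ) : ℝ := sinhPowInt j L / Real.sinh L ^ (2 * j + 1)

/-- The derivative of `sinhRatio j` at `L > 0`. It extends continuously by `0`, its junk value,
to `L = 0`. -/
noncomputable def sinhRatioDeriv (j : ℕ) (L : ℝ) : ℝ :=
  1 / Real.sinh L - (2 * j + 1) * (Real.cosh L / Real.sinh L) * sinhRatio j L

lemma hasDerivAt_sinhPowInt (j : ℕ) (L : ℝ) :
    HasDerivAt (sinhPowInt j) (Real.sinh L ^ (2 * j)) L :=
  intervalIntegral.integral_hasDerivAt_right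
    (Continuous.intervalIntegrable (by fun_prop) _ _)
    (Continuous.stronglyMeasurableAtFilter (by fun_prop) _ _) (by fun_prop)

lemma hasDerivAt_sinh_pow (n : ℕ) (L : ℝ) :
    HasDerivAt (fun L => Real.sinh L ^ (n + 1)) ((n + 1) * Real.sinh L ^ n * Real.cosh L) L := by
  have := (Real.hasDerivAt_sinh L).fun_pow (n + 1)
  simpa using this

lemma sinhPowInt_succ (j : ℕ) (L : ℝ) :
    (2 * j + 2) * sinhPowInt (j + 1) L =
      Real.sinh L ^ (2 * j + 1) * Real.cosh L - (2 * j + 1) * sinhPowInt j L := by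
  have hd : ∀ b ∈ Set.uIcc 0 L, HasDerivAt (fun b => Real.sinh b ^ (2 * j + 1) * Real.cosh b)
      ((2 * j + 1) * Real.sinh b ^ (2 * j) + (2 * j + 2) * Real.sinh b ^ (2 * (j + 1))) b := by
    intro b _
    refine ((hasDerivAt_sinh_pow (2 * j) b).mul (Real.hasDerivAt_cosh b)).congr_deriv ?_
    have := Real.cosh_sq b
    push_cast
    linear_combination (2 * j + 1) * Real.sinh b ^ (2 * j) * this
  have h := intervalIntegral.integral_eq_sub_of_hasDerivAt hd
    (Continuous.intervalIntegrable (by fun_prop) _ _)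
  rw [intervalIntegral.integral_add (Continuous.intervalIntegrable (by fun_prop) _ _)
    (Continuous.intervalIntegrable (by fun_prop) _ _), intervalIntegral.integral_const_mul,
    intervalIntegral.integral_const_mul] at h
  simp only [Real.sinh_zero, ne_eq, Nat.add_eq_zero_iff, one_ne_zero, and_false, not_false_eq_true,
    zero_pow, zero_mul, sub_zero] at h
  rw [sinhPowInt, sinhPowInt]
  linear_combination h

lemma sinhPowInt_nonneg (j : ℕ) {L : ℝ} (hL : 0 ≤ L) : 0 ≤ sinhPowInt j L :=
  intervalIntegral.integral_nonneg hL fun b _ => by rw [pow_mul]; positivity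

lemma integral_cosh_mul_sinh_pow (j : ℕ) (L : ℝ) :
    ∫ b in (0 : ℝ)..L, (2 * j + 1) * Real.sinh b ^ (2 * j) * Real.cosh b =
      Real.sinh L ^ (2 * j + 1) := by
  have h := intervalIntegral.integral_eq_sub_of_hasDerivAt
    (fun b (_ : b ∈ Set.uIcc 0 L) => hasDerivAt_sinh_pow (2 * j) b)
    (Continuous.intervalIntegrable (by fun_prop) _ _)
  push_cast at h
  rw [h]
  simp

lemma mul_sinhPowInt_le (j : ℕ) {L : ℝ} (hL : 0 ≤ L) :
    (2 * j + 1) * sinhPowInt j L ≤ Real.sinh L ^ (2 * j + 1) := by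
  rw [← integral_cosh_mul_sinh_pow, sinhPowInt, ← intervalIntegral.integral_const_mul]
  refine intervalIntegral.integral_mono_on hL (Continuous.intervalIntegrable (by fun_prop) _ _)
    (Continuous.intervalIntegrable (by fun_prop) _ _) fun b _ => ?_
  refine le_mul_of_one_le_right ?_ (Real.one_le_cosh b)
  rw [pow_mul]
  positivity

lemma le_mul_sinhPowInt (j : ℕ) {L : ℝ} (hL : 0 ≤ L) :
    Real.sinh L ^ (2 * j + 1) ≤ (2 * j + 1) * Real.cosh L * sinhPowInt j L := by
  rw [← integral_cosh_mul_sinh_pow, sinhPowInt, ← intervalIntegral.integral_const_mul]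
  refine intervalIntegral.integral_mono_on hL (Continuous.intervalIntegrable (by fun_prop) _ _)
    (Continuous.intervalIntegrable (by fun_prop) _ _) fun b hb => ?_
  have h1 : Real.cosh b ≤ Real.cosh L := by
    rw [Real.cosh_le_cosh, abs_of_nonneg hb.1, abs_of_nonneg hL]
    exact hb.2
  have h2 : 0 ≤ Real.sinh b ^ (2 * j) := by rw [pow_mul]; positivity
  have : (0 : ℝ) ≤ 2 * j + 1 := by positivity
  calc _ ≤ (2 * (j : ℝ) + 1) * Real.sinh b ^ (2 * j) * Real.cosh L := by gcongr
    _ = _ := by ring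

lemma sinhRatio_nonneg (j : ℕ) {L : ℝ} (hL : 0 ≤ L) : 0 ≤ sinhRatio j L :=
  div_nonneg (sinhPowInt_nonneg j hL) (pow_nonneg (Real.sinh_nonneg_iff.2 hL) _)

lemma sinhRatio_le_one (j : ℕ) {L : ℝ} (hL : 0 ≤ L) : sinhRatio j L ≤ 1 := by
  have hs := pow_nonneg (Real.sinh_nonneg_iff.2 hL) (2 * j + 1)
  refine div_le_one_of_le₀ ?_ hs
  have h1 := mul_sinhPowInt_le j hL
  have h2 := sinhPowInt_nonneg j hL
  nlinarith [mul_nonneg (Nat.cast_nonneg (α := ℝ) j) h2]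

lemma sinhPowInt_le (j : ℕ) {L : ℝ} (hL : 0 ≤ L) : sinhPowInt j L ≤ L * Real.sinh L ^ (2 * j) := by
  have h : sinhPowInt j L ≤ ∫ _ in (0 : ℝ)..L, Real.sinh L ^ (2 * j) := by
    refine intervalIntegral.integral_mono_on hL (Continuous.intervalIntegrable (by fun_prop) _ _)
      (Continuous.intervalIntegrable (by fun_prop) _ _) fun b hb => ?_
    have := Real.sinh_nonneg_iff.2 hb.1
    have := Real.sinh_le_sinh.2 hb.2
    gcongr
  simpa using h

lemma div_sinh_le {L : ℝ} (hL : 0 < L) : L / Real.sinh L ≤ 2 * Real.exp (-(1 / 2) * L) := by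
  have hs := Real.sinh_pos_iff.2 hL
  have h1 : Real.sinh L = 2 * Real.sinh (L / 2) * Real.cosh (L / 2) := by
    rw [← Real.sinh_two_mul]; congr 1; ring
  have h2 : L / 2 ≤ Real.sinh (L / 2) := Real.self_le_sinh_iff.2 (by linarith)
  have h3 : Real.exp (L / 2) / 2 ≤ Real.cosh (L / 2) := by
    rw [Real.cosh_eq]
    have := Real.exp_pos (-(L / 2))
    linarith
  rw [div_le_iff₀ hs, h1]
  have h4 : Real.exp (-(1 / 2) * L) * Real.exp (L / 2) = 1 := by
    rw [← Real.exp_add, show -(1 / 2) * L + L / 2 = 0 by ring, Real.exp_zero]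
  have h5 : L / 2 * (Real.exp (L / 2) / 2) ≤ Real.sinh (L / 2) * Real.cosh (L / 2) := by
    gcongr
  have h6 := mul_le_mul_of_nonneg_left h5 (Real.exp_pos (-(1 / 2) * L)).le
  nlinarith

lemma sinhRatio_le (j : ℕ) {L : ℝ} (hL : 0 < L) :
    sinhRatio j L ≤ 2 * Real.exp (-(1 / 2) * L) := by
  have hs := Real.sinh_pos_iff.2 hL
  refine le_trans ?_ (div_sinh_le hL)
  rw [sinhRatio, div_le_div_iff₀ (pow_pos hs _) hs]
  calc _ ≤ L * Real.sinh L ^ (2 * j) * Real.sinh L := by gcongr; exact sinhPowInt_le j hL.le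
    _ = _ := by ring

lemma hasDerivAt_sinhRatio (j : ℕ) {L : ℝ} (hL : 0 < L) :
    HasDerivAt (sinhRatio j) (sinhRatioDeriv j L) L := by
  have hs := (Real.sinh_pos_iff.2 hL).ne'
  refine ((hasDerivAt_sinhPowInt j L).div (hasDerivAt_sinh_pow (2 * j) L)
    (pow_ne_zero _ hs)).congr_deriv ?_
  rw [sinhRatioDeriv, sinhRatio]
  push_cast
  field_simp
  ring

/-- `((2j+1)² - d²/dL²) ψ_j = (2j+2)² ψ_{j+1}` for `ψ_j = sinhRatio j`. -/
lemma hasDerivAt_sinhRatioDeriv (j : ℕ) {L : ℝ} (hL : 0 < L) :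
    HasDerivAt (sinhRatioDeriv j)
      ((2 * j + 1) ^ 2 * sinhRatio j L - (2 * j + 2) ^ 2 * sinhRatio (j + 1) L) L := by
  have hs := (Real.sinh_pos_iff.2 hL).ne'
  have h1 := (hasDerivAt_const L (1 : ℝ)).div (Real.hasDerivAt_sinh L) hs
  have h2 := (((Real.hasDerivAt_cosh L).div (Real.hasDerivAt_sinh L) hs).const_mul
    (2 * (j : ℝ) + 1)).mul (hasDerivAt_sinhRatio j hL)
  refine (h1.sub h2).congr_deriv ?_
  have hc := Real.cosh_sq L
  have e1 : (2 * j + 2) * sinhRatio (j + 1) L =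
      Real.cosh L / Real.sinh L ^ 2 - (2 * j + 1) * sinhRatio j L / Real.sinh L ^ 2 := by
    rw [sinhRatio, ← mul_div_assoc, sinhPowInt_succ, sinhRatio]
    field_simp
    ring
  rw [show (2 * (j : ℝ) + 2) ^ 2 * sinhRatio (j + 1) L =
    (2 * j + 2) * ((2 * j + 2) * sinhRatio (j + 1) L) by ring, e1, sinhRatioDeriv]
  simp only [Pi.div_apply]
  field_simp
  linear_combination (2 * (j : ℝ) + 1) * sinhRatio j L * (2 * j + 2) * hc

lemma abs_sinhRatioDeriv_le_sinh (j : ℕ) {L : ℝ} (hL : 0 ≤ L) :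
    |sinhRatioDeriv j L| ≤ Real.sinh L := by
  rcases hL.eq_or_lt with rfl | hL
  · simp [sinhRatioDeriv]
  have hs := Real.sinh_pos_iff.2 hL
  have hc := Real.cosh_sq L
  have hc1 := Real.one_le_cosh L
  have h1 := mul_sinhPowInt_le j hL.le
  have h2 := le_mul_sinhPowInt j hL.le
  have hp := pow_pos hs (2 * j + 1)
  have e : (2 * j + 1) * Real.cosh L * sinhPowInt j L =
      (2 * j + 1) * Real.cosh L * sinhRatio j L * Real.sinh L ^ (2 * j + 1) := by
    rw [sinhRatio, mul_assoc _ _ (_ ^ _), div_mul_cancel₀ _ hp.ne']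
  have e' : (2 * j + 1) * sinhPowInt j L =
      (2 * j + 1) * sinhRatio j L * Real.sinh L ^ (2 * j + 1) := by
    rw [sinhRatio, mul_assoc _ _ (_ ^ _), div_mul_cancel₀ _ hp.ne']
  rw [e] at h2
  rw [e'] at h1
  have h1' : (2 * j + 1) * sinhRatio j L ≤ 1 := by
    refine le_of_mul_le_mul_right ?_ hp
    linarith
  have h2' : 1 ≤ (2 * j + 1) * Real.cosh L * sinhRatio j L := by
    refine le_of_mul_le_mul_right ?_ hp
    linarith
  have e3 : sinhRatioDeriv j L =
      (1 - (2 * j + 1) * Real.cosh L * sinhRatio j L) / Real.sinh L := by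
    rw [sinhRatioDeriv]
    field_simp
  rw [e3, abs_div, abs_of_pos hs, abs_of_nonpos (by linarith), div_le_iff₀ hs]
  nlinarith

lemma abs_sinhRatioDeriv_le_exp (j : ℕ) {L : ℝ} (hL : 1 ≤ L) :
    |sinhRatioDeriv j L| ≤ (4 * j + 3) * (2 * Real.exp (-(1 / 2) * L)) := by
  have hL0 : 0 < L := by linarith
  have hs := Real.sinh_pos_iff.2 hL0
  have hLs := Real.self_le_sinh_iff.2 hL0.le
  have h1 : 1 / Real.sinh L ≤ 2 * Real.exp (-(1 / 2) * L) := by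
    refine le_trans ?_ (div_sinh_le hL0)
    gcongr
  have h2 : Real.cosh L / Real.sinh L ≤ 2 := by
    rw [div_le_iff₀ hs]
    have h3 := Real.cosh_sub_sinh L
    have h4 : Real.exp (-L) ≤ 1 := Real.exp_le_one_iff.2 (by linarith)
    linarith
  have h3 := sinhRatio_le j hL0
  have h0 := sinhRatio_nonneg j hL0.le
  have h5 : 0 ≤ Real.cosh L / Real.sinh L := by positivity
  have h6 : (0 : ℝ) ≤ 1 / Real.sinh L := by positivity
  have h7 : (2 * j + 1) * (Real.cosh L / Real.sinh L) * sinhRatio j L ≤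
      (2 * j + 1) * 2 * (2 * Real.exp (-(1 / 2) * L)) := by gcongr
  have h8 : 0 ≤ (2 * j + 1) * (Real.cosh L / Real.sinh L) * sinhRatio j L := by positivity
  rw [sinhRatioDeriv, abs_le]
  constructor <;> linarith

lemma integrableOn_pow_mul_exp (m : ℕ) :
    MeasureTheory.IntegrableOn (fun L : ℝ => L ^ m * (2 * Real.exp (-(1 / 2) * L)))
      (Set.Ioi 0) := by
  have h : MeasureTheory.IntegrableOn _ (Set.Ioi (0 : ℝ)) MeasureTheory.volume :=
    (integrableOn_rpow_mul_exp_neg_mul_rpow (s := m) (p := 1) (b := 1 / 2)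
    (by have := m.cast_nonneg (α := ℝ); linarith) one_pos (by norm_num)).const_mul 2
  refine MeasureTheory.IntegrableOn.congr_fun h (fun L _ => ?_) measurableSet_Ioi
  simp only [Real.rpow_natCast, Real.rpow_one]
  ring

lemma integrableOn_pow_mul_sinhRatio (m j : ℕ) :
    MeasureTheory.IntegrableOn (fun L : ℝ => L ^ m * sinhRatio j L) (Set.Ioi 0) := by
  refine MeasureTheory.Integrable.mono' (integrableOn_pow_mul_exp m) ?_ ?_
  · refine ContinuousOn.aestronglyMeasurable (fun L hL => ?_) measurableSet_Ioi
    exact ((continuousAt_id.pow m).mul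
      (hasDerivAt_sinhRatio j hL).continuousAt).continuousWithinAt
  · refine MeasureTheory.ae_restrict_of_forall_mem measurableSet_Ioi fun L hL => ?_
    have hL' : 0 < L := hL
    rw [Real.norm_of_nonneg (mul_nonneg (by positivity) (sinhRatio_nonneg j hL'.le))]
    have := sinhRatio_le j hL
    gcongr

/-- The moments `∫₀^∞ L^m ψ_j(L) dL`, where `ψ_j = sinhRatio j`. -/
noncomputable def sinhMoment (m j : ℕ) : ℝ := ∫ L in Set.Ioi (0 : ℝ), L ^ m * sinhRatio j L

lemma tendsto_pow_mul_exp (m : ℕ) :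
    Tendsto (fun L : ℝ => L ^ m * (2 * Real.exp (-(1 / 2) * L))) atTop (𝓝 0) := by
  have h := (tendsto_rpow_mul_exp_neg_mul_atTop_nhds_zero m (1 / 2) (by norm_num)).const_mul 2
  rw [mul_zero] at h
  refine h.congr fun L => ?_
  rw [Real.rpow_natCast]
  ring

/-- Integration of the differential equation of `ψ_j`; the boundary terms vanish. -/
lemma sinhMoment_zero_succ (j : ℕ) :
    (2 * j + 2) ^ 2 * sinhMoment 0 (j + 1) = (2 * j + 1) ^ 2 * sinhMoment 0 j := by
  have hi : ∀ j, MeasureTheory.IntegrableOn (sinhRatio j) (Set.Ioi 0) := fun j => by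
    simpa using integrableOn_pow_mul_sinhRatio 0 j
  have hcont : ContinuousWithinAt (sinhRatioDeriv j) (Set.Ici 0) 0 := by
    have h0 : sinhRatioDeriv j 0 = 0 := by simp [sinhRatioDeriv]
    rw [ContinuousWithinAt, h0]
    refine squeeze_zero_norm' (a := Real.sinh) ?_ ?_
    · filter_upwards [self_mem_nhdsWithin] with L hL using abs_sinhRatioDeriv_le_sinh j hL
    · have := Real.continuous_sinh.tendsto 0
      rw [Real.sinh_zero] at this
      exact this.mono_left nhdsWithin_le_nhds
  have hlim : Tendsto (sinhRatioDeriv j) atTop (𝓝 0) := by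
    refine squeeze_zero_norm' (a := fun L => (4 * j + 3) * (L ^ 0 * (2 * Real.exp (-(1 / 2) * L))))
      ?_ ?_
    · filter_upwards [eventually_ge_atTop 1] with L hL
      rw [pow_zero, one_mul]
      exact abs_sinhRatioDeriv_le_exp j hL
    · simpa only [mul_zero] using (tendsto_pow_mul_exp 0).const_mul (4 * (j : ℝ) + 3)
  have h := MeasureTheory.integral_Ioi_of_hasDerivAt_of_tendsto hcont
    (fun L hL => hasDerivAt_sinhRatioDeriv j hL)
    (((hi j).const_mul _).sub ((hi (j + 1)).const_mul _)) hlim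
  rw [MeasureTheory.integral_sub ((hi j).const_mul _) ((hi (j + 1)).const_mul _),
    MeasureTheory.integral_const_mul, MeasureTheory.integral_const_mul] at h
  have h0 : sinhRatioDeriv j 0 = 0 := by simp [sinhRatioDeriv]
  simp only [sinhMoment, pow_zero, one_mul]
  rw [h0] at h
  linear_combination -h

/-- Here `L² ψ_j' - 2 L ψ_j` is an antiderivative of `L² ψ_j'' - 2 ψ_j`. -/
lemma sinhMoment_two_succ (j : ℕ) :
    (2 * j + 2) ^ 2 * sinhMoment 2 (j + 1) =
      (2 * j + 1) ^ 2 * sinhMoment 2 j - 2 * sinhMoment 0 j := by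
  have hi0 : MeasureTheory.IntegrableOn (sinhRatio j) (Set.Ioi 0) := by
    simpa using integrableOn_pow_mul_sinhRatio 0 j
  have hi := integrableOn_pow_mul_sinhRatio 2
  let f : ℝ → ℝ := fun L => L ^ 2 * sinhRatioDeriv j L - 2 * L * sinhRatio j L
  have hf0 : f 0 = 0 := by simp [f]
  have hcont : ContinuousWithinAt f (Set.Ici 0) 0 := by
    rw [ContinuousWithinAt, hf0]
    refine squeeze_zero_norm' (a := fun L => L ^ 2 * Real.sinh L + 2 * L) ?_ ?_
    · filter_upwards [self_mem_nhdsWithin] with L hL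
      have hL' : 0 ≤ L := hL
      have h1 := abs_sinhRatioDeriv_le_sinh j hL'
      have h2 := sinhRatio_le_one j hL'
      have h3 := sinhRatio_nonneg j hL'
      refine (norm_sub_le _ _).trans ?_
      rw [norm_mul, norm_mul, Real.norm_of_nonneg (by positivity : 0 ≤ L ^ 2),
        Real.norm_of_nonneg (by positivity : 0 ≤ 2 * L), Real.norm_of_nonneg h3, Real.norm_eq_abs]
      have : 2 * L * sinhRatio j L ≤ 2 * L * 1 := by gcongr
      have : L ^ 2 * |sinhRatioDeriv j L| ≤ L ^ 2 * Real.sinh L := by gcongr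
      linarith
    · have hc : Continuous fun L : ℝ => L ^ 2 * Real.sinh L + 2 * L := by fun_prop
      have := hc.tendsto 0
      simp only [ne_eq, OfNat.ofNat_ne_zero, not_false_eq_true, zero_pow, zero_mul, mul_zero,
        add_zero] at this
      exact this.mono_left nhdsWithin_le_nhds
  have hlim : Tendsto f atTop (𝓝 0) := by
    refine squeeze_zero_norm' (a := fun L => (4 * j + 3) * (L ^ 2 * (2 * Real.exp (-(1 / 2) * L)))
      + 2 * (L ^ 1 * (2 * Real.exp (-(1 / 2) * L)))) ?_ ?_
    · filter_upwards [eventually_ge_atTop 1] with L hL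
      have hL' : 0 < L := by linarith
      have h1 := abs_sinhRatioDeriv_le_exp j hL
      have h2 := sinhRatio_le j hL'
      have h3 := sinhRatio_nonneg j hL'.le
      refine (norm_sub_le _ _).trans ?_
      rw [norm_mul, norm_mul, Real.norm_of_nonneg (by positivity : 0 ≤ L ^ 2),
        Real.norm_of_nonneg (by positivity : 0 ≤ 2 * L), Real.norm_of_nonneg h3, Real.norm_eq_abs]
      have : 2 * L * sinhRatio j L ≤ 2 * L * (2 * Real.exp (-(1 / 2) * L)) := by gcongr
      have : L ^ 2 * |sinhRatioDeriv j L| ≤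
          L ^ 2 * ((4 * j + 3) * (2 * Real.exp (-(1 / 2) * L))) := by gcongr
      linarith
    · simpa only [mul_zero, add_zero] using
        ((tendsto_pow_mul_exp 2).const_mul (4 * (j : ℝ) + 3)).add
        ((tendsto_pow_mul_exp 1).const_mul 2)
  have hint : MeasureTheory.IntegrableOn (fun L : ℝ => (2 * (j : ℝ) + 1) ^ 2 *
      (L ^ 2 * sinhRatio j L) - (2 * (j : ℝ) + 2) ^ 2 * (L ^ 2 * sinhRatio (j + 1) L))
      (Set.Ioi 0) :=
    ((hi j).const_mul ((2 * (j : ℝ) + 1) ^ 2)).sub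
      ((hi (j + 1)).const_mul ((2 * (j : ℝ) + 2) ^ 2))
  have h := MeasureTheory.integral_Ioi_of_hasDerivAt_of_tendsto hcont (fun L hL => by
    have h1 := (((hasDerivAt_pow 2 L).mul (hasDerivAt_sinhRatioDeriv j hL)).sub
      (((hasDerivAt_id L).const_mul 2).mul (hasDerivAt_sinhRatio j hL)))
    refine h1.congr_deriv (g' := (2 * (j : ℝ) + 1) ^ 2 * (L ^ 2 * sinhRatio j L)
      - (2 * (j : ℝ) + 2) ^ 2 * (L ^ 2 * sinhRatio (j + 1) L) - 2 * sinhRatio j L) ?_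
    simp only [id]
    push_cast
    ring) (hint.sub (hi0.const_mul 2)) hlim
  simp only [Pi.sub_apply] at h
  rw [MeasureTheory.integral_sub hint (hi0.const_mul 2), MeasureTheory.integral_sub
    ((hi j).const_mul _) ((hi (j + 1)).const_mul _), MeasureTheory.integral_const_mul,
    MeasureTheory.integral_const_mul, MeasureTheory.integral_const_mul, hf0] at h
  simp only [sinhMoment, pow_zero, one_mul]
  linear_combination -h

lemma sinhMoment_nonneg (m j : ℕ) : 0 ≤ sinhMoment m j :=
  MeasureTheory.setIntegral_nonneg measurableSet_Ioi fun L hL => by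
    have : 0 < L := hL
    have := sinhRatio_nonneg j this.le
    positivity

lemma sinhRatio_zero_eq (L : ℝ) : sinhRatio 0 L = L / Real.sinh L := by
  simp [sinhRatio, sinhPowInt]

lemma hasSum_div_sinh {L : ℝ} (hL : 0 < L) :
    HasSum (fun i : ℕ => 2 * Real.exp (-((2 * i + 1) * L))) (1 / Real.sinh L) := by
  have h1 : Real.exp (-(2 * L)) < 1 := by
    rw [← Real.exp_zero]
    exact Real.exp_lt_exp.2 (by linarith)
  have h := (hasSum_geometric_of_lt_one (Real.exp_pos _).le h1).mul_left (2 * Real.exp (-L))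
  have hs := (Real.sinh_pos_iff.2 hL).ne'
  have e1 : Real.exp (-(2 * L)) = Real.exp (-L) * Real.exp (-L) := by
    rw [← Real.exp_add]; congr 1; ring
  have e2 : Real.exp L * Real.exp (-L) = 1 := by rw [← Real.exp_add]; simp
  have e3 : 2 * Real.sinh L = Real.exp L - Real.exp (-L) := by rw [Real.sinh_eq]; ring
  convert! h using 1
  · ext i
    rw [← Real.exp_nat_mul, mul_assoc, ← Real.exp_add]
    congr 2
    ring
  · rw [← div_eq_mul_inv, div_eq_div_iff hs (by linarith)]
    rw [e1]
    linear_combination -Real.exp (-L) * e3 - e2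

/-- Expansion of `1 / sinh L` in exponentials reduces the moments of `ψ_0 = L / sinh L` to Gamma
integrals. -/
lemma sinhMoment_zero_eq (m : ℕ) : HasSum
    (fun i : ℕ => 2 * (m + 1).factorial * (1 / ((2 * i + 1 : ℝ)) ^ (m + 2))) (sinhMoment m 0) := by
  let F : ℕ → ℝ → ℝ := fun i L => 2 * (L ^ (m + 1) * Real.exp (-((2 * i + 1) * L)))
  have hr : ∀ i : ℕ, (0 : ℝ) < 2 * i + 1 := fun i => by positivity
  have hFint : ∀ i, ∫ L in Set.Ioi (0 : ℝ), F i L =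
      2 * (m + 1).factorial * (1 / ((2 * i + 1 : ℝ)) ^ (m + 2)) := by
    intro i
    have h := Real.integral_rpow_mul_exp_neg_mul_Ioi (a := ((m + 1 : ℕ) : ℝ) + 1) (r := 2 * i + 1)
      (by positivity) (hr i)
    rw [Real.Gamma_nat_eq_factorial] at h
    simp only [F, MeasureTheory.integral_const_mul]
    simp only [add_sub_cancel_right, Real.rpow_natCast] at h
    rw [h, show ((m + 1 : ℕ) : ℝ) + 1 = ((m + 2 : ℕ) : ℝ) by push_cast; ring, Real.rpow_natCast,
      div_pow, one_pow]
    ring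
  have hFi : ∀ i, MeasureTheory.Integrable (F i)
      (MeasureTheory.volume.restrict (Set.Ioi (0 : ℝ))) := by
    intro i
    refine MeasureTheory.Integrable.of_integral_ne_zero ?_
    rw [hFint]
    have := hr i
    positivity
  have hnorm : ∀ i, ∫ L in Set.Ioi (0 : ℝ), ‖F i L‖ = ∫ L in Set.Ioi (0 : ℝ), F i L := fun i =>
    MeasureTheory.setIntegral_congr_fun measurableSet_Ioi fun L hL => by
      have : (0 : ℝ) < L := hL
      exact Real.norm_of_nonneg (by positivity)
  have hsum : Summable fun i : ℕ => (1 / ((2 * i + 1 : ℝ)) ^ (m + 2)) := by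
    have h := (Real.summable_one_div_nat_pow (p := m + 2)).2 (by omega)
    refine (h.comp_injective (i := fun i : ℕ => 2 * i + 1) fun a b h => by simpa using h).congr
      fun i => ?_
    simp
  have key := MeasureTheory.hasSum_integral_of_summable_integral_norm hFi (by
    simp only [hnorm, hFint]
    exact hsum.mul_left _)
  simp only [hFint] at key
  convert! key using 1
  refine MeasureTheory.setIntegral_congr_fun measurableSet_Ioi fun L hL => ?_
  have h := ((hasSum_div_sinh hL).mul_left (L ^ (m + 1))).tsum_eq
  simp only [F, sinhRatio_zero_eq]
  rw [show (∑' i : ℕ, 2 * (L ^ (m + 1) * Real.exp (-((2 * i + 1) * L)))) =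
    ∑' i : ℕ, L ^ (m + 1) * (2 * Real.exp (-((2 * i + 1) * L))) from tsum_congr fun i => by ring, h]
  ring

lemma hasSum_odd_of_hasSum {k : ℕ} {S : ℝ}
    (h : HasSum (fun n : ℕ => (1 : ℝ) / (n : ℝ) ^ k) S) :
    HasSum (fun i : ℕ => 1 / ((2 * i + 1 : ℝ)) ^ k) (S * (1 - 1 / 2 ^ k)) := by
  have hodd : Summable fun i : ℕ => 1 / ((2 * i + 1 : ℝ)) ^ k := by
    refine (h.summable.comp_injective (i := fun i : ℕ => 2 * i + 1)
      fun a b h => by simpa using h).congr fun i => ?_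
    simp
  obtain ⟨s, hs⟩ := hodd
  have heven : HasSum (fun i : ℕ => (1 : ℝ) / ((2 * i : ℕ) : ℝ) ^ k) (1 / 2 ^ k * S) := by
    refine (h.mul_left (1 / 2 ^ k)).congr_fun fun i => ?_
    push_cast
    rw [mul_pow, one_div_mul_one_div]
  have hsum := HasSum.even_add_odd heven
    (f := fun n : ℕ => (1 : ℝ) / (n : ℝ) ^ k) (by simpa using hs)
  have := hsum.unique h
  convert! hs using 1
  linear_combination -this

/-- The values `∫ L / sinh L = π²/4` and `∫ L³ / sinh L = π⁴/8` give this ratio. -/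
lemma sinhMoment_two_zero : sinhMoment 2 0 = Real.pi ^ 2 / 2 * sinhMoment 0 0 := by
  have e0 : HasSum (fun i : ℕ => 2 * (1 / ((2 * i + 1 : ℝ)) ^ 2)) (sinhMoment 0 0) := by
    simpa using sinhMoment_zero_eq 0
  have e2 : HasSum (fun i : ℕ => 12 * (1 / ((2 * i + 1 : ℝ)) ^ 4)) (sinhMoment 2 0) := by
    have h := sinhMoment_zero_eq 2
    have e : (2 : ℝ) * ((2 + 1).factorial : ℕ) = 12 := by norm_num [Nat.factorial]
    simp only [e] at h
    exact h
  have h0 := e0.unique ((hasSum_odd_of_hasSum hasSum_zeta_two).mul_left 2)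
  have h2 := e2.unique
    ((hasSum_odd_of_hasSum hasSum_zeta_four).mul_left 12)
  rw [h0, h2]
  ring

open MeasureTheory

/-! ### The cube integrals as moments -/

lemma lintegral_Icc_eq_lintegral_exp (f : ℝ → ENNReal) :
    ∫⁻ u in Set.Icc (0 : ℝ) 1, f u =
      ∫⁻ x in Set.Ioi (0 : ℝ), ENNReal.ofReal (Real.exp (-x)) * f (Real.exp (-x)) := by
  have him : (fun x : ℝ => Real.exp (-x)) '' Set.Ioi 0 = Set.Ioo 0 1 := by
    ext u
    constructor
    · rintro ⟨x, hx, rfl⟩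
      have hx' : 0 < x := hx
      refine ⟨Real.exp_pos _, ?_⟩
      simpa using hx'
    · rintro ⟨h0, h1⟩
      exact ⟨-Real.log u, by simpa using Real.log_neg h0 h1, by simp [Real.exp_log h0]⟩
  have hd : ∀ x ∈ Set.Ioi (0 : ℝ), HasDerivWithinAt (fun x : ℝ => Real.exp (-x))
      (-Real.exp (-x)) (Set.Ioi 0) x := fun x _ => by
    simpa using ((hasDerivAt_neg x).exp).hasDerivWithinAt
  have hinj : Set.InjOn (fun x : ℝ => Real.exp (-x)) (Set.Ioi 0) := fun a _ b _ h => by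
    simpa using h
  rw [← setLIntegral_congr Ioo_ae_eq_Icc, ← him,
    lintegral_image_eq_lintegral_abs_deriv_mul measurableSet_Ioi hd hinj]
  simp [abs_of_pos (Real.exp_pos _)]

/-- The substitution `s = x + y` in an integral over the positive quadrant. -/
lemma lintegral_lintegral_add {p : ℝ → ℝ → ENNReal} (hp : Measurable (Function.uncurry p)) :
    ∫⁻ x in Set.Ioi (0 : ℝ), ∫⁻ y in Set.Ioi (0 : ℝ), p x (x + y) =
      ∫⁻ s in Set.Ioi (0 : ℝ), ∫⁻ x in Set.Ioo 0 s, p x s := by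
  have h1 : ∀ x : ℝ, ∫⁻ y in Set.Ioi (0 : ℝ), p x (x + y) = ∫⁻ s in Set.Ioi x, p x s := fun x => by
    have h := (measurePreserving_add_left volume x).setLIntegral_comp_preimage_emb
      (MeasurableEquiv.addLeft x).measurableEmbedding (p x) (Set.Ioi x)
    simpa using h
  simp only [h1]
  have hset : MeasurableSet {z : ℝ × ℝ | 0 < z.1 ∧ z.1 < z.2} :=
    (measurableSet_lt measurable_const measurable_fst).inter
      (measurableSet_lt measurable_fst measurable_snd)
  let P : ℝ → ℝ → ENNReal := fun x s =>
    {z : ℝ × ℝ | 0 < z.1 ∧ z.1 < z.2}.indicator (Function.uncurry p) (x, s)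
  have hP : Measurable (Function.uncurry P) := hp.indicator hset
  have h2 : ∫⁻ x in Set.Ioi (0 : ℝ), ∫⁻ s in Set.Ioi x, p x s = ∫⁻ x, ∫⁻ s, P x s := by
    rw [← lintegral_indicator measurableSet_Ioi]
    refine lintegral_congr fun x => ?_
    by_cases hx : 0 < x
    · rw [Set.indicator_of_mem (show x ∈ Set.Ioi 0 from hx),
        ← lintegral_indicator measurableSet_Ioi]
      refine lintegral_congr fun s => ?_
      simp [P, Set.indicator, hx]
    · rw [Set.indicator_of_notMem (show x ∉ Set.Ioi 0 from hx)]
      simp [P, Set.indicator, hx]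
  have h3 : ∫⁻ s in Set.Ioi (0 : ℝ), ∫⁻ x in Set.Ioo 0 s, p x s = ∫⁻ s, ∫⁻ x, P x s := by
    rw [← lintegral_indicator measurableSet_Ioi]
    refine lintegral_congr fun s => ?_
    by_cases hs : 0 < s
    · rw [Set.indicator_of_mem (show s ∈ Set.Ioi 0 from hs),
        ← lintegral_indicator measurableSet_Ioo]
      refine lintegral_congr fun x => ?_
      simp [P, Set.indicator]
    · rw [Set.indicator_of_notMem (show s ∉ Set.Ioi 0 from hs)]
      have : ∀ x, P x s = 0 := fun x => by
        simp only [P]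
        rw [Set.indicator_of_notMem]
        rintro ⟨ha, hb⟩
        exact hs (ha.trans hb)
      simp [this]
  rw [h2, h3]
  exact lintegral_lintegral_swap hP.aemeasurable

/-- The density of `-log (u_0 ⋯ u_n)` for independent uniformly distributed `u_i ∈ [0,1]`. -/
noncomputable def erlangDensity (n : ℕ) (x : ℝ) : ℝ := x ^ n / n.factorial * Real.exp (-x)

lemma continuous_erlangDensity (n : ℕ) : Continuous (erlangDensity n) := by
  unfold erlangDensity
  fun_prop

lemma erlangDensity_nonneg (n : ℕ) {x : ℝ} (hx : 0 ≤ x) : 0 ≤ erlangDensity n x := by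
  unfold erlangDensity
  positivity

lemma integral_exp_mul_erlangDensity (n : ℕ) (s : ℝ) :
    ∫ x in (0 : ℝ)..s, Real.exp (-(s - x)) * erlangDensity n x = erlangDensity (n + 1) s := by
  have h : ∀ x, Real.exp (-(s - x)) * erlangDensity n x =
      Real.exp (-s) / n.factorial * x ^ n := fun x => by
    have : Real.exp (-s) = Real.exp (-(s - x)) * Real.exp (-x) := by
      rw [← Real.exp_add]; congr 1; ring
    rw [this, erlangDensity]
    ring
  rw [intervalIntegral.integral_congr fun x _ => h x, intervalIntegral.integral_const_mul,
    integral_pow, erlangDensity, Nat.factorial_succ]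
  have := n.factorial_ne_zero
  push_cast
  field_simp
  simp

lemma lintegral_Ioo_ofReal {f : ℝ → ℝ} {s : ℝ} (hs : 0 ≤ s) (hf : Continuous f)
    (h0 : ∀ x ∈ Set.Ioo 0 s, 0 ≤ f x) :
    ∫⁻ x in Set.Ioo 0 s, ENNReal.ofReal (f x) = ENNReal.ofReal (∫ x in (0 : ℝ)..s, f x) := by
  rw [intervalIntegral.integral_of_le hs, integral_Ioc_eq_integral_Ioo,
    ofReal_integral_eq_lintegral_ofReal]
  · exact (hf.integrableOn_Icc (a := 0) (b := s)).mono_set Set.Ioo_subset_Icc_self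
  · exact ae_restrict_of_forall_mem measurableSet_Ioo h0

lemma lintegral_cube_succ {n : ℕ} {F : (Fin (n + 1) → ℝ) → ENNReal} (hF : Measurable F) :
    ∫⁻ u in Set.Icc (0 : Fin (n + 1) → ℝ) 1, F u =
      ∫⁻ x in Set.Icc (0 : ℝ) 1, ∫⁻ v in Set.Icc (0 : Fin n → ℝ) 1, F (Fin.cons x v) := by
  let e := (MeasurableEquiv.piFinSuccAbove (fun _ : Fin (n + 1) => ℝ) 0).symm
  have he : MeasurePreserving e :=
    (volume_preserving_piFinSuccAbove (fun _ : Fin (n + 1) => ℝ) 0).symm _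
  have hset : e ⁻¹' Set.Icc 0 1 = Set.Icc (0 : ℝ) 1 ×ˢ Set.Icc (0 : Fin n → ℝ) 1 :=
    ((Fin.insertNthOrderIso (fun _ => ℝ) 0).preimage_Icc _ _).trans (Set.Icc_prod_eq _ _)
  have h := he.setLIntegral_comp_preimage_emb e.measurableEmbedding F (Set.Icc 0 1)
  rw [← h, hset, Measure.volume_eq_prod,
    setLIntegral_prod (fun z => F (e z)) (hF.comp e.measurable).aemeasurable]
  simp only [e, MeasurableEquiv.piFinSuccAbove, Fin.insertNthEquiv_zero]
  rfl

lemma lintegral_cube_fin_prod (n : ℕ) {f : ℝ → ENNReal} (hf : Measurable f) :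
    ∫⁻ u in Set.Icc (0 : Fin (n + 1) → ℝ) 1, f (∏ i, u i) =
      ∫⁻ x in Set.Ioi (0 : ℝ), ENNReal.ofReal (erlangDensity n x) * f (Real.exp (-x)) := by
  induction n generalizing f with
  | zero =>
    rw [lintegral_cube_succ (F := fun u => f (∏ i, u i)) (hf.comp (by fun_prop))]
    simp only [erlangDensity, pow_zero, Nat.factorial_zero, Nat.cast_one, div_one, one_mul]
    rw [← lintegral_Icc_eq_lintegral_exp]
    refine lintegral_congr fun x => ?_
    rw [Measure.volume_pi_eq_dirac]
    simp
  | succ n ih =>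
    rw [lintegral_cube_succ (F := fun u => f (∏ i, u i)) (hf.comp (by fun_prop)),
      lintegral_Icc_eq_lintegral_exp]
    have h1 : ∀ x : ℝ, ENNReal.ofReal (Real.exp (-x)) *
        (∫⁻ v in Set.Icc (0 : Fin (n + 1) → ℝ) 1,
          f (∏ i, (Fin.cons (Real.exp (-x)) v : Fin (n + 2) → ℝ) i)) =
        ∫⁻ y in Set.Ioi (0 : ℝ), ENNReal.ofReal (Real.exp (-x)) *
          (ENNReal.ofReal (erlangDensity n y) * f (Real.exp (-(x + y)))) := fun x => by
      simp only [Fin.prod_univ_succ (n := n + 1), Fin.cons_zero, Fin.cons_succ]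
      rw [ih (f := fun z => f (Real.exp (-x) * z)) (hf.comp (by fun_prop)),
        lintegral_const_mul']
      · simp only [← Real.exp_add, neg_add]
      · exact ENNReal.ofReal_ne_top
    simp only [h1]
    have hm := (continuous_erlangDensity n).measurable
    have h2 := lintegral_lintegral_add (p := fun x s => ENNReal.ofReal (Real.exp (-x)) *
      (ENNReal.ofReal (erlangDensity n (s - x)) * f (Real.exp (-s)))) (by
        unfold Function.uncurry
        fun_prop)
    simp only [add_sub_cancel_left] at h2
    rw [h2]
    refine setLIntegral_congr_fun measurableSet_Ioi fun s hs => ?_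
    have hs' : 0 < s := hs
    simp only [← mul_assoc]
    rw [lintegral_mul_const _ (by fun_prop)]
    congr 1
    have hc := continuous_erlangDensity n
    have h3 := intervalIntegral.integral_comp_sub_left (a := 0) (b := s)
      (fun x => Real.exp (-(s - x)) * erlangDensity n x) s
    simp only [sub_self, sub_zero, sub_sub_cancel] at h3
    rw [← integral_exp_mul_erlangDensity, ← h3,
      ← lintegral_Ioo_ofReal hs'.le (by fun_prop) fun x hx =>
      mul_nonneg (Real.exp_pos _).le (erlangDensity_nonneg n (by linarith [hx.2]))]
    refine lintegral_congr fun x => ?_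
    rw [ENNReal.ofReal_mul (Real.exp_pos _).le]

/-- The law of a product of independent variables which are uniformly distributed in `[0, 1]`. -/
lemma lintegral_cube_prod {ι : Type*} [Fintype ι] {n : ℕ} (hn : Fintype.card ι = n + 1)
    {f : ℝ → ENNReal} (hf : Measurable f) :
    ∫⁻ u in Set.Icc (0 : ι → ℝ) 1, f (∏ i, u i) =
      ∫⁻ x in Set.Ioi (0 : ℝ), ENNReal.ofReal (erlangDensity n x) * f (Real.exp (-x)) := by
  let σ : Fin (n + 1) ≃ ι := (Fintype.equivFinOfCardEq hn).symm
  have he := volume_measurePreserving_piCongrLeft (fun _ : ι => ℝ) σ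
  let e := MeasurableEquiv.piCongrLeft (fun _ : ι => ℝ) σ
  have happ : ∀ v j, e v (σ j) = v j := fun v j =>
    Equiv.piCongrLeft_apply_apply (fun _ : ι => ℝ) σ v j
  have hset : e ⁻¹' Set.Icc 0 1 = Set.Icc 0 1 := by
    ext v
    simp only [Set.mem_preimage, Set.mem_Icc, Pi.le_def,
      ← σ.forall_congr_right (q := fun i => _ ≤ e v i),
      ← σ.forall_congr_right (q := fun i => e v i ≤ _), happ]
    rfl
  rw [← lintegral_cube_fin_prod n hf, ← he.setLIntegral_comp_preimage_emb e.measurableEmbedding]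
  change ∫⁻ a in e ⁻¹' Set.Icc 0 1, f (∏ i, e a i) = _
  rw [hset]
  refine lintegral_congr fun v => ?_
  rw [← σ.prod_comp]
  simp only [happ]

lemma lintegral_cube_prod_prod {ι : Type*} [Fintype ι] (p : ι → Prop) [DecidablePred p] {a b : ℕ}
    (ha : Fintype.card {i // p i} = a + 1) (hb : Fintype.card {i // ¬p i} = b + 1)
    {G : ℝ → ℝ → ENNReal} (hG : Measurable (Function.uncurry G)) :
    ∫⁻ u in Set.Icc (0 : ι → ℝ) 1, G (∏ i : {i // p i}, u i) (∏ i : {i // ¬p i}, u i) =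
      ∫⁻ x in Set.Ioi (0 : ℝ), ∫⁻ y in Set.Ioi (0 : ℝ),
        ENNReal.ofReal (erlangDensity a x) * (ENNReal.ofReal (erlangDensity b y) *
          G (Real.exp (-x)) (Real.exp (-y))) := by
  let e := MeasurableEquiv.piEquivPiSubtypeProd (fun _ : ι => ℝ) p
  have he : MeasurePreserving e := volume_preserving_piEquivPiSubtypeProd (fun _ : ι => ℝ) p
  have hset : e ⁻¹' (Set.Icc 0 1 ×ˢ Set.Icc 0 1) = Set.Icc 0 1 := by
    ext u
    simp only [e, Set.mem_preimage, Set.mem_prod, Set.mem_Icc, Pi.le_def, Subtype.forall,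
      MeasurableEquiv.piEquivPiSubtypeProd, MeasurableEquiv.coe_mk,
      Equiv.piEquivPiSubtypeProd_apply, Pi.zero_apply, Pi.one_apply]
    constructor
    · rintro ⟨⟨h1, h2⟩, h3, h4⟩
      exact ⟨fun i => (em (p i)).elim (h1 i) (h3 i), fun i => (em (p i)).elim (h2 i) (h4 i)⟩
    · rintro ⟨h1, h2⟩
      exact ⟨⟨fun i _ => h1 i, fun i _ => h2 i⟩, fun i _ => h1 i, fun i _ => h2 i⟩
  have h := he.setLIntegral_comp_preimage_emb e.measurableEmbedding
    (fun z => G (∏ i, z.1 i) (∏ i, z.2 i)) (Set.Icc 0 1 ×ˢ Set.Icc 0 1)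
  rw [hset] at h
  have hm : Measurable fun z : ({i // p i} → ℝ) × ({i // ¬p i} → ℝ) =>
      G (∏ i, z.1 i) (∏ i, z.2 i) :=
    hG.comp (f := fun z : ({i // p i} → ℝ) × ({i // ¬p i} → ℝ) => (∏ i, z.1 i, ∏ i, z.2 i))
      (by fun_prop)
  change ∫⁻ u in Set.Icc (0 : ι → ℝ) 1, G (∏ i, (e u).1 i) (∏ i, (e u).2 i) = _
  rw [h, Measure.volume_eq_prod, setLIntegral_prod _ hm.aemeasurable]
  have hm' : Measurable fun x : ℝ => ∫⁻ y in Set.Ioi (0 : ℝ),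
      ENNReal.ofReal (erlangDensity b y) * G x (Real.exp (-y)) := by
    refine Measurable.lintegral_prod_right' (f := fun z : ℝ × ℝ =>
      ENNReal.ofReal (erlangDensity b z.2) * G z.1 (Real.exp (-z.2))) ?_
    have := (continuous_erlangDensity b).measurable
    have := hG.comp (f := fun z : ℝ × ℝ => (z.1, Real.exp (-z.2))) (by fun_prop)
    exact Measurable.mul (by fun_prop) this
  have hGx : ∀ x, Measurable (G x) := fun x => hG.of_uncurry_left
  simp only [fun x => lintegral_cube_prod hb (hGx x)]
  rw [lintegral_cube_prod ha hm']
  refine lintegral_congr fun x => ?_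
  rw [lintegral_const_mul' _ _ ENNReal.ofReal_ne_top]

/-! ### Apéry-like numbers as binomial transforms of moments -/

/-- The function `(X² - Y²)^{2j} / (1 - X²Y²)^{2j+1}`. -/
noncomputable def ratioPow (j : ℕ) (X Y : ℝ) : ℝ :=
  (X ^ 2 - Y ^ 2) ^ (2 * j) / (1 - X ^ 2 * Y ^ 2) ^ (2 * j + 1)

lemma measurable_ratioPow (j : ℕ) : Measurable (Function.uncurry (ratioPow j)) := by
  unfold Function.uncurry ratioPow
  fun_prop

/-- The identity `(1 - X⁴)(1 - Y⁴) = (1 - X²Y²)² - (X² - Y²)²` turns the integrand of `aperyTerm`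
into a binomial sum. At the zeros of the denominator both sides are the junk value `0`. -/
lemma apery_integrand_eq_sum (n : ℕ) (X Y : ℝ) :
    (1 - X ^ 4) ^ n * (1 - Y ^ 4) ^ n / (1 - X ^ 2 * Y ^ 2) ^ (2 * n + 1) =
      ∑ j ∈ Finset.range (n + 1), (-1) ^ j * n.choose j * ratioPow j X Y := by
  by_cases hD : 1 - X ^ 2 * Y ^ 2 = 0
  · simp [ratioPow, hD]
  rw [← mul_pow, show (1 - X ^ 4) * (1 - Y ^ 4) =
    -(X ^ 2 - Y ^ 2) ^ 2 + (1 - X ^ 2 * Y ^ 2) ^ 2 by ring, add_pow, Finset.sum_div]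
  refine Finset.sum_congr rfl fun j hj => ?_
  obtain ⟨i, rfl⟩ := Nat.exists_eq_add_of_le (Nat.lt_succ_iff.1 (Finset.mem_range.1 hj))
  rw [ratioPow, Nat.add_sub_cancel_left, neg_pow]
  generalize 1 - X ^ 2 * Y ^ 2 = D at hD
  generalize X ^ 2 - Y ^ 2 = E
  field_simp
  ring

lemma ratioPow_nonneg (j : ℕ) {X Y : ℝ} (hX : X ∈ Set.Icc (0 : ℝ) 1) (hY : Y ∈ Set.Icc (0 : ℝ) 1) :
    0 ≤ ratioPow j X Y := by
  have h : X ^ 2 * Y ^ 2 ≤ 1 :=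
    mul_le_one₀ (pow_le_one₀ hX.1 hX.2) (by positivity) (pow_le_one₀ hY.1 hY.2)
  refine div_nonneg ?_ (pow_nonneg (by linarith) _)
  rw [pow_mul]
  positivity

/-- In logarithmic coordinates `X = e^{-x}`, `Y = e^{-(s-x)}` the kernel is a ratio of powers of
hyperbolic sines. -/
lemma exp_mul_ratioPow_exp (j : ℕ) {x s : ℝ} (hs : 0 < s) :
    Real.exp (-s) * ratioPow j (Real.exp (-x)) (Real.exp (-(s - x))) =
      Real.sinh (s - 2 * x) ^ (2 * j) / (2 * Real.sinh s ^ (2 * j + 1)) := by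
  have h1 : Real.exp (-x) ^ 2 - Real.exp (-(s - x)) ^ 2 =
      Real.exp (-s) * 2 * Real.sinh (s - 2 * x) := by
    rw [Real.sinh_eq, ← Real.exp_nat_mul, ← Real.exp_nat_mul,
      show ((2 : ℕ) : ℝ) * -x = -s + (s - 2 * x) by push_cast; ring,
      show ((2 : ℕ) : ℝ) * -(s - x) = -s + -(s - 2 * x) by push_cast; ring, Real.exp_add,
      Real.exp_add]
    ring
  have h2 : 1 - Real.exp (-x) ^ 2 * Real.exp (-(s - x)) ^ 2 =
      Real.exp (-s) * 2 * Real.sinh s := by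
    rw [← mul_pow, ← Real.exp_add, show -x + -(s - x) = -s by ring, Real.sinh_eq]
    have : Real.exp (-s) * Real.exp s = 1 := by rw [← Real.exp_add]; simp
    linear_combination -this
  have hsinh := (Real.sinh_pos_iff.2 hs).ne'
  have he := (Real.exp_pos (-s)).ne'
  rw [ratioPow, h1, h2]
  field_simp
  ring

lemma integral_sinh_sub_two_mul (j : ℕ) (s : ℝ) :
    ∫ x in (0 : ℝ)..s, Real.sinh (s - 2 * x) ^ (2 * j) = sinhPowInt j s := by
  have hi : ∀ a b, IntervalIntegrable (fun b => Real.sinh b ^ (2 * j)) volume a b := fun a b =>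
    Continuous.intervalIntegrable (by fun_prop) _ _
  have h1 := intervalIntegral.integral_comp_sub_mul (a := 0) (b := s)
    (fun b => Real.sinh b ^ (2 * j)) two_ne_zero s
  have h2 : ∫ b in (-s)..0, Real.sinh b ^ (2 * j) = sinhPowInt j s := by
    have h := intervalIntegral.integral_comp_neg (a := 0) (b := s)
      (fun b => Real.sinh b ^ (2 * j))
    simp only [Real.sinh_neg, (even_two_mul j).neg_pow, neg_zero] at h
    exact h.symm
  rw [h1, show s - 2 * s = -s by ring, mul_zero, sub_zero,
    ← intervalIntegral.integral_add_adjacent_intervals (hi _ 0) (hi _ _), h2, sinhPowInt]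
  simp only [smul_eq_mul]
  ring

/-- Summation over all positions of the cut makes the weight a function of `x + y` alone. -/
lemma sum_erlangDensity_mul (m : ℕ) (x y : ℝ) :
    ∑ a ∈ Finset.range (m + 1), erlangDensity a x * erlangDensity (m - a) y =
      (x + y) ^ m / m.factorial * Real.exp (-(x + y)) := by
  rw [add_pow, Finset.sum_div, Finset.sum_mul]
  refine Finset.sum_congr rfl fun a ha => ?_
  have h := Nat.choose_mul_factorial_mul_factorial (Nat.lt_succ_iff.1 (Finset.mem_range.1 ha))
  have h' : (m.choose a : ℝ) * a.factorial * (m - a).factorial = m.factorial := by exact_mod_cast h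
  have := a.factorial_ne_zero
  have := (m - a).factorial_ne_zero
  have := m.factorial_ne_zero
  rw [erlangDensity, erlangDensity, neg_add, Real.exp_add]
  field_simp
  linear_combination -x ^ a * y ^ (m - a) * h'

/-- The integral over the cube of `ratioPow j`, at the products of the first `r` and of the
remaining variables. -/
noncomputable def cubeIntegral (k r j : ℕ) : ENNReal :=
  ∫⁻ u in Set.Icc (0 : Fin k → ℝ) 1, ENNReal.ofReal
    (ratioPow j (∏ i ∈ Finset.univ.filter (fun i : Fin k => (i : ℕ) < r), u i)
      (∏ i ∈ Finset.univ.filter (fun i : Fin k => r ≤ (i : ℕ)), u i))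

lemma cubeIntegral_eq {m a : ℕ} (ha : a ≤ m) (j : ℕ) :
    cubeIntegral (m + 2) (a + 1) j =
      ∫⁻ x in Set.Ioi (0 : ℝ), ∫⁻ y in Set.Ioi (0 : ℝ),
        ENNReal.ofReal (erlangDensity a x * erlangDensity (m - a) y *
          ratioPow j (Real.exp (-x)) (Real.exp (-y))) := by
  let p : Fin (m + 2) → Prop := fun i => (i : ℕ) < a + 1
  have hp : Fintype.card {i // p i} = a + 1 := by
    rw [Fintype.card_subtype]
    simp only [p, Fin.card_filter_val_lt]
    omega
  have hq : Fintype.card {i // ¬p i} = (m - a) + 1 := by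
    rw [Fintype.card_subtype_compl, hp, Fintype.card_fin]
    omega
  have h := lintegral_cube_prod_prod p hp hq
    (G := fun X Y => ENNReal.ofReal (ratioPow j X Y)) (measurable_ratioPow j).ennreal_ofReal
  have e : cubeIntegral (m + 2) (a + 1) j = ∫⁻ u in Set.Icc (0 : Fin (m + 2) → ℝ) 1, ENNReal.ofReal
      (ratioPow j (∏ i : {i // p i}, u i) (∏ i : {i // ¬p i}, u i)) := by
    refine lintegral_congr fun u => ?_
    rw [Finset.prod_subtype _ (p := p) (by simp [p]), Finset.prod_subtype _ (p := fun i => ¬p i)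
      (by simp [p])]
  rw [e, h]
  refine setLIntegral_congr_fun measurableSet_Ioi fun x hx => ?_
  refine setLIntegral_congr_fun measurableSet_Ioi fun y hy => ?_
  have hx' : 0 < x := hx
  have hy' : 0 < y := hy
  have h1 := erlangDensity_nonneg a hx'.le
  have h2 := erlangDensity_nonneg (m - a) hy'.le
  rw [ENNReal.ofReal_mul (by positivity), ENNReal.ofReal_mul h1, mul_assoc]

lemma sum_cubeIntegral (m j : ℕ) :
    ∑ r ∈ Finset.Ico 1 (m + 2), cubeIntegral (m + 2) r j =
      ENNReal.ofReal (sinhMoment m j / (2 * m.factorial)) := by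
  have hmeas : ∀ a, Measurable fun z : ℝ × ℝ => ENNReal.ofReal (erlangDensity a z.1 *
      erlangDensity (m - a) z.2 * ratioPow j (Real.exp (-z.1)) (Real.exp (-z.2))) := fun a => by
    have h1 := (continuous_erlangDensity a).measurable
    have h2 := (continuous_erlangDensity (m - a)).measurable
    have h3 := (measurable_ratioPow j).comp
      (f := fun z : ℝ × ℝ => (Real.exp (-z.1), Real.exp (-z.2))) (by fun_prop)
    exact (Measurable.mul (by fun_prop) h3).ennreal_ofReal
  rw [Finset.sum_Ico_eq_sum_range, show m + 2 - 1 = m + 1 from rfl]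
  have h1 : ∑ a ∈ Finset.range (m + 1), cubeIntegral (m + 2) (1 + a) j =
      ∫⁻ x in Set.Ioi (0 : ℝ), ∫⁻ y in Set.Ioi (0 : ℝ), ENNReal.ofReal
        ((x + y) ^ m / m.factorial * (Real.exp (-(x + y)) *
          ratioPow j (Real.exp (-x)) (Real.exp (-((x + y) - x))))) := by
    rw [Finset.sum_congr rfl fun a ha => by
      rw [add_comm 1 a, cubeIntegral_eq (Nat.lt_succ_iff.1 (Finset.mem_range.1 ha))],
      ← lintegral_finsetSum _ fun a _ => (hmeas a).lintegral_prod_right']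
    refine setLIntegral_congr_fun measurableSet_Ioi fun x hx => ?_
    have hx' : 0 < x := hx
    simp only
    have hmx : ∀ a, Measurable fun y : ℝ => ENNReal.ofReal (erlangDensity a x *
        erlangDensity (m - a) y * ratioPow j (Real.exp (-x)) (Real.exp (-y))) := fun a =>
      (hmeas a).comp measurable_prodMk_left
    rw [← lintegral_finsetSum _ fun a _ => hmx a]
    refine setLIntegral_congr_fun measurableSet_Ioi fun y hy => ?_
    have hy' : 0 < y := hy
    have hK : 0 ≤ ratioPow j (Real.exp (-x)) (Real.exp (-y)) :=
      ratioPow_nonneg j ⟨(Real.exp_pos _).le, Real.exp_le_one_iff.2 (by linarith)⟩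
        ⟨(Real.exp_pos _).le, Real.exp_le_one_iff.2 (by linarith)⟩
    rw [← ENNReal.ofReal_sum_of_nonneg fun a _ => mul_nonneg (mul_nonneg
      (erlangDensity_nonneg a hx'.le) (erlangDensity_nonneg (m - a) hy'.le)) hK,
      ← Finset.sum_mul, sum_erlangDensity_mul, add_sub_cancel_left, mul_assoc]
  have h2 := lintegral_lintegral_add (p := fun x s => ENNReal.ofReal
        (s ^ m / m.factorial * (Real.exp (-s) *
          ratioPow j (Real.exp (-x)) (Real.exp (-(s - x)))))) (by
    have h3 := (measurable_ratioPow j).comp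
      (f := fun z : ℝ × ℝ => (Real.exp (-z.1), Real.exp (-(z.2 - z.1)))) (by fun_prop)
    exact (Measurable.mul (by fun_prop) (Measurable.mul (by fun_prop) h3)).ennreal_ofReal)
  rw [h1, h2, sinhMoment, ← integral_div, ofReal_integral_eq_lintegral_ofReal]
  · refine setLIntegral_congr_fun measurableSet_Ioi fun s hs => ?_
    have hs' : 0 < s := hs
    have hsinh := Real.sinh_pos_iff.2 hs'
    simp only [exp_mul_ratioPow_exp j hs']
    rw [lintegral_Ioo_ofReal hs'.le (by fun_prop) fun x _ => by
      have : 0 ≤ Real.sinh (s - 2 * x) ^ (2 * j) := by rw [pow_mul]; positivity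
      positivity]
    rw [intervalIntegral.integral_const_mul, intervalIntegral.integral_div,
      integral_sinh_sub_two_mul, sinhRatio]
    congr 1
    field_simp
  · exact (integrableOn_pow_mul_sinhRatio m j).div_const _
  · refine ae_restrict_of_forall_mem measurableSet_Ioi fun s hs => ?_
    have hs' : 0 < s := hs
    have := sinhRatio_nonneg j hs'.le
    simp only [Pi.zero_apply]
    positivity

lemma prod_mem_Icc {ι : Type*} (s : Finset ι) {u : ι → ℝ} (hu : u ∈ Set.Icc (0 : ι → ℝ) 1) :
    ∏ i ∈ s, u i ∈ Set.Icc (0 : ℝ) 1 :=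
  ⟨Finset.prod_nonneg fun i _ => hu.1 i,
    Finset.prod_le_one (fun i _ => hu.1 i) fun i _ => hu.2 i⟩

lemma aperyTerm_eq {k r : ℕ} (hfin : ∀ j, cubeIntegral k r j ≠ ⊤) (n : ℕ) :
    aperyTerm k r n = 2 ^ k * ∑ j ∈ Finset.range (n + 1),
      (-1) ^ j * n.choose j * (cubeIntegral k r j).toReal := by
  let X : (Fin k → ℝ) → ℝ := fun u => ∏ i ∈ Finset.univ.filter (fun i : Fin k => (i : ℕ) < r), u i
  let Y : (Fin k → ℝ) → ℝ := fun u => ∏ i ∈ Finset.univ.filter (fun i : Fin k => r ≤ (i : ℕ)), u i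
  have hXY : ∀ u : Fin k → ℝ, ∏ i, u i ^ 2 = X u ^ 2 * Y u ^ 2 := fun u => by
    simp only [X, Y, Finset.prod_pow]
    rw [← mul_pow]
    congr 1
    rw [← Finset.prod_filter_mul_prod_filter_not Finset.univ (fun i : Fin k => (i : ℕ) < r)]
    simp only [not_lt]
  have hm : ∀ j, Measurable fun u => ratioPow j (X u) (Y u) := fun j =>
    (measurable_ratioPow j).comp (f := fun u => (X u, Y u)) (by fun_prop)
  have h0 : ∀ j, 0 ≤ᵐ[volume.restrict (Set.Icc (0 : Fin k → ℝ) 1)]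
      fun u => ratioPow j (X u) (Y u) := fun j =>
    ae_restrict_of_forall_mem measurableSet_Icc fun u hu =>
      ratioPow_nonneg j (prod_mem_Icc _ hu) (prod_mem_Icc _ hu)
  have hint : ∀ j, IntegrableOn (fun u => ratioPow j (X u) (Y u)) (Set.Icc (0 : Fin k → ℝ) 1) :=
    fun j => ⟨(hm j).aestronglyMeasurable, by
      rw [hasFiniteIntegral_iff_ofReal (h0 j)]
      exact (hfin j).lt_top⟩
  have hval : ∀ j, ∫ u in Set.Icc (0 : Fin k → ℝ) 1, ratioPow j (X u) (Y u) =
      (cubeIntegral k r j).toReal := fun j =>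
    integral_eq_lintegral_of_nonneg_ae (h0 j) (hm j).aestronglyMeasurable
  rw [aperyTerm]
  congr 1
  simp only [Finset.prod_pow _ 4, hXY]
  change ∫ u in Set.Icc (0 : Fin k → ℝ) 1, (1 - X u ^ 4) ^ n * (1 - Y u ^ 4) ^ n /
    (1 - X u ^ 2 * Y u ^ 2) ^ (2 * n + 1) = _
  simp only [apery_integrand_eq_sum]
  rw [integral_finsetSum _ fun j _ => (hint j).const_mul _]
  simp only [integral_const_mul, hval]

/-- The Apéry-like numbers `J_{m+2}(n)` are binomial transforms of multiples of the moments of the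
functions `ψ_j = sinhRatio j`. -/
lemma apery_eq (m n : ℕ) :
    apery (m + 2) n = ∑ j ∈ Finset.range (n + 1),
      (-1) ^ j * n.choose j * (2 ^ (m + 1) / m.factorial * sinhMoment m j) := by
  have hfin : ∀ r ∈ Finset.Ico 1 (m + 2), ∀ j, cubeIntegral (m + 2) r j ≠ ⊤ := fun r hr j => by
    have h : ∑ r ∈ Finset.Ico 1 (m + 2), cubeIntegral (m + 2) r j ≠ ⊤ := by
      rw [sum_cubeIntegral]
      exact ENNReal.ofReal_ne_top
    exact (ENNReal.sum_ne_top.1 h) r hr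
  rw [apery, Finset.sum_congr rfl fun r hr => aperyTerm_eq (hfin r hr) n, ← Finset.mul_sum,
    Finset.sum_comm, Finset.mul_sum]
  refine Finset.sum_congr rfl fun j _ => ?_
  rw [← Finset.mul_sum, ← ENNReal.toReal_sum fun r hr => hfin r hr j, sum_cubeIntegral,
    ENNReal.toReal_ofReal (div_nonneg (sinhMoment_nonneg m j) (by positivity))]
  have := m.factorial_ne_zero
  field_simp
  ring

/-! ### Generating functions of binomial transforms -/

lemma hasSum_choose_mul_pow {t : ℂ} (ht : ‖t‖ < 1) (j : ℕ) :
    HasSum (fun n : ℕ => (n.choose j : ℂ) * t ^ n) (t ^ j / (1 - t) ^ (j + 1)) := by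
  have h := (hasSum_choose_mul_geometric_of_norm_lt_one j ht).mul_left (t ^ j)
  rw [← (add_left_injective j).hasSum_iff]
  · convert! h using 1
    · ext n
      simp only [Function.comp_apply, pow_add]
      ring
    · ring
  · intro n hn
    have : n < j := by
      by_contra! hjn
      exact hn ⟨n - j, Nat.sub_add_cancel hjn⟩
    simp [Nat.choose_eq_zero_of_lt this]

/-- Euler's transformation of a power series with bounded coefficients. -/
lemma hasSum_binomialTransform {A : ℕ → ℂ} {C : ℝ} (hA : ∀ j, ‖A j‖ ≤ C) {t : ℂ}
    (ht : ‖t‖ < 1 / 2) :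
    HasSum (fun n : ℕ => (∑ j ∈ Finset.range (n + 1), (-1) ^ j * (n.choose j : ℂ) * A j) * t ^ n)
      ((1 - t)⁻¹ * ∑' j, A j * (t / (t - 1)) ^ j) := by
  have hC : 0 ≤ C := (norm_nonneg _).trans (hA 0)
  have hfin : ∀ n, ∀ j ∉ Finset.range (n + 1), (n.choose j : ℝ) = 0 := fun n j hj => by
    rw [Finset.mem_range, not_lt] at hj
    exact_mod_cast Nat.choose_eq_zero_of_lt hj
  let f : ℕ × ℕ → ℂ := fun p => (-1) ^ p.2 * (p.1.choose p.2 : ℂ) * A p.2 * t ^ p.1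
  have hbound : ∀ p, ‖f p‖ ≤ C * ((p.1.choose p.2 : ℝ) * ‖t‖ ^ p.1) := fun p => by
    simp only [f, norm_mul, norm_pow, norm_neg, norm_one, one_pow, one_mul, Complex.norm_natCast]
    calc _ ≤ (p.1.choose p.2 : ℝ) * C * ‖t‖ ^ p.1 := by gcongr; exact hA _
      _ = _ := by ring
  have hrow : ∀ n, HasSum (fun j => (n.choose j : ℝ) * ‖t‖ ^ n) ((2 * ‖t‖) ^ n) := fun n => by
    have h := hasSum_sum_of_ne_finset_zero (L := SummationFilter.unconditional ℕ)
      (f := fun j => (n.choose j : ℝ) * ‖t‖ ^ n)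
      (s := Finset.range (n + 1)) fun j hj => by simp only [hfin n j hj, zero_mul]
    convert! h using 1
    rw [← Finset.sum_mul, ← Nat.cast_sum, Nat.sum_range_choose, mul_pow]
    push_cast
    rfl
  have hsum : Summable f := by
    refine Summable.of_norm_bounded (Summable.mul_left C ?_) hbound
    refine (summable_prod_of_nonneg fun p => by positivity).2
      ⟨fun n => (hrow n).summable, ?_⟩
    simp only [fun n => (hrow n).tsum_eq]
    exact summable_geometric_of_lt_one (by positivity) (by linarith)
  have ht1 : ‖t‖ < 1 := by linarith
  have h1t : 1 - t ≠ 0 := fun h => by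
    rw [← sub_eq_zero.1 h, norm_one] at ht1
    exact lt_irrefl _ ht1
  have hcol : ∀ j, HasSum (fun n => f (n, j)) ((1 - t)⁻¹ * (A j * (t / (t - 1)) ^ j)) := fun j => by
    convert! (hasSum_choose_mul_pow ht1 j).mul_left ((-1) ^ j * A j) using 1
    · ext n
      simp only [f]
      ring
    · rw [show t / (t - 1) = -1 * (t / (1 - t)) by rw [← neg_sub 1 t, div_neg]; ring, mul_pow,
        div_pow]
      field_simp
      ring
  have hrows : ∀ n, HasSum (fun j => f (n, j))
      ((∑ j ∈ Finset.range (n + 1), (-1) ^ j * (n.choose j : ℂ) * A j) * t ^ n) := fun n => by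
    rw [Finset.sum_mul]
    refine hasSum_sum_of_ne_finset_zero fun j hj => ?_
    have : (n.choose j : ℂ) = 0 := by exact_mod_cast hfin n j hj
    simp [f, this]
  have htotal : ∑' p, f p = (1 - t)⁻¹ * ∑' j, A j * (t / (t - 1)) ^ j := by
    rw [← tsum_mul_left, ← (Equiv.prodComm ℕ ℕ).tsum_eq]
    exact (((Equiv.prodComm ℕ ℕ).summable_iff.2 hsum).hasSum.prod_fiberwise hcol).tsum_eq.symm
  rw [← htotal]
  exact hsum.hasSum.prod_fiberwise hrows

/-- The sequence whose binomial transform consists of the Apéry-like numbers `J_{m+2}(n)`. -/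
noncomputable def aperyMoment (m j : ℕ) : ℝ := 2 ^ (m + 1) / m.factorial * sinhMoment m j

lemma apery_eq_sum_aperyMoment (m n : ℕ) :
    apery (m + 2) n = ∑ j ∈ Finset.range (n + 1), (-1) ^ j * n.choose j * aperyMoment m j :=
  apery_eq m n

lemma exists_norm_aperyMoment_le (m : ℕ) : ∃ C, ∀ j, ‖(aperyMoment m j : ℂ)‖ ≤ C := by
  refine ⟨2 ^ (m + 1) / m.factorial *
    ∫ L in Set.Ioi (0 : ℝ), L ^ m * (2 * Real.exp (-(1 / 2) * L)), fun j => ?_⟩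
  have h0 := sinhMoment_nonneg m j
  have hle : sinhMoment m j ≤ ∫ L in Set.Ioi (0 : ℝ), L ^ m * (2 * Real.exp (-(1 / 2) * L)) := by
    refine MeasureTheory.setIntegral_mono_on (integrableOn_pow_mul_sinhRatio m j)
      (integrableOn_pow_mul_exp m) measurableSet_Ioi fun L hL => ?_
    have hL' : 0 < L := hL
    have := sinhRatio_le j hL'
    gcongr
  rw [Complex.norm_real, aperyMoment, Real.norm_of_nonneg (by positivity)]
  gcongr

lemma aperyMoment_zero_succ (j : ℕ) :
    4 * ((j : ℂ) + 1) ^ 2 * aperyMoment 0 (j + 1) = (2 * j + 1) ^ 2 * aperyMoment 0 j := by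
  have h : 4 * ((j : ℝ) + 1) ^ 2 * aperyMoment 0 (j + 1) = (2 * j + 1) ^ 2 * aperyMoment 0 j := by
    simp only [aperyMoment]
    linear_combination (2 ^ (0 + 1) / (Nat.factorial 0 : ℝ)) * sinhMoment_zero_succ j
  exact_mod_cast h

lemma aperyMoment_two_succ (j : ℕ) :
    4 * ((j : ℂ) + 1) ^ 2 * aperyMoment 2 (j + 1) =
      (2 * j + 1) ^ 2 * aperyMoment 2 j - 4 * aperyMoment 0 j := by
  have h : 4 * ((j : ℝ) + 1) ^ 2 * aperyMoment 2 (j + 1) =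
      (2 * j + 1) ^ 2 * aperyMoment 2 j - 4 * aperyMoment 0 j := by
    simp only [aperyMoment, Nat.factorial]
    push_cast
    linear_combination 4 * sinhMoment_two_succ j
  exact_mod_cast h

lemma aperyMoment_two_zero : (aperyMoment 2 0 : ℂ) = Real.pi ^ 2 * aperyMoment 0 0 := by
  have h : aperyMoment 2 0 = Real.pi ^ 2 * aperyMoment 0 0 := by
    simp only [aperyMoment, Nat.factorial]
    push_cast
    linear_combination 4 * sinhMoment_two_zero
  exact_mod_cast h

lemma apery_two_zero : apery 2 0 = aperyMoment 0 0 := by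
  simp [apery_eq_sum_aperyMoment 0 0]

/-! ### The modular function and the kernel -/

lemma modT_eq {τ : ℂ} (hτ : 0 < τ.im) :
    modT τ = nomeLambda (qParam 2 τ) / (nomeLambda (qParam 2 τ) - 1) := by
  have hx := norm_qParam_two_lt_one hτ
  have ha := squareSum_ne_zero hx
  have hd := squareSum_ne_zero (x := -qParam 2 τ) (by simpa using hx)
  rw [← neg_sub, one_sub_nomeLambda hx, modT, θ₂_pow_four_eq, θ₄_eq, nomeLambda]
  field_simp

lemma nomeLambda_ne_one {x : ℂ} (hx : ‖x‖ < 1) : 1 - nomeLambda x ≠ 0 := by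
  rw [one_sub_nomeLambda hx]
  exact div_ne_zero (pow_ne_zero 4 (squareSum_ne_zero (by simpa using hx)))
    (pow_ne_zero 4 (squareSum_ne_zero hx))

/-- `q dt/dq = t θ₃⁴/2`. -/
lemma qDeriv_modT {τ : ℂ} (hτ : 0 < τ.im) :
    qDeriv modT τ = modT τ * (squareSum (qParam 2 τ) ^ 4 / 2) := by
  have hx := norm_qParam_two_lt_one hτ
  have hd : ∀ x : ℂ, ‖x‖ < 1 → HasDerivAt (fun x => nomeLambda x / (nomeLambda x - 1))
      (-deriv nomeLambda x / (1 - nomeLambda x) ^ 2) x := fun x hx => by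
    have h1 := (differentiableAt_nomeLambda hx).hasDerivAt
    have h0 : nomeLambda x - 1 ≠ 0 := by
      rw [← neg_sub]; exact neg_ne_zero.2 (nomeLambda_ne_one hx)
    refine (h1.fun_div (h1.sub_const 1) h0).congr_deriv ?_
    rw [show (1 - nomeLambda x) ^ 2 = (nomeLambda x - 1) ^ 2 by ring]
    ring
  have h := (hasDerivAt_comp_qParam two_pos (fun x hx => (hd x hx).differentiableAt)
    hτ).congr_of_eventuallyEq (f₁ := modT) (by
      filter_upwards [eventually_im_pos hτ] with z hz using modT_eq hz)
  have hpi : (Real.pi : ℂ) ≠ 0 := by exact_mod_cast Real.pi_ne_zero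
  have h1 := nomeLambda_ne_one hx
  have ha := squareSum_ne_zero hx
  have hm := mul_deriv_nomeLambda hx
  have ho := one_sub_nomeLambda hx
  have hs : squareSum (-qParam 2 τ) ^ 4 = (1 - nomeLambda (qParam 2 τ)) *
      squareSum (qParam 2 τ) ^ 4 := by
    rw [ho]
    field_simp
  rw [qDeriv, h.deriv, (hd _ hx).deriv, modT_eq hτ, mul_div_assoc', mul_neg, hm, hs,
    ← neg_sub 1 (nomeLambda (qParam 2 τ))]
  push_cast
  field_simp

lemma kernel_eq {τ : ℂ} (hτ : 0 < τ.im) : kernel τ = -1 / 4 * thetaForm τ := by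
  have hx := norm_qParam_two_lt_one hτ
  have ha := squareSum_ne_zero hx
  have hb := pronicSum_ne_zero hx
  have hd := squareSum_ne_zero (x := -qParam 2 τ) (by simpa using hx)
  have hq : qParam 2 τ ≠ 0 := Function.Periodic.qParam_ne_zero τ
  have ht : modT τ ≠ 0 := by
    rw [modT, θ₂_pow_four_eq, θ₄_eq]
    exact neg_ne_zero.2 (div_ne_zero (mul_ne_zero hq (pow_ne_zero 4 hb)) (pow_ne_zero 4 hd))
  have h1 : 1 - modT τ = squareSum (qParam 2 τ) ^ 4 / squareSum (-qParam 2 τ) ^ 4 := by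
    rw [modT, θ₂_pow_four_eq, θ₄_eq]
    field_simp
    linear_combination -squareSum_pow_four hx
  rw [kernel, qDeriv_modT hτ, mul_div_cancel_left₀ _ ht, h1, modT, θ₂_pow_four_eq, θ₄_eq,
    thetaForm_eq hτ]
  field_simp
  norm_num

/-! ### Analytic continuation to the upper half plane -/

lemma eq_of_eventuallyEq_atImInfty {f g : ℍ → ℂ} (hf : MDiff f) (hg : MDiff g)
    (h : f =ᶠ[UpperHalfPlane.atImInfty] g) : f = g := by
  rw [UpperHalfPlane.mdifferentiable_iff] at hf hg
  have hopen : IsOpen {z : ℂ | 0 < z.im} := isOpen_lt continuous_const Complex.continuous_im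
  obtain ⟨A, hA⟩ := (UpperHalfPlane.atImInfty_mem _).1 h
  have hpos : (0 : ℝ) < |A| + 1 := by positivity
  have key := (hf.analyticOnNhd hopen).eqOn_of_preconnected_of_eventuallyEq
    (hg.analyticOnNhd hopen) (convex_halfSpace_im_gt 0).isPreconnected
    (z₀ := ((|A| + 1 : ℝ) : ℂ) * Complex.I) (by simpa using hpos) (by
      have hnhd : {z : ℂ | |A| < z.im} ∈ 𝓝 (((|A| + 1 : ℝ) : ℂ) * Complex.I) :=
        (isOpen_lt continuous_const Complex.continuous_im).mem_nhds (by simp)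
      filter_upwards [hnhd] with z hz
      have hz' : |A| < z.im := hz
      have hz0 : 0 < z.im := (abs_nonneg A).trans_lt hz'
      simp only [Function.comp_apply, UpperHalfPlane.ofComplex_apply_of_im_pos hz0]
      exact hA ⟨z, hz0⟩ ((le_abs_self A).trans hz'.le))
  ext τ
  have := key τ.im_pos
  simpa using this

lemma IsGenFun.iff_eq {k : ℕ} {w₀ : ℍ → ℂ} (h₀ : IsGenFun k w₀) (w : ℍ → ℂ) :
    IsGenFun k w ↔ w = w₀ := by
  refine ⟨fun h => eq_of_eventuallyEq_atImInfty h.holo h₀.holo ?_, fun h => h ▸ h₀⟩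
  filter_upwards [h.series, h₀.series] with τ h1 h2 using h1.2.unique h2.2

/-- If `∑ A_j λ^j` equals `f(x)` for small `x`, where `A_j = aperyMoment m j` and `λ = λ(x)`, then
the generating function of the numbers `J_{m+2}(n)` at `t = λ/(λ-1)` is `(1 - λ) f(x)`. -/
lemma isGenFun_of_eventually {m : ℕ} {w : ℍ → ℂ} (hw : MDiff w) {f : ℂ → ℂ}
    (hf : ∀ᶠ x in 𝓝 (0 : ℂ), ∑' j, (aperyMoment m j : ℂ) * nomeLambda x ^ j = f x)
    (hwf : ∀ τ : ℍ, w τ = (1 - nomeLambda (qParam 2 τ)) * f (qParam 2 τ)) :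
    IsGenFun (m + 2) w := by
  refine ⟨hw, ?_⟩
  obtain ⟨C, hC⟩ := exists_norm_aperyMoment_le m
  have hlim := tendsto_qParam_atImInfty (h := 2) two_pos
  have h0 : ‖(0 : ℂ)‖ < 1 := by simp
  have hcont : Tendsto (fun x => nomeLambda x / (nomeLambda x - 1)) (𝓝 0) (𝓝 0) := by
    have hc := (differentiableAt_nomeLambda h0).continuousAt
    have h : ContinuousAt (fun x => nomeLambda x / (nomeLambda x - 1)) 0 :=
      hc.div (hc.sub continuousAt_const) (by simp [nomeLambda_zero])
    simpa [nomeLambda_zero] using h.tendsto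
  have hsmall : ∀ᶠ x in 𝓝 (0 : ℂ), ‖nomeLambda x / (nomeLambda x - 1)‖ < 1 / 2 := by
    have := hcont.norm
    rw [norm_zero] at this
    exact this.eventually_lt_const (by norm_num)
  filter_upwards [hlim.eventually hf, hlim.eventually hsmall] with τ hτ ht
  rw [← modT_eq τ.im_pos] at ht
  refine ⟨ht.trans (by norm_num), ?_⟩
  have h := hasSum_binomialTransform hC ht
  have h1 := nomeLambda_ne_one (norm_qParam_two_lt_one τ.im_pos)
  have h2 : nomeLambda (qParam 2 τ) - 1 ≠ 0 := by rw [← neg_sub]; exact neg_ne_zero.2 h1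
  have e1 : (1 - modT τ)⁻¹ = 1 - nomeLambda (qParam 2 τ) := by
    rw [modT_eq τ.im_pos, one_sub_div h2, sub_sub_cancel_left, inv_div, div_neg, div_one, neg_sub]
  have e2 : modT τ / (modT τ - 1) = nomeLambda (qParam 2 τ) := by
    rw [modT_eq τ.im_pos, div_sub_one h2, sub_sub_cancel, div_div_div_cancel_right₀ h2, div_one]
  rw [e1, e2, hτ, ← hwf] at h
  convert! h using 3 with n
  rw [apery_eq_sum_aperyMoment]
  push_cast
  rfl

/-- A twofold primitive `W` of `θ₂⁴θ₄⁴` with respect to the logarithm of the nome, in terms of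
which the two hypergeometric-type series are evaluated. -/
lemma exists_primitive_primitive_thetaForm : ∃ W : ℂ → ℂ,
    (∀ τ : ℂ, 0 < τ.im → qInt (qInt thetaForm) τ = 4 * W (qParam 2 τ)) ∧
    ∀ᶠ x in 𝓝 (0 : ℂ),
      ∑' j, (aperyMoment 0 j : ℂ) * nomeLambda x ^ j = squareSum x ^ 2 * apery 2 0 ∧
      ∑' j, (aperyMoment 2 j : ℂ) * nomeLambda x ^ j =
        squareSum x ^ 2 * (Real.pi ^ 2 * apery 2 0 - apery 2 0 * W x) := by
  let φ : ℂ → ℂ := fun x => x * pronicSum x ^ 4 * squareSum (-x) ^ 4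
  have hφ : ∀ x : ℂ, ‖x‖ < 1 → DifferentiableAt ℂ φ x := fun x hx =>
    (differentiableAt_id.mul ((differentiableAt_pronicSum hx).pow 4)).mul
      ((differentiableAt_squareSum_neg hx).pow 4)
  obtain ⟨V, hV0, hV, hVφ⟩ := exists_primitive hφ (by simp [φ])
  obtain ⟨W, hW0, hW, hWV⟩ := exists_primitive hV hV0
  have h1 : ∀ τ : ℂ, 0 < τ.im → qInt thetaForm τ = 2 * V (qParam 2 τ) := fun τ hτ => by
    rw [qInt_congr (fun τ hτ => thetaForm_eq hτ) hτ]
    refine qInt_comp_qParam (φ := φ) (Φ := fun x => 2 * V x) two_pos hφ (by simp [φ])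
      (fun x hx => (hV x hx).const_mul 2) (by simp [hV0]) (fun x hx => ?_) hτ
    rw [deriv_const_mul _ (hV x hx), ← hVφ x hx]
    push_cast
    ring
  have h2 : ∀ τ : ℂ, 0 < τ.im → qInt (qInt thetaForm) τ = 4 * W (qParam 2 τ) := fun τ hτ => by
    rw [qInt_congr h1 hτ]
    refine qInt_comp_qParam (φ := fun x => 2 * V x) (Φ := fun x => 4 * W x) two_pos
      (fun x hx => (hV x hx).const_mul 2) (by simp [hV0])
      (fun x hx => (hW x hx).const_mul 4) (by simp [hW0]) (fun x hx => ?_) hτ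
    rw [deriv_const_mul _ (hW x hx), ← hWV x hx]
    push_cast
    ring
  obtain ⟨C₀, hC₀⟩ := exists_norm_aperyMoment_le 0
  obtain ⟨C₂, hC₂⟩ := exists_norm_aperyMoment_le 2
  refine ⟨W, h2, ?_⟩
  have h := hypergeometric_pair (fun j => (hC₀ j).trans (le_max_left C₀ C₂))
    (fun j => (hC₂ j).trans (le_max_right C₀ C₂)) aperyMoment_zero_succ aperyMoment_two_succ
    hW hV hWV hVφ hW0
  rwa [aperyMoment_two_zero, ← apery_two_zero] at h

end NcHO

/-! ### The generating functions of `J₂` and `J₄` -/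

theorem theorem5p1 :
    -- the iterated `q`-integrals defining `G₁` and `W₁` converge absolutely
    (NcHO.QIntegrable NcHO.thetaForm ∧ NcHO.QIntegrable (NcHO.qInt NcHO.thetaForm) ∧
      NcHO.QIntegrable (NcHO.qInt (NcHO.qInt NcHO.thetaForm)) ∧
      NcHO.QIntegrable NcHO.kernel ∧ NcHO.QIntegrable (NcHO.qInt NcHO.kernel)) ∧
    NcHO.IsAutomorphicIntegral NcHO.thetaGroup (-2) (fun τ : ℍ => NcHO.G₁ τ) ∧
    -- `w₂` and `w₄` stand for the functions `w_2(t(τ))` and `w_4(t(τ))`, which exist uniquely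
    ∃ w₂ w₄ : ℍ → ℂ,
      (∀ w : ℍ → ℂ, NcHO.IsGenFun 2 w ↔ w = w₂) ∧
      (∀ w : ℍ → ℂ, NcHO.IsGenFun 4 w ↔ w = w₄) ∧
      (∀ τ : ℍ, w₂ τ = (NcHO.apery 2 0 : ℂ) * (NcHO.θ₄ τ ^ 4 / NcHO.θ₃ τ ^ 2)) ∧
      NcHO.IsFormWithMultiplier (CongruenceSubgroup.Gamma 2) 1 NcHO.χ w₂ ∧
      (∀ τ : ℍ, w₄ τ = (Real.pi : ℂ) ^ 2 * w₂ τ + NcHO.W₁ w₂ τ) ∧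
      (∀ τ : ℍ, NcHO.W₁ w₂ τ =
        2 * (Real.pi : ℂ) * Complex.I / (16 * (Real.pi : ℂ) ^ 2) * w₂ τ * deriv NcHO.G₁ τ) := by
  have hf := NcHO.isNomeFun_thetaForm
  have h2 : (0 : ℝ) < 2 := two_pos
  obtain ⟨W, hqq, hW⟩ := NcHO.exists_primitive_primitive_thetaForm
  have hk1 : ∀ τ : ℂ, 0 < τ.im →
      NcHO.qInt NcHO.kernel τ = -1 / 4 * NcHO.qInt NcHO.thetaForm τ := fun τ hτ => by
    rw [NcHO.qInt_congr (fun τ hτ => NcHO.kernel_eq hτ) hτ, NcHO.qInt_const_mul]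
  have hk2 : ∀ τ : ℂ, 0 < τ.im → NcHO.qInt (NcHO.qInt NcHO.kernel) τ =
      -1 / 4 * NcHO.qInt (NcHO.qInt NcHO.thetaForm) τ := fun τ hτ => by
    rw [NcHO.qInt_congr hk1 hτ, NcHO.qInt_const_mul]
  let w₂ : ℍ → ℂ := fun τ => NcHO.apery 2 0 * NcHO.thetaQuot τ
  have hform := NcHO.isFormWithMultiplier_thetaQuot (NcHO.apery 2 0)
  have hquot : ∀ τ : ℍ, NcHO.thetaQuot τ =
      (1 - NcHO.nomeLambda (Function.Periodic.qParam 2 τ)) *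
        NcHO.squareSum (Function.Periodic.qParam 2 τ) ^ 2 := fun τ => by
    have hx := NcHO.norm_qParam_two_lt_one τ.im_pos
    have ha := NcHO.squareSum_ne_zero hx
    rw [NcHO.one_sub_nomeLambda hx, NcHO.thetaQuot, NcHO.θ₃_eq, NcHO.θ₄_eq]
    field_simp
  have hgen2 : NcHO.IsGenFun 2 w₂ :=
    NcHO.isGenFun_of_eventually (m := 0) hform.holo (hW.mono fun _ h => h.1) fun τ => by
      simp only [w₂, hquot]
      ring
  have hgen4 : NcHO.IsGenFun 4 fun τ => (Real.pi : ℂ) ^ 2 * w₂ τ + NcHO.W₁ w₂ τ := by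
    refine NcHO.isGenFun_of_eventually (m := 2) ?_ (hW.mono fun _ h => h.2) fun τ => ?_
    · have hqd : MDiff fun τ : ℍ => NcHO.qInt (NcHO.qInt NcHO.kernel) τ :=
        NcHO.mdiff_of_differentiableAt fun τ hτ =>
          ((hf.qInt h2).hasDerivAt_qInt h2 hτ).differentiableAt.const_mul (-1 / 4)
            |>.congr_of_eventuallyEq (by
              filter_upwards [NcHO.eventually_im_pos hτ] with z hz using hk2 z hz)
      exact (hform.holo.const_smul ((Real.pi : ℂ) ^ 2)).add (hform.holo.mul hqd)
    · simp only [w₂, NcHO.W₁, hk2 τ τ.im_pos, hqq τ τ.im_pos, hquot]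
      ring
  refine ⟨⟨hf.qIntegrable h2, (hf.qInt h2).qIntegrable h2, ((hf.qInt h2).qInt h2).qIntegrable h2,
    NcHO.qIntegrable_congr (fun τ hτ => NcHO.kernel_eq hτ)
      fun τ => (hf.qIntegrable h2 τ).const_mul _,
    NcHO.qIntegrable_congr hk1 fun τ => ((hf.qInt h2).qIntegrable h2 τ).const_mul _⟩,
    NcHO.isAutomorphicIntegral_G₁, w₂, _, hgen2.iff_eq, hgen4.iff_eq, fun _ => rfl, hform,
    fun _ => rfl, fun τ => ?_⟩
  have hG : deriv NcHO.G₁ τ = _ :=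
    (((hf.qInt h2).qInt h2).hasDerivAt_qInt h2 τ.im_pos).deriv
  have hpi : (Real.pi : ℂ) ≠ 0 := by exact_mod_cast Real.pi_ne_zero
  rw [hG, NcHO.W₁, hk2 τ τ.im_pos]
  field_simp
  linear_combination (-16) * w₂ τ * NcHO.qInt (NcHO.qInt NcHO.thetaForm) τ * Complex.I_sq
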